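/- **Setting.** Consider a phase space with $n$ bosonic and $m$ fermionic canonical pairs $(q^A,p_A)$, coordinates $x^M$ of grading $\#_M$ (the real bosonic coordinates range over all of $\mathbb R^{2n}$), and a finite number of Grassmann parameters. All functions $F(x,t)$ are smooth superfunctions, i.e. polynomials in the fermionic coordinates and the parameters whose coefficients are real $C^\infty$ functions of $t$ and the bosonic coordinates; points and curves $x(t)$ have coordinates in real Grassmann algebras with arbitrarily (finitely) many generators, containing the parameters. The graded Poisson bracket is $$[F,G\}=\sum_A\Big((-1)^{\#_A}\frac{\overleftarrow\partial F}{\partial q^A}\frac{\overrightarrow\partial G}{\partial p_A}-\frac{\overleftarrow\partial F}{\partial p_A}\frac{\overrightarrow\partial G}{\partial q^A}\Big),\qquad J^{MN}=[x^M,x^N\}.$$ A *total Hamiltonian system* consists of a bosonic Hamiltonian $H(x,t)$ and a complete set of regular constraints $\phi_h(x,t)$ of definite grading, primary ($\phi_m$) and secondary, with constraint surface $\mathcal V=\{\phi_h=0\ \forall h\}$ (regular: the differentials of the $\phi_h$ are independent on $\mathcal V$). Write $F\approx0$ if $F$ vanishes on $\mathcal V$. Let $U^m(x,t)$ be a solution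 of $[\phi_h,H+\phi_mU^m\}+\partial_t\phi_h\approx0$ for all $h$, and let $V^m{}_i(x,t)$ be a basis, modulo $\approx$, of the solutions of $[\phi_h,\phi_m\}V^m{}_i\approx0$ for all $h$. The primary first-class constraints are $\phi^{1\rm st}_i=\phi_mV^m{}_i$, and the total Hamiltonian is $$H_T(x,t;v,w)=H+\phi_mU^m+\phi^{1\rm st}_i\,v^i(t)+\tfrac12\phi_h\phi_{h'}\,w^{hh'}(t),$$ where the local parameters $v^i,w^{hh'}$ are smooth functions of time only, with values in the algebra of the parameters, graded so that $H_T$ is bosonic, and $w^{hh'}=(-1)^{\#_h\#_{h'}}w^{h'h}$. Solutions are curves on the full phase space with $\dot x^M=[x^M,H_T\}$. Fix $v$ and $w$. An infinitesimal transformation $x^M\to x'^M=x^M+\epsilon\,\delta x^M(x,t)$, with $\delta x^M$ of grading $\#_M$, is a *symmetry* of the system if, to first order in $\epsilon$, 1. it preserves the symplectic structure, $[x'^M,x'^N\}=J^{MN}$; 2. it takes solutions to solutions: there are local parameters $\delta v^i(t),\delta w^{hh'}(t)$ such that for every solution $x(t)$ of $H_T(x,t;v,w)$ the curve $x'(x(t),t)$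 solves the equations of motion of $H_T(x,t;v+\epsilon\delta v,w+\epsilon\delta w)$; 3. it preserves the constraint surface on-shell: $\phi_h(x')=0$ for all $h$ wherever a solution of $H_T(x,t;v,w)$ meets $\mathcal V$. A bosonic function $Q_H(x,t)$ is a *symmetry generator* if $\delta x^M=[x^M,Q_H\}$ is a symmetry, and it is *on-shell first-class* if $[Q_H,\phi_h\}=0$ for all $h$ wherever a solution of $H_T(x,t;v,w)$ meets $\mathcal V$. **Statement.** * An infinitesimal transformation $\delta x$ preserves the symplectic structure to first order if and only if there is a bosonic function $Q_H(x,t)$ with $\delta x^M=[x^M,Q_H\}$ for all $M$. In particular every symmetry is generated by a function. * Every symmetry generator is on-shell first-class. * Let the bosonic function $Q_H$ be on-shell first-class. Then $Q_H$ is a symmetry generator if and only if, after the addition to $Q_H$ of a suitable smooth bosonic function $c(t)$ of time only, with values in the algebra of the parameters (which does not change $\delta x$), there are local parameters $\delta v^i(t)$, $\delta w^{hh'}(t)$ such that, on the whole phase space and for all $t$, $$[Q_H,H_T\}+\frac{\partial Q_H}{\partial t}=\phi^{1\rm st}_i\,\delta v^i+\tfrac12\,\phi_h\phi_{h'}\,\delta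 w^{hh'}.$$ -/

import Mathlib

open scoped ContDiff

noncomputable section

/-! ## Grassmann algebras

`Grassmann r` is the real Grassmann algebra on `r` anticommuting generators `ζ₀, …, ζ_{r-1}`.  An
element is given by its coefficients in the basis of the monomials `ζ_I`, `I ⊆ {0, …, r-1}`, each
monomial being the product of its generators in increasing order. -/

def Grassmann (r : ℕ) : Type := Finset (Fin r) → ℝ

namespace Grassmann

instance (r : ℕ) : NormedAddCommGroup (Grassmann r) :=
  inferInstanceAs (NormedAddCommGroup (Finset (Fin r) → ℝ))

instance (r : ℕ) : NormedSpace ℝ (Grassmann r) :=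
  inferInstanceAs (NormedSpace ℝ (Finset (Fin r) → ℝ))

/-- The number of transpositions needed to sort `ζ_I ζ_J`. -/
def inversions {r : ℕ} (I J : Finset (Fin r)) : ℕ :=
  ((I ×ˢ J).filter (fun e => e.2 < e.1)).card

/-- The Grassmann product: `ζ_I ζ_J = ± ζ_{I ∪ J}` for disjoint `I`, `J`, and `0` otherwise. -/
instance (r : ℕ) : Mul (Grassmann r) :=
  ⟨fun a b K => ∑ I ∈ K.powerset, (-1 : ℝ) ^ inversions I (K \ I) * (a I * b (K \ I))⟩

instance (r : ℕ) : One (Grassmann r) := ⟨fun I => if I = ∅ then 1 else 0⟩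

/-- The generator `ζ_i`. -/
def gen {r : ℕ} (i : Fin r) : Grassmann r := fun I => if I = {i} then 1 else 0

/-- The body (the coefficient of `1`). -/
def body {r : ℕ} (a : Grassmann r) : ℝ := a ∅

/-- The soul (the nilpotent part). -/
def soul {r : ℕ} (a : Grassmann r) : Grassmann r := fun I => if I = ∅ then 0 else a I

/-- `a` is homogeneous of parity `ε` (`0`: bosonic, `1`: fermionic). -/
def HasParity {r : ℕ} (ε : ZMod 2) (a : Grassmann r) : Prop :=
  ∀ I, a I ≠ 0 → (I.card : ZMod 2) = ε

/-- The derivative with respect to `ζ_g` acting from the left. -/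
def leftDeriv {r : ℕ} (g : Fin r) (a : Grassmann r) : Grassmann r := fun I =>
  if g ∈ I then 0 else (-1 : ℝ) ^ (I.filter (fun j => j < g)).card * a (insert g I)

/-- The derivative with respect to `ζ_g` acting from the right. -/
def rightDeriv {r : ℕ} (g : Fin r) (a : Grassmann r) : Grassmann r := fun I =>
  if g ∈ I then 0 else (-1 : ℝ) ^ (I.filter (fun j => g < j)).card * a (insert g I)

/-- The algebra map `ζ_i ↦ ζ_{f i}` for an increasing renaming `f` of the generators. -/
def rename {r s : ℕ} (f : Fin r ↪o Fin s) (a : Grassmann r) : Grassmann s := fun J =>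
  ∑ I : Finset (Fin r), if I.map f.toEmbedding = J then a I else 0

end Grassmann

/-! ## Functions on the graded phase space

There are `n` bosonic and `m` fermionic canonical pairs `(q^A, p_A)`. -/

/-- The index `A`: `inl` bosonic, `inr` fermionic. -/
abbrev PairIdx (n m : ℕ) : Type := Fin n ⊕ Fin m

/-- The index `M` of the phase space coordinates: `x^(inl A) = q^A` and `x^(inr A) = p_A`. -/
abbrev CoordIdx (n m : ℕ) : Type := PairIdx n m ⊕ PairIdx n m

/-- The grading of the coordinates. -/
def coordParity {n m : ℕ} : CoordIdx n m → ZMod 2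
  | .inl (.inl _) => 0
  | .inl (.inr _) => 1
  | .inr (.inl _) => 0
  | .inr (.inr _) => 1

/-- A function `F(q, p, t)` on the graded phase space, with Grassmann parameters
`ζ₀, …, ζ_{P-1}`: the expansion of `F` in the fermionic coordinates and in the parameters, whose
coefficients are functions of the time and of the (real) bosonic coordinates.  The first `m`
generators are the fermionic `q`'s, the next `m` the fermionic `p`'s, the last `P` the
parameters. -/
abbrev SuperFun (n m P : ℕ) : Type :=
  ℝ × (Fin n ⊕ Fin n → ℝ) → Grassmann (m + m + P)

namespace SuperFun

variable {n m P : ℕ}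

/-- The generator that stands for the fermionic coordinate `q^μ`. -/
def qGen (P : ℕ) {m : ℕ} (μ : Fin m) : Fin (m + m + P) := Fin.castAdd P (Fin.castAdd m μ)

/-- The generator that stands for the fermionic momentum `p_μ`. -/
def pGen (P : ℕ) {m : ℕ} (μ : Fin m) : Fin (m + m + P) := Fin.castAdd P (Fin.natAdd m μ)

def Smooth (F : SuperFun n m P) : Prop := ContDiff ℝ ∞ F

def HasParity (ε : ZMod 2) (F : SuperFun n m P) : Prop := ∀ z, (F z).HasParity ε

/-- The coordinate `x^M` as a function on phase space. -/
def coord (P : ℕ) {n m : ℕ} : CoordIdx n m → SuperFun n m P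
  | .inl (.inl i) => fun z => z.2 (.inl i) • (1 : Grassmann (m + m + P))
  | .inl (.inr μ) => fun _ => Grassmann.gen (qGen P μ)
  | .inr (.inl i) => fun z => z.2 (.inr i) • (1 : Grassmann (m + m + P))
  | .inr (.inr μ) => fun _ => Grassmann.gen (pGen P μ)

/-- The partial derivative with respect to `x^M` acting from the left. -/
def leftPD : CoordIdx n m → SuperFun n m P → SuperFun n m P
  | .inl (.inl i), F => fun z => fderiv ℝ F z (0, Pi.single (.inl i) 1)
  | .inl (.inr μ), F => fun z => (F z).leftDeriv (qGen P μ)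
  | .inr (.inl i), F => fun z => fderiv ℝ F z (0, Pi.single (.inr i) 1)
  | .inr (.inr μ), F => fun z => (F z).leftDeriv (pGen P μ)

/-- The partial derivative with respect to `x^M` acting from the right. -/
def rightPD : CoordIdx n m → SuperFun n m P → SuperFun n m P
  | .inl (.inl i), F => fun z => fderiv ℝ F z (0, Pi.single (.inl i) 1)
  | .inl (.inr μ), F => fun z => (F z).rightDeriv (qGen P μ)
  | .inr (.inl i), F => fun z => fderiv ℝ F z (0, Pi.single (.inr i) 1)
  | .inr (.inr μ), F => fun z => (F z).rightDeriv (pGen P μ)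

/-- The explicit time derivative `∂F/∂t`. -/
def timePD (F : SuperFun n m P) : SuperFun n m P := fun z => fderiv ℝ F z (1, 0)

/-- `(-1)^{#_A}`. -/
def pairSign : PairIdx n m → ℝ
  | .inl _ => 1
  | .inr _ => -1

/-- The graded Poisson bracket
`[F, G} = ∑_A (-1)^{#_A} (F ∂←/∂q^A) (∂→/∂p_A G) - (F ∂←/∂p_A) (∂→/∂q^A G)`. -/
def bracket (F G : SuperFun n m P) : SuperFun n m P :=
  ∑ A : PairIdx n m,
    (pairSign A • (rightPD (.inl A) F * leftPD (.inr A) G)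
      - rightPD (.inr A) F * leftPD (.inl A) G)

/-- A function of the time alone, with values in the algebra of the parameters, as a function on
phase space. -/
def ofTime (n m : ℕ) {P : ℕ} (c : ℝ → Grassmann P) : SuperFun n m P :=
  fun z => (c z.1).rename (Fin.natAddOrderEmb (m + m))

/-! ### Values at Grassmann-valued points

A point has coordinates `X^M ∈ Grassmann P'`, of the parity of `x^M`, where the algebra
`Grassmann P'` contains the parameters: `P ≤ P'`. -/

/-- The real bosonic coordinates of the body of a point. -/
def bodyPoint {P' : ℕ} (X : CoordIdx n m → Grassmann P') : Fin n ⊕ Fin n → ℝ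
  | .inl i => (X (.inl (.inl i))).body
  | .inr i => (X (.inr (.inl i))).body

/-- The nilpotent even derivation `∑_M ξ^M ∂→/∂x^M`, for constants `ξ^M`. -/
def displace (ξ : CoordIdx n m → Grassmann P) (F : SuperFun n m P) : SuperFun n m P :=
  fun z => ∑ M : CoordIdx n m, (ξ M).rename (Fin.natAddOrderEmb (m + m)) * leftPD M F z

/-- Enlarge the algebra of parameters. -/
def extend {P' : ℕ} (hP : P ≤ P') (F : SuperFun n m P) : SuperFun n m P' :=
  fun z => (F z).rename (Fin.castLEOrderEmb (Nat.add_le_add_left hP (m + m)))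

/-- The value `F(X, t)`.  By Taylor's formula around the body of `X` (where the fermionic
coordinates vanish) it is `∑_k (1/k!) ((∑_M ξ^M ∂_M)^k F)(body X, t)` with `ξ` the soul of `X`; a
product of more than `P'` souls is zero, so that the series stops at `k = P'`.  The last step sets
the fermionic coordinates to zero: it keeps the monomials in the parameters only. -/
def value {P' : ℕ} (hP : P ≤ P') (F : SuperFun n m P) (t : ℝ)
    (X : CoordIdx n m → Grassmann P') : Grassmann P' :=
  fun J =>
    (∑ k ∈ Finset.range (P' + 1), ((k.factorial : ℝ)⁻¹) •
        ((displace (fun M => (X M).soul))^[k] (F.extend hP)) (t, bodyPoint X))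
      (J.map (Fin.natAddOrderEmb (m + m)).toEmbedding)

/-- `X` respects the grading. -/
def IsPoint {P' : ℕ} (X : CoordIdx n m → Grassmann P') : Prop :=
  ∀ M, (X M).HasParity (coordParity M)

/-- `t ↦ X t` solves `ẋ^M = [x^M, H}` on the open interval `(a, b)`. -/
structure IsSolution (H : SuperFun n m P) {P' : ℕ} (hP : P ≤ P') (a b : ℝ)
    (X : ℝ → CoordIdx n m → Grassmann P') : Prop where
  isPoint : ∀ t ∈ Set.Ioo a b, IsPoint (X t)
  motion : ∀ t ∈ Set.Ioo a b, ∀ M,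
    HasDerivAt (fun s => X s M) (value hP (bracket (coord P M) H) t (X t)) t

/-- The point `X + ε δx(X, t)`. -/
def shift (δx : CoordIdx n m → SuperFun n m P) {P' : ℕ} (hP : P ≤ P') (ε t : ℝ)
    (X : CoordIdx n m → Grassmann P') : CoordIdx n m → Grassmann P' :=
  fun M => X M + ε • value hP (δx M) t X

/-- An infinitesimal transformation `x^M ↦ x^M + ε δx^M(x, t)` of phase space. -/
structure IsTransformation (δx : CoordIdx n m → SuperFun n m P) : Prop where
  smooth : ∀ M, Smooth (δx M)
  parity : ∀ M, HasParity (coordParity M) (δx M)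

/-- `x'^M = x^M + ε δx^M` preserves the symplectic structure to first order in `ε`: the derivative
of `[x'^M, x'^N}` at `ε = 0` vanishes. -/
def PreservesSymplectic (δx : CoordIdx n m → SuperFun n m P) : Prop :=
  ∀ M N z, HasDerivAt
    (fun ε : ℝ => bracket (coord P M + ε • δx M) (coord P N + ε • δx N) z) 0 0

/-- The point `X` lies at time `t` on the surface `φ_h = 0` for all `h`. -/
def OnSurface {ι : Type} (φ : ι → SuperFun n m P) {P' : ℕ} (hP : P ≤ P') (t : ℝ)
    (X : CoordIdx n m → Grassmann P') : Prop :=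
  ∀ h, value hP (φ h) t X = 0

/-- Weak vanishing `F ≈ 0`: the function `F` vanishes on the surface `φ_h = 0`. -/
def WeaklyZero {ι : Type} (φ : ι → SuperFun n m P) (F : SuperFun n m P) : Prop :=
  ∀ (P' : ℕ) (hP : P ≤ P') (t : ℝ) (X : CoordIdx n m → Grassmann P'), IsPoint X →
    OnSurface φ hP t X → value hP F t X = 0

end SuperFun

/-! ## Total Hamiltonian systems -/

open SuperFun in
/-- The data of a total Hamiltonian system after the analysis of the constraints, apart from the
local parameters: the canonical Hamiltonian `H`, the complete set of constraints `φ_h` (`inl`: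
primary, `inr`: secondary), a particular solution `U^m` of the conditions which say that the
constraints are preserved, and a basis `V^m_i` of the solutions of the homogeneous conditions. -/
structure TotalHamiltonianSystem (n m P : ℕ) where
  numPrimary : ℕ
  numSecondary : ℕ
  numFirstClass : ℕ
  ham : SuperFun n m P
  ham_smooth : Smooth ham
  ham_even : HasParity 0 ham
  phi : Fin numPrimary ⊕ Fin numSecondary → SuperFun n m P
  phiParity : Fin numPrimary ⊕ Fin numSecondary → ZMod 2
  phi_smooth : ∀ h, Smooth (phi h)
  phi_parity : ∀ h, HasParity (phiParity h) (phi h)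
  U : Fin numPrimary → SuperFun n m P
  U_smooth : ∀ k, Smooth (U k)
  U_parity : ∀ k, HasParity (phiParity (.inl k)) (U k)
  V : Fin numPrimary → Fin numFirstClass → SuperFun n m P
  fcParity : Fin numFirstClass → ZMod 2
  V_smooth : ∀ k i, Smooth (V k i)
  V_parity : ∀ k i, HasParity (phiParity (.inl k) + fcParity i) (V k i)
  /-- The differentials of the constraints are linearly independent on the constraint surface. -/
  regular : ∀ (P' : ℕ) (hP : P ≤ P') (t : ℝ) (X : CoordIdx n m → Grassmann P'), IsPoint X →
    OnSurface phi hP t X →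
      LinearIndependent ℝ (fun h => fun M : CoordIdx n m =>
        (value hP (leftPD M (phi h)) t X).body)
  /-- The evolution with `u^m = U^m` preserves the constraints. -/
  preserved : ∀ h, WeaklyZero phi
    (bracket (phi h) (ham + ∑ k, phi (.inl k) * U k) + timePD (phi h))
  /-- The `V^m_i` solve the homogeneous conditions … -/
  V_kernel : ∀ h i, WeaklyZero phi (∑ k, bracket (phi h) (phi (.inl k)) * V k i)
  /-- … they span the solutions … -/
  V_span : ∀ u : Fin numPrimary → SuperFun n m P, (∀ k, Smooth (u k)) →
    (∀ h, WeaklyZero phi (∑ k, bracket (phi h) (phi (.inl k)) * u k)) →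
      ∃ a : Fin numFirstClass → SuperFun n m P, (∀ i, Smooth (a i)) ∧
        ∀ k, WeaklyZero phi (u k - ∑ i, V k i * a i)
  /-- … and they are independent. -/
  V_indep : ∀ a : Fin numFirstClass → SuperFun n m P, (∀ i, Smooth (a i)) →
    (∀ k, WeaklyZero phi (∑ i, V k i * a i)) → ∀ i, WeaklyZero phi (a i)

namespace TotalHamiltonianSystem

open SuperFun

variable {n m P : ℕ} (S : TotalHamiltonianSystem n m P)

/-- The index `h` of the constraints, primary and secondary. -/
abbrev ConstraintIdx : Type := Fin S.numPrimary ⊕ Fin S.numSecondary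

/-- `H' = H + φ_m U^m`. -/
def hamPrime : SuperFun n m P := S.ham + ∑ k, S.phi (.inl k) * S.U k

/-- The primary first-class constraints `φ¹ˢᵗ_i = φ_m V^m_i`. -/
def firstClass (i : Fin S.numFirstClass) : SuperFun n m P := ∑ k, S.phi (.inl k) * S.V k i

/-- `v^i(t)`, `w^{hh'}(t)` are admissible local parameters: smooth functions of time, of the parity
that makes `φ¹ˢᵗ_i v^i` and `φ_h φ_h' w^{hh'}` bosonic, and `w^{hh'} = (-1)^{#_h #_h'} w^{h'h}`. -/
structure IsLocalParam (v : Fin S.numFirstClass → ℝ → Grassmann P)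
    (w : S.ConstraintIdx → S.ConstraintIdx → ℝ → Grassmann P) : Prop where
  v_smooth : ∀ i, ContDiff ℝ ∞ (v i)
  v_parity : ∀ i t, (v i t).HasParity (S.fcParity i)
  w_smooth : ∀ h h', ContDiff ℝ ∞ (w h h')
  w_parity : ∀ h h' t, (w h h' t).HasParity (S.phiParity h + S.phiParity h')
  w_symm : ∀ h h' t,
    w h h' t = (-1 : ℝ) ^ ((S.phiParity h).val * (S.phiParity h').val) • w h' h t

/-- `φ¹ˢᵗ_i v^i + ½ φ_h φ_h' w^{hh'}`. -/
def gaugeTerms (v : Fin S.numFirstClass → ℝ → Grassmann P)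
    (w : S.ConstraintIdx → S.ConstraintIdx → ℝ → Grassmann P) : SuperFun n m P :=
  ∑ i, S.firstClass i * ofTime n m (v i)
    + (1 / 2 : ℝ) • ∑ h, ∑ h', S.phi h * S.phi h' * ofTime n m (w h h')

/-- The total Hamiltonian `H_T(x, t; v, w) = H' + φ¹ˢᵗ_i v^i + ½ φ_h φ_h' w^{hh'}`. -/
def totalHam (v : Fin S.numFirstClass → ℝ → Grassmann P)
    (w : S.ConstraintIdx → S.ConstraintIdx → ℝ → Grassmann P) : SuperFun n m P :=
  S.hamPrime + S.gaugeTerms v w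

variable (v : Fin S.numFirstClass → ℝ → Grassmann P)
  (w : S.ConstraintIdx → S.ConstraintIdx → ℝ → Grassmann P)

/-- `x ↦ x + ε δx` takes, to first order in `ε`, solutions of `H_T(v, w)` to solutions of
`H_T(v + ε δv, w + ε δw)` for some `δv(t)`, `δw(t)`: along each solution `X`, the curve
`Y_ε(s) = X(s) + ε δx(X(s), s)` has a velocity `Y'_ε` such that
`Y'_ε - [x, H_T(v + ε δv, w + ε δw)}(Y_ε, t)` has derivative zero at `ε = 0`. -/
def PreservesSolutions (δx : CoordIdx n m → SuperFun n m P) : Prop :=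
  ∃ (δv : Fin S.numFirstClass → ℝ → Grassmann P)
    (δw : S.ConstraintIdx → S.ConstraintIdx → ℝ → Grassmann P),
    S.IsLocalParam δv δw ∧
    ∀ (P' : ℕ) (hP : P ≤ P') (a b : ℝ) (X : ℝ → CoordIdx n m → Grassmann P'),
      IsSolution (S.totalHam v w) hP a b X → ∀ t ∈ Set.Ioo a b, ∀ M,
        ∃ Y' : ℝ → Grassmann P',
          (∀ ε, HasDerivAt (fun s => shift δx hP ε s (X s) M) (Y' ε) t) ∧
          HasDerivAt (fun ε => Y' ε -
            value hP (bracket (coord P M) (S.totalHam (v + ε • δv) (w + ε • δw))) t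
              (shift δx hP ε t (X t))) 0 0

/-- `x ↦ x + ε δx` preserves the constraint surface on-shell, to first order in `ε`: where a
solution of `H_T(v, w)` meets the surface, `φ_h(x + ε δx)` has derivative zero at `ε = 0`. -/
def PreservesSurface (δx : CoordIdx n m → SuperFun n m P) : Prop :=
  ∀ (P' : ℕ) (hP : P ≤ P') (a b : ℝ) (X : ℝ → CoordIdx n m → Grassmann P'),
    IsSolution (S.totalHam v w) hP a b X → ∀ t ∈ Set.Ioo a b, OnSurface S.phi hP t (X t) →
      ∀ h, HasDerivAt (fun ε => value hP (S.phi h) t (shift δx hP ε t (X t))) 0 0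

/-- An infinitesimal symmetry of the system with total Hamiltonian `H_T(v, w)`. -/
structure IsSymmetry (δx : CoordIdx n m → SuperFun n m P) : Prop where
  transformation : IsTransformation δx
  symplectic : PreservesSymplectic δx
  solutions : S.PreservesSolutions v w δx
  surface : S.PreservesSurface v w δx

/-- `Q` generates a symmetry: `δx^M = [x^M, Q}` is an infinitesimal symmetry. -/
def IsSymmetryGenerator (Q : SuperFun n m P) : Prop :=
  S.IsSymmetry v w (fun M => bracket (coord P M) Q)

/-- `Q` is first-class on-shell: `[Q, φ_h}` vanishes for all `h` wherever a solution of
`H_T(v, w)` meets the constraint surface. -/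
def IsFirstClassOnShell (Q : SuperFun n m P) : Prop :=
  ∀ (P' : ℕ) (hP : P ≤ P') (a b : ℝ) (X : ℝ → CoordIdx n m → Grassmann P'),
    IsSolution (S.totalHam v w) hP a b X → ∀ t ∈ Set.Ioo a b, OnSurface S.phi hP t (X t) →
      ∀ h, value hP (bracket Q (S.phi h)) t (X t) = 0

end TotalHamiltonianSystem

end

/-!
Functions on the graded phase space are tested at points with coordinates in Grassmann algebras.
The value of `F` at such a point is obtained by applying the exponential of the nilpotent derivation
`∑_M ξ^M ∂_M`, with `ξ` the soul of the point, and evaluating at its body.  The exponential of a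
derivation is an algebra homomorphism (`value_mul`), and differentiating it along a line gives the
chain rule (`hasDerivAt_value_curve`, `hasDerivAt_value_shift`).  Evaluation at a point whose
fermionic coordinates are new generators shows that a function is determined by its values
(`eq_zero_of_value_eq_zero`).

*Symplectic transformations.*  To first order, `[x'^M, x'^N} = J^{MN}` says that the form
`∑_M dx^M η_M` obtained by lowering the index of `δx` is closed in the graded sense.  The Poincaré
lemma `leftPD_superPotential` gives a potential `Q`: the coefficient of a monomial that contains a
fermionic coordinate is read off from the derivative with respect to that coordinate, and for the
monomials in the parameters alone the homotopy formula over the real bosonic coordinates is used.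

*The constraint surface.*  Under `δx^M = [x^M, Q}` a function `F` changes by `-[Q, F}` to first
order (`hasDerivAt_value_shift_bracket`), so that preserving the constraint surface on-shell and
being first-class on-shell are the same condition.

*Solutions.*  By the Jacobi identity for `x^M`, `Q` and `H_T` (`leftPD_bracket`), the shifted curve
fails to solve the equations of motion with `v + ε δv` and `w + ε δw`, to first order, by the value
of `[x^M, K}`, where `K = [Q, H_T} + ∂_t Q - φ¹ˢᵗ_i δv^i - ½ φ_h φ_h' δw^{hh'}`
(`hasDerivAt_defect`).  If `Q` generates a symmetry, this vanishes along all solutions.  A solution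
passes through each point at each time (`exists_isSolution`), so all partial derivatives of `K`
vanish and `K` is a function of time (`exists_eq_ofTime`).  Adding to `Q` minus an antiderivative
of it makes `K` zero.  The converse is read off from the same formula.
-/

noncomputable section

/-! ### The Grassmann algebra -/

namespace Grassmann

variable {r s : ℕ}

theorem inversions_union_left {I I' : Finset (Fin r)} (h : Disjoint I I') (J : Finset (Fin r)) :
    inversions (I ∪ I') J = inversions I J + inversions I' J := by
  unfold inversions
  rw [Finset.union_product, Finset.filter_union, Finset.card_union_of_disjoint]
  exact Finset.disjoint_filter_filter (Finset.disjoint_product.2 (Or.inl h))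

theorem inversions_union_right (I : Finset (Fin r)) {J J' : Finset (Fin r)} (h : Disjoint J J') :
    inversions I (J ∪ J') = inversions I J + inversions I J' := by
  unfold inversions
  rw [Finset.product_union, Finset.filter_union, Finset.card_union_of_disjoint]
  exact Finset.disjoint_filter_filter (Finset.disjoint_product.2 (Or.inr h))

theorem inversions_singleton_left (g : Fin r) (I : Finset (Fin r)) :
    inversions {g} I = (I.filter (fun j => j < g)).card := by
  unfold inversions
  rw [Finset.singleton_product, Finset.filter_map, Finset.card_map]
  rfl

theorem inversions_singleton_right (I : Finset (Fin r)) (g : Fin r) :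
    inversions I {g} = (I.filter (fun j => g < j)).card := by
  unfold inversions
  rw [Finset.product_singleton, Finset.filter_map, Finset.card_map]
  rfl

/-- A pair of generators is out of order in exactly one of `ζ_I ζ_J` and `ζ_J ζ_I`. -/
theorem inversions_add_inversions {I J : Finset (Fin r)} (h : Disjoint I J) :
    inversions I J + inversions J I = I.card * J.card := by
  have h1 : inversions J I = ((I ×ˢ J).filter (fun e => ¬ e.2 < e.1)).card := by
    unfold inversions
    refine Finset.card_bij (fun e _ => (e.2, e.1)) ?_ ?_ ?_
    · rintro ⟨a, b⟩ hab
      simp only [Finset.mem_filter, Finset.mem_product] at hab ⊢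
      exact ⟨⟨hab.1.2, hab.1.1⟩, not_lt.2 hab.2.le⟩
    · rintro ⟨a, b⟩ _ ⟨c, d⟩ _ hh
      simp_all
    · rintro ⟨a, b⟩ hab
      simp only [Finset.mem_filter, Finset.mem_product, not_lt] at hab
      refine ⟨(b, a), ?_, rfl⟩
      simp only [Finset.mem_filter, Finset.mem_product]
      refine ⟨⟨hab.1.2, hab.1.1⟩, lt_of_le_of_ne hab.2 fun hne => ?_⟩
      exact Finset.disjoint_left.1 h hab.1.1 (hne ▸ hab.1.2)
  rw [h1, inversions, Finset.card_filter_add_card_filter_not, Finset.card_product]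

/-- The monomial `ζ_I`. -/
def mono (I : Finset (Fin r)) : Grassmann r := fun K => if K = I then 1 else 0

theorem mul_apply (a b : Grassmann r) (K : Finset (Fin r)) :
    (a * b) K = ∑ I ∈ K.powerset, (-1 : ℝ) ^ inversions I (K \ I) * (a I * b (K \ I)) := rfl

theorem add_apply (a b : Grassmann r) (K : Finset (Fin r)) : (a + b) K = a K + b K := rfl

theorem neg_apply (a : Grassmann r) (K : Finset (Fin r)) : (-a) K = -a K := rfl

theorem smul_apply (c : ℝ) (a : Grassmann r) (K : Finset (Fin r)) : (c • a) K = c * a K := rfl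

theorem zero_apply (K : Finset (Fin r)) : (0 : Grassmann r) K = 0 := rfl

theorem one_apply (K : Finset (Fin r)) : (1 : Grassmann r) K = if K = ∅ then 1 else 0 := rfl

theorem one_eq_mono : (1 : Grassmann r) = mono ∅ := rfl

theorem gen_eq_mono (g : Fin r) : gen g = mono {g} := rfl

@[ext] theorem ext {a b : Grassmann r} (h : ∀ K, a K = b K) : a = b := funext h

/-- The coefficient of `ζ_I`, as a linear map. -/
def coeff (I : Finset (Fin r)) : Grassmann r →ₗ[ℝ] ℝ where
  toFun a := a I
  map_add' _ _ := rfl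
  map_smul' _ _ := rfl

theorem sum_apply {ι : Type*} (t : Finset ι) (a : ι → Grassmann r) (K : Finset (Fin r)) :
    (∑ i ∈ t, a i) K = ∑ i ∈ t, a i K :=
  map_sum (coeff K) a t

theorem eq_sum_mono (a : Grassmann r) : a = ∑ I, a I • mono I := by
  ext K
  simp only [sum_apply, smul_apply, mono, mul_ite, mul_one, mul_zero]
  exact ((Finset.sum_ite_eq Finset.univ K fun I => a I).trans (if_pos (Finset.mem_univ K))).symm

theorem induction_mono {p : Grassmann r → Prop} (hadd : ∀ a b, p a → p b → p (a + b))
    (hmono : ∀ (c : ℝ) I, p (c • mono I)) (a : Grassmann r) : p a := by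
  rw [eq_sum_mono a]
  refine Finset.sum_induction _ p hadd ?_ fun I _ => hmono _ I
  simpa using hmono 0 ∅

protected theorem add_mul (a b c : Grassmann r) : (a + b) * c = a * c + b * c := by
  ext K
  simp only [mul_apply, add_apply, ← Finset.sum_add_distrib]
  exact Finset.sum_congr rfl fun _ _ => by ring

protected theorem mul_add (a b c : Grassmann r) : a * (b + c) = a * b + a * c := by
  ext K
  simp only [mul_apply, add_apply, ← Finset.sum_add_distrib]
  exact Finset.sum_congr rfl fun _ _ => by ring

protected theorem smul_mul (x : ℝ) (a b : Grassmann r) : (x • a) * b = x • (a * b) := by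
  ext K
  simp only [mul_apply, smul_apply, Finset.mul_sum]
  exact Finset.sum_congr rfl fun _ _ => by ring

protected theorem mul_smul' (x : ℝ) (a b : Grassmann r) : a * (x • b) = x • (a * b) := by
  ext K
  simp only [mul_apply, smul_apply, Finset.mul_sum]
  exact Finset.sum_congr rfl fun _ _ => by ring

theorem mono_mul_mono (I J : Finset (Fin r)) :
    mono I * mono J = if Disjoint I J then (-1 : ℝ) ^ inversions I J • mono (I ∪ J) else 0 := by
  ext K
  rw [mul_apply]
  have key : ∀ A ∈ K.powerset, (-1 : ℝ) ^ inversions A (K \ A) * (mono I A * mono J (K \ A))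
      = if A = I then (if I ⊆ K ∧ K \ I = J then (-1 : ℝ) ^ inversions I J else 0) else 0 := by
    intro A hA
    rw [Finset.mem_powerset] at hA
    unfold mono
    split_ifs with h1 h2 h3 h4
    · subst h1; rw [h2]; ring
    · subst h1; exact absurd ⟨hA, h2⟩ h3
    · subst h1; exact absurd h4.2 h2
    · ring
    · ring
    · ring
  rw [Finset.sum_congr rfl key, Finset.sum_ite_eq']
  by_cases hd : Disjoint I J
  · rw [if_pos hd, smul_apply, mono]
    by_cases hK : K = I ∪ J
    · subst hK
      rw [if_pos (Finset.mem_powerset.2 Finset.subset_union_left), if_pos, if_pos rfl, mul_one]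
      exact ⟨Finset.subset_union_left, Finset.union_sdiff_cancel_left hd⟩
    · rw [if_neg hK, mul_zero]
      split_ifs with h1 h2
      · exact absurd (by rw [← h2.2, Finset.union_sdiff_of_subset h2.1]) hK
      · rfl
      · rfl
  · rw [if_neg hd, zero_apply]
    split_ifs with h1 h2
    · exact absurd (h2.2 ▸ Finset.disjoint_sdiff) hd
    · rfl
    · rfl

protected theorem mul_assoc (a b c : Grassmann r) : a * b * c = a * (b * c) := by
  induction a using induction_mono with
  | hadd a a' h h' => simp only [Grassmann.add_mul, h, h']
  | hmono x I =>
  induction b using induction_mono with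
  | hadd b b' h h' => simp only [Grassmann.add_mul, Grassmann.mul_add, h, h']
  | hmono y J =>
  induction c using induction_mono with
  | hadd c c' h h' => simp only [Grassmann.mul_add, h, h']
  | hmono z K =>
  simp only [Grassmann.smul_mul, Grassmann.mul_smul']
  congr 3
  have z0 : ∀ a : Grassmann r, 0 * a = 0 := fun a => by
    have := Grassmann.smul_mul 0 a a
    simpa using this
  have z1 : ∀ a : Grassmann r, a * 0 = 0 := fun a => by
    have := Grassmann.mul_smul' 0 a a
    simpa using this
  simp only [mono_mul_mono]
  by_cases h1 : Disjoint I J <;> by_cases h2 : Disjoint J K <;> by_cases h3 : Disjoint I K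
  · rw [if_pos h1, if_pos h2, Grassmann.smul_mul, Grassmann.mul_smul', mono_mul_mono,
      mono_mul_mono, if_pos (Finset.disjoint_union_left.2 ⟨h3, h2⟩),
      if_pos (Finset.disjoint_union_right.2 ⟨h1, h3⟩), smul_smul, smul_smul, Finset.union_assoc,
      ← pow_add, ← pow_add, inversions_union_left h1, inversions_union_right _ h2]
    congr 2
    ring
  all_goals
    simp_all [Grassmann.smul_mul, Grassmann.mul_smul', mono_mul_mono]

/-- The ring structure is scoped: outside the namespace, sums and scalar multiples are those of the
normed space. -/
scoped instance : Ring (Grassmann r) where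
  __ := (inferInstance : AddCommGroup (Grassmann r))
  mul_assoc := Grassmann.mul_assoc
  left_distrib := Grassmann.mul_add
  right_distrib := Grassmann.add_mul
  one_mul a := by
    ext K
    rw [mul_apply, Finset.sum_eq_single ∅]
    · simp [inversions, one_apply]
    · intro I _ hI
      simp [one_apply, hI]
    · simp
  mul_one a := by
    ext K
    rw [mul_apply, Finset.sum_eq_single K]
    · simp [inversions, one_apply]
    · intro I hI hK
      rw [one_apply, if_neg, mul_zero, mul_zero]
      rw [Finset.sdiff_eq_empty_iff_subset]
      exact fun h => hK (Finset.Subset.antisymm (Finset.mem_powerset.1 hI) h)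
    · simp
  zero_mul a := by
    ext K
    simp [mul_apply, zero_apply]
  mul_zero a := by
    ext K
    simp [mul_apply, zero_apply]

scoped instance : Algebra ℝ (Grassmann r) :=
  Algebra.ofModule Grassmann.smul_mul Grassmann.mul_smul'

instance : FiniteDimensional ℝ (Grassmann r) :=
  inferInstanceAs (FiniteDimensional ℝ (Finset (Fin r) → ℝ))

instance : CompleteSpace (Grassmann r) := FiniteDimensional.complete ℝ _

end Grassmann

/-- The sign `(-1)^ε` of a parity. -/
def paritySign (ε : ZMod 2) : ℝ := if ε = 0 then 1 else -1

theorem paritySign_zero : paritySign 0 = 1 := if_pos rfl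

theorem paritySign_one : paritySign 1 = -1 := if_neg one_ne_zero

theorem eq_zero_or_eq_one (ε : ZMod 2) : ε = 0 ∨ ε = 1 := by
  revert ε
  decide

theorem paritySign_add (ε δ : ZMod 2) : paritySign (ε + δ) = paritySign ε * paritySign δ := by
  rcases eq_zero_or_eq_one ε with rfl | rfl <;> rcases eq_zero_or_eq_one δ with rfl | rfl <;>
    simp [paritySign_zero, paritySign_one, show (1 + 1 : ZMod 2) = 0 from rfl]

theorem paritySign_mul_self (ε : ZMod 2) : paritySign ε * paritySign ε = 1 := by
  rcases eq_zero_or_eq_one ε with rfl | rfl <;> simp [paritySign_zero, paritySign_one]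

theorem paritySign_natCast (k : ℕ) : paritySign (k : ZMod 2) = (-1) ^ k := by
  induction k with
  | zero => simp [paritySign]
  | succ k ih => rw [Nat.cast_succ, paritySign_add, ih, pow_succ, paritySign_one]

namespace Grassmann

variable {r s : ℕ}

/-! ### Parity of elements -/

theorem HasParity.apply_eq_zero {ε : ZMod 2} {a : Grassmann r} (ha : a.HasParity ε)
    {I : Finset (Fin r)} (hI : (I.card : ZMod 2) ≠ ε) : a I = 0 :=
  by_contra fun h => hI (ha I h)

theorem hasParity_iff {ε : ZMod 2} {a : Grassmann r} :
    a.HasParity ε ↔ ∀ I : Finset (Fin r), (I.card : ZMod 2) ≠ ε → a I = 0 :=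
  ⟨fun ha _ hI => ha.apply_eq_zero hI, fun h I hI => by_contra fun hc => hI (h I hc)⟩

theorem HasParity.zero (ε : ZMod 2) : (0 : Grassmann r).HasParity ε :=
  fun _ h => absurd rfl h

theorem HasParity.add {ε : ZMod 2} {a b : Grassmann r} (ha : a.HasParity ε)
    (hb : b.HasParity ε) : (a + b).HasParity ε :=
  hasParity_iff.2 fun I hI => by
    rw [add_apply, ha.apply_eq_zero hI, hb.apply_eq_zero hI, add_zero]

theorem HasParity.smul {ε : ZMod 2} (c : ℝ) {a : Grassmann r} (ha : a.HasParity ε) :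
    (c • a).HasParity ε :=
  hasParity_iff.2 fun I hI => by rw [smul_apply, ha.apply_eq_zero hI, mul_zero]

theorem HasParity.neg {ε : ZMod 2} {a : Grassmann r} (ha : a.HasParity ε) :
    (-a).HasParity ε :=
  hasParity_iff.2 fun I hI => by rw [neg_apply, ha.apply_eq_zero hI, neg_zero]

theorem HasParity.sub {ε : ZMod 2} {a b : Grassmann r} (ha : a.HasParity ε)
    (hb : b.HasParity ε) : (a - b).HasParity ε := by
  rw [sub_eq_add_neg]
  exact ha.add hb.neg

theorem HasParity.sum {ι : Type*} (t : Finset ι) {ε : ZMod 2} {a : ι → Grassmann r}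
    (ha : ∀ i ∈ t, (a i).HasParity ε) : (∑ i ∈ t, a i).HasParity ε :=
  Finset.sum_induction _ (fun x : Grassmann r => x.HasParity ε) (fun _ _ => HasParity.add)
    (HasParity.zero ε) ha

theorem HasParity.mul {ε δ : ZMod 2} {a b : Grassmann r} (ha : a.HasParity ε)
    (hb : b.HasParity δ) : (a * b).HasParity (ε + δ) :=
  hasParity_iff.2 fun K hK => by
    rw [mul_apply]
    refine Finset.sum_eq_zero fun I hI => ?_
    by_cases h1 : (I.card : ZMod 2) = ε
    · by_cases h2 : ((K \ I).card : ZMod 2) = δ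
      · refine absurd ?_ hK
        rw [← h1, ← h2, ← Nat.cast_add, add_comm,
          Finset.card_sdiff_add_card_eq_card (Finset.mem_powerset.1 hI)]
      · rw [hb.apply_eq_zero h2, mul_zero, mul_zero]
    · rw [ha.apply_eq_zero h1, zero_mul, mul_zero]

theorem mono_apply_self (I : Finset (Fin r)) : mono I I = 1 := if_pos rfl

theorem mono_apply_ne {I J : Finset (Fin r)} (h : J ≠ I) : mono I J = 0 := if_neg h

theorem hasParity_mono (I : Finset (Fin r)) : (mono I).HasParity (I.card : ZMod 2) :=
  fun J hJ => by
    by_cases h : J = I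
    · rw [h]
    · exact absurd (mono_apply_ne h) hJ

theorem hasParity_one : (1 : Grassmann r).HasParity 0 := by
  simpa using! hasParity_mono (∅ : Finset (Fin r))

theorem hasParity_gen (g : Fin r) : (gen g).HasParity 1 := by
  simpa using! hasParity_mono ({g} : Finset (Fin r))

/-- An element of parity `ε` is a combination of the monomials of parity `ε`. -/
theorem HasParity.induction_mono {ε : ZMod 2} {p : Grassmann r → Prop}
    (hadd : ∀ a b, p a → p b → p (a + b))
    (hmono : ∀ (c : ℝ) (I : Finset (Fin r)), (I.card : ZMod 2) = ε → p (c • mono I))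
    (hzero : p 0) {a : Grassmann r} (ha : a.HasParity ε) : p a := by
  rw [eq_sum_mono a]
  refine Finset.sum_induction _ p hadd hzero fun I _ => ?_
  by_cases h : (I.card : ZMod 2) = ε
  · exact hmono _ I h
  · rw [ha.apply_eq_zero h, zero_smul]
    exact hzero

/-- Graded commutativity. -/
theorem HasParity.mul_comm {ε δ : ZMod 2} {a b : Grassmann r} (ha : a.HasParity ε)
    (hb : b.HasParity δ) : a * b = paritySign (ε * δ) • (b * a) := by
  refine HasParity.induction_mono (p := fun a => a * b = paritySign (ε * δ) • (b * a)) ?_ ?_ ?_ ha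
  · intro a a' h h'
    rw [add_mul, h, h', mul_add, smul_add]
  · intro c I hI
    refine HasParity.induction_mono
      (p := fun b => c • mono I * b = paritySign (ε * δ) • (b * c • mono I)) ?_ ?_ ?_ hb
    · intro b b' h h'
      rw [add_mul, mul_add, h, h', smul_add]
    · intro d J hJ
      rw [smul_mul_assoc, smul_mul_assoc, mul_smul_comm, mul_smul_comm,
        smul_comm (paritySign _) d, smul_comm (paritySign _) c, smul_comm d c]
      congr 2
      rw [mono_mul_mono, mono_mul_mono, ← hI, ← hJ, ← Nat.cast_mul, paritySign_natCast]
      by_cases h : Disjoint I J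
      · rw [if_pos h, if_pos h.symm, smul_smul, Finset.union_comm, ← inversions_add_inversions h,
          pow_add, mul_assoc, ← pow_add, ← two_mul, pow_mul]
        simp
      · rw [if_neg h, if_neg fun h' => h h'.symm, smul_zero]
    · simp
  · simp

/-! ### Derivatives with respect to a generator -/

/-- The left derivative as a linear map. -/
def leftDerivLM (g : Fin r) : Grassmann r →ₗ[ℝ] Grassmann r where
  toFun := leftDeriv g
  map_add' a b := by
    ext I
    simp only [leftDeriv, add_apply]
    split_ifs <;> ring
  map_smul' c a := by
    ext I
    simp only [leftDeriv, smul_apply, RingHom.id_apply]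
    split_ifs <;> ring

theorem leftDerivLM_apply (g : Fin r) (a : Grassmann r) : leftDerivLM g a = leftDeriv g a := rfl

theorem leftDeriv_apply_of_mem {g : Fin r} {I : Finset (Fin r)} (h : g ∈ I) (a : Grassmann r) :
    leftDeriv g a I = 0 := if_pos h

theorem leftDeriv_apply_of_notMem {g : Fin r} {I : Finset (Fin r)} (h : g ∉ I)
    (a : Grassmann r) :
    leftDeriv g a I = (-1 : ℝ) ^ (I.filter (fun j => j < g)).card * a (insert g I) := if_neg h

theorem leftDeriv_mono (g : Fin r) (I : Finset (Fin r)) :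
    leftDeriv g (mono I) =
      if g ∈ I then (-1 : ℝ) ^ inversions {g} I • mono (I.erase g) else 0 := by
  ext K
  by_cases hK : g ∈ K
  · rw [leftDeriv_apply_of_mem hK]
    split_ifs with h
    · rw [smul_apply, mono_apply_ne, mul_zero]
      rintro rfl
      exact absurd hK (Finset.notMem_erase g I)
    · rfl
  · rw [leftDeriv_apply_of_notMem hK, inversions_singleton_left]
    split_ifs with h
    · by_cases hI : K = I.erase g
      · subst hI
        rw [Finset.insert_erase h, smul_apply, mono_apply_self, mono_apply_self,
          Finset.filter_erase, Finset.erase_eq_of_notMem]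
        simp
      · rw [mono_apply_ne, smul_apply, mono_apply_ne hI, mul_zero, mul_zero]
        rintro rfl
        exact hI (Finset.erase_insert hK).symm
    · rw [mono_apply_ne, mul_zero, zero_apply]
      rintro rfl
      exact h (Finset.mem_insert_self g K)

theorem leftDeriv_mono_mul_mono (g : Fin r) (I J : Finset (Fin r)) :
    leftDeriv g (mono I * mono J) =
      leftDeriv g (mono I) * mono J + (-1 : ℝ) ^ I.card • (mono I * leftDeriv g (mono J)) := by
  have hz : leftDeriv g (0 : Grassmann r) = 0 := map_zero (leftDerivLM g)
  have hs : ∀ (c : ℝ) (a : Grassmann r), leftDeriv g (c • a) = c • leftDeriv g a :=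
    map_smul (leftDerivLM g)
  have herase : ∀ A : Finset (Fin r), g ∈ A → ∃ B, g ∉ B ∧ A = {g} ∪ B := fun A hA =>
    ⟨A.erase g, Finset.notMem_erase g A, by
      rw [← Finset.insert_eq, Finset.insert_erase hA]⟩
  have her : ∀ B : Finset (Fin r), g ∉ B → ({g} ∪ B).erase g = B := fun B hB => by
    rw [← Finset.insert_eq, Finset.erase_insert hB]
  have hdis : ∀ B : Finset (Fin r), g ∉ B → Disjoint {g} B := fun B hB =>
    Finset.disjoint_singleton_left.2 hB
  have hgg : inversions {g} {g} = 0 := by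
    rw [inversions_singleton_left, Finset.card_eq_zero]
    simp
  have hsq : ∀ k : ℕ, (-1 : ℝ) ^ k * (-1 : ℝ) ^ k = 1 := fun k => by
    rw [← mul_pow]; simp
  have hcomm : ∀ B : Finset (Fin r), g ∉ B →
      (-1 : ℝ) ^ inversions B {g} = (-1) ^ B.card * (-1) ^ inversions {g} B := fun B hB => by
    have h := inversions_add_inversions (hdis B hB)
    rw [Finset.card_singleton, one_mul] at h
    rw [← h, pow_add, mul_right_comm, hsq, one_mul]
  by_cases hI : g ∈ I <;> by_cases hJ : g ∈ J
  · obtain ⟨A, hA, rfl⟩ := herase I hI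
    obtain ⟨B, hB, rfl⟩ := herase J hJ
    have hnd : ¬ Disjoint ({g} ∪ A) ({g} ∪ B) := fun h =>
      Finset.disjoint_left.1 h hI hJ
    rw [mono_mul_mono, if_neg hnd, hz, leftDeriv_mono, leftDeriv_mono, if_pos hI, if_pos hJ,
      her A hA, her B hB, smul_mul_assoc, mul_smul_comm, mono_mul_mono, mono_mul_mono]
    by_cases hd : Disjoint A B
    · rw [if_pos (Finset.disjoint_union_right.2 ⟨(hdis A hA).symm, hd⟩),
        if_pos (Finset.disjoint_union_left.2 ⟨hdis B hB, hd⟩),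
        inversions_union_right _ (hdis A hA), inversions_union_right _ (hdis B hB),
        inversions_union_right _ (hdis B hB), inversions_union_left (hdis A hA), hgg, zero_add,
        Finset.card_union_of_disjoint (hdis A hA), Finset.card_singleton, zero_add,
        Finset.union_left_comm A {g} B, ← Finset.union_assoc {g} A B]
      simp only [smul_smul, ← add_smul, pow_add, hcomm A hA, pow_one]
      rw [eq_comm]
      convert zero_smul ℝ _ using 2
      linear_combination ((-1) ^ A.card * (-1) ^ inversions A B) * hsq (inversions {g} A)
        - ((-1) ^ A.card * (-1) ^ inversions A B) * hsq (inversions {g} B)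
    · rw [if_neg fun h => hd (Finset.disjoint_union_right.1 h).2,
        if_neg fun h => hd (Finset.disjoint_union_left.1 h).2]
      simp
  · obtain ⟨A, hA, rfl⟩ := herase I hI
    rw [leftDeriv_mono, leftDeriv_mono, if_pos hI, if_neg hJ, mul_zero, smul_zero, add_zero,
      her A hA, smul_mul_assoc, mono_mul_mono, mono_mul_mono]
    by_cases hd : Disjoint A J
    · have hgJ : Disjoint {g} (A ∪ J) := by
        simp [hA, hJ]
      rw [if_pos (Finset.disjoint_union_left.2 ⟨hdis J hJ, hd⟩), if_pos hd, hs, leftDeriv_mono,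
        if_pos (Finset.mem_union_left _ hI), Finset.union_assoc, her _ (by simp [hA, hJ]),
        inversions_union_left (hdis A hA), inversions_union_right _ hgJ,
        inversions_union_right _ (hdis A hA), inversions_union_right _ hd, hgg]
      simp only [smul_smul, pow_add, pow_zero]
      congr 1
      linear_combination ((-1) ^ inversions A J * (-1) ^ inversions {g} A) * hsq (inversions {g} J)
    · rw [if_neg fun h => hd (Finset.disjoint_union_left.1 h).2, if_neg hd, hz, smul_zero]
  · obtain ⟨B, hB, rfl⟩ := herase J hJ
    rw [leftDeriv_mono, leftDeriv_mono, if_neg hI, if_pos hJ, zero_mul, zero_add,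
      her B hB, mul_smul_comm, mono_mul_mono, mono_mul_mono]
    by_cases hd : Disjoint I B
    · have hgJ : Disjoint {g} (I ∪ B) := by
        simp [hI, hB]
      rw [if_pos (Finset.disjoint_union_right.2 ⟨(hdis I hI).symm, hd⟩), if_pos hd, hs,
        leftDeriv_mono, if_pos (Finset.mem_union_right _ hJ), Finset.union_left_comm,
        her _ (by simp [hI, hB]), inversions_union_right _ (hdis B hB),
        inversions_union_right _ hgJ, inversions_union_right _ hd,
        inversions_union_right _ (hdis B hB), hgg]
      simp only [smul_smul, pow_add, pow_zero, hcomm I hI]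
      congr 1
      linear_combination ((-1) ^ I.card * (-1) ^ inversions I B * (-1) ^ inversions {g} B)
        * hsq (inversions {g} I)
    · rw [if_neg fun h => hd (Finset.disjoint_union_right.1 h).2, if_neg hd, hz, smul_zero,
        smul_zero]
  · rw [leftDeriv_mono, leftDeriv_mono, if_neg hI, if_neg hJ, zero_mul, mul_zero, smul_zero,
      add_zero, mono_mul_mono]
    split_ifs with hd
    · rw [hs, leftDeriv_mono, if_neg (by simp [hI, hJ]), smul_zero]
    · exact hz

/-- The left derivative is an odd derivation. -/
theorem leftDeriv_mul {ε : ZMod 2} {a : Grassmann r} (ha : a.HasParity ε) (g : Fin r)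
    (b : Grassmann r) :
    leftDeriv g (a * b) = leftDeriv g a * b + paritySign ε • (a * leftDeriv g b) := by
  simp only [← leftDerivLM_apply]
  refine HasParity.induction_mono (p := fun a => leftDerivLM g (a * b) =
    leftDerivLM g a * b + paritySign ε • (a * leftDerivLM g b)) ?_ ?_ ?_ ha
  · intro a a' h h'
    rw [add_mul, map_add, h, h', map_add, add_mul, add_mul, smul_add]
    abel
  · intro c I hI
    induction b using induction_mono with
    | hadd b b' h h' =>
      rw [mul_add, map_add, h, h', map_add, mul_add, mul_add, smul_add]
      abel
    | hmono d J =>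
      rw [smul_mul_assoc, mul_smul_comm, map_smul, map_smul, map_smul, map_smul, smul_mul_assoc,
        mul_smul_comm, smul_mul_assoc, mul_smul_comm, smul_comm (paritySign ε) c,
        smul_comm (paritySign ε) d, ← smul_add, ← smul_add, ← hI, paritySign_natCast]
      congr 2
      exact leftDeriv_mono_mul_mono g I J
  · simp

theorem HasParity.leftDeriv {ε : ZMod 2} {a : Grassmann r} (ha : a.HasParity ε) (g : Fin r) :
    (Grassmann.leftDeriv g a).HasParity (ε + 1) :=
  hasParity_iff.2 fun I hI => by
    by_cases h : g ∈ I
    · exact leftDeriv_apply_of_mem h a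
    · rw [leftDeriv_apply_of_notMem h, ha.apply_eq_zero, mul_zero]
      rw [Finset.card_insert_of_notMem h, Nat.cast_succ]
      rintro rfl
      refine hI ?_
      rw [add_assoc, show (1 + 1 : ZMod 2) = 0 from rfl, add_zero]

/-- Moving `ζ_g` from the right end of `ζ_I ζ_g` to the left one costs the sign `(-1)^#I`. -/
theorem rightDeriv_apply (g : Fin r) (a : Grassmann r) (I : Finset (Fin r)) :
    rightDeriv g a I = (-1 : ℝ) ^ I.card * leftDeriv g a I := by
  by_cases h : g ∈ I
  · rw [leftDeriv_apply_of_mem h, mul_zero]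
    exact if_pos h
  · rw [leftDeriv_apply_of_notMem h, rightDeriv, if_neg h, ← mul_assoc]
    congr 1
    have h2 := inversions_add_inversions (Finset.disjoint_singleton_left.2 h)
    rw [Finset.card_singleton, one_mul, inversions_singleton_left, inversions_singleton_right] at h2
    rw [← h2, pow_add, mul_right_comm, ← mul_pow]
    simp

theorem HasParity.rightDeriv_eq {ε : ZMod 2} {a : Grassmann r} (ha : a.HasParity ε) (g : Fin r) :
    rightDeriv g a = paritySign (ε + 1) • Grassmann.leftDeriv g a := by
  ext I
  rw [rightDeriv_apply, smul_apply, ← paritySign_natCast]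
  by_cases h : (I.card : ZMod 2) = ε + 1
  · rw [h]
  · rw [(ha.leftDeriv g).apply_eq_zero h, mul_zero, mul_zero]

/-- The right derivative as a linear map. -/
def rightDerivLM (g : Fin r) : Grassmann r →ₗ[ℝ] Grassmann r where
  toFun := rightDeriv g
  map_add' a b := by
    ext I
    simp only [rightDeriv, add_apply]
    split_ifs <;> ring
  map_smul' c a := by
    ext I
    simp only [rightDeriv, smul_apply, RingHom.id_apply]
    split_ifs <;> ring

theorem leftDeriv_leftDeriv (g h : Fin r) (a : Grassmann r) :
    leftDeriv g (leftDeriv h a) = - leftDeriv h (leftDeriv g a) := by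
  have key : ∀ g h : Fin r, g < h → ∀ (a : Grassmann r),
      leftDeriv g (leftDeriv h a) = - leftDeriv h (leftDeriv g a) := by
    intro g h hgh a
    ext I
    rw [neg_apply]
    by_cases hg : g ∈ I
    · rw [leftDeriv_apply_of_mem hg]
      by_cases hh : h ∈ I
      · rw [leftDeriv_apply_of_mem hh, neg_zero]
      · rw [leftDeriv_apply_of_notMem hh,
          leftDeriv_apply_of_mem (Finset.mem_insert_of_mem hg), mul_zero, neg_zero]
    · rw [leftDeriv_apply_of_notMem hg]
      by_cases hh : h ∈ I
      · rw [leftDeriv_apply_of_mem hh,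
          leftDeriv_apply_of_mem (Finset.mem_insert_of_mem hh), mul_zero, neg_zero]
      · rw [leftDeriv_apply_of_notMem hh, leftDeriv_apply_of_notMem (by simp [hh, hgh.ne']),
          leftDeriv_apply_of_notMem (by simp [hg, hgh.ne]), Finset.filter_insert,
          Finset.filter_insert, if_pos hgh, if_neg (not_lt.2 hgh.le),
          Finset.card_insert_of_notMem (by simp [hg]), Finset.insert_comm h g, pow_succ]
        ring
  rcases lt_trichotomy g h with hgh | rfl | hgh
  · exact key g h hgh a
  · ext I
    rw [neg_apply]
    by_cases hg : g ∈ I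
    · rw [leftDeriv_apply_of_mem hg, neg_zero]
    · rw [leftDeriv_apply_of_notMem hg, leftDeriv_apply_of_mem (Finset.mem_insert_self g I),
        mul_zero, neg_zero]
  · rw [key h g hgh a, neg_neg]

theorem leftDeriv_one (g : Fin r) : leftDeriv g 1 = 0 := by
  rw [one_eq_mono, leftDeriv_mono, if_neg (Finset.notMem_empty g)]

theorem leftDeriv_gen (g h : Fin r) : leftDeriv g (gen h) = if g = h then 1 else 0 := by
  rw [gen_eq_mono, leftDeriv_mono]
  by_cases hg : g = h
  · subst hg
    rw [if_pos (Finset.mem_singleton_self g), if_pos rfl, inversions_singleton_left, one_eq_mono,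
      Finset.filter_singleton, if_neg (lt_irrefl g), Finset.card_empty, pow_zero, one_smul,
      Finset.erase_singleton]
  · rw [if_neg (by simpa using hg), if_neg hg]

/-! ### Renaming and restricting the generators -/

theorem inversions_map (f : Fin r ↪o Fin s) (I J : Finset (Fin r)) :
    inversions (I.map f.toEmbedding) (J.map f.toEmbedding) = inversions I J := by
  unfold inversions
  symm
  refine Finset.card_bij (fun e _ => (f e.1, f e.2)) ?_ ?_ ?_
  · rintro ⟨a, b⟩ h
    simpa using h
  · rintro ⟨a, b⟩ _ ⟨c, d⟩ _ h
    simpa using h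
  · rintro ⟨a, b⟩ h
    simp only [Finset.mem_filter, Finset.mem_product, Finset.mem_map] at h
    obtain ⟨⟨⟨a, ha, rfl⟩, ⟨b, hb, rfl⟩⟩, hab⟩ := h
    exact ⟨(a, b), by simpa [ha, hb] using hab, rfl⟩

/-- The renaming of the generators as a linear map. -/
def renameLM (f : Fin r ↪o Fin s) : Grassmann r →ₗ[ℝ] Grassmann s where
  toFun := rename f
  map_add' a b := by
    ext J
    simp only [rename, add_apply, ← Finset.sum_add_distrib]
    exact Finset.sum_congr rfl fun I _ => by split_ifs <;> simp
  map_smul' c a := by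
    ext J
    simp only [rename, smul_apply, RingHom.id_apply, Finset.mul_sum]
    exact Finset.sum_congr rfl fun I _ => by split_ifs <;> simp

theorem renameLM_apply (f : Fin r ↪o Fin s) (a : Grassmann r) : renameLM f a = rename f a := rfl

theorem rename_apply_map (f : Fin r ↪o Fin s) (a : Grassmann r) (I : Finset (Fin r)) :
    rename f a (I.map f.toEmbedding) = a I := by
  rw [rename, Finset.sum_eq_single I]
  · rw [if_pos rfl]
  · intro J _ hJ
    rw [if_neg fun h => hJ (Finset.map_injective _ h)]
  · simp

theorem rename_apply_of_ne (f : Fin r ↪o Fin s) (a : Grassmann r) {J : Finset (Fin s)}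
    (hJ : ∀ I : Finset (Fin r), I.map f.toEmbedding ≠ J) : rename f a J = 0 :=
  Finset.sum_eq_zero fun I _ => if_neg (hJ I)

theorem rename_mono (f : Fin r ↪o Fin s) (I : Finset (Fin r)) :
    rename f (mono I) = mono (I.map f.toEmbedding) := by
  ext J
  by_cases hJ : ∃ K : Finset (Fin r), K.map f.toEmbedding = J
  · obtain ⟨K, rfl⟩ := hJ
    rw [rename_apply_map]
    by_cases h : K = I
    · rw [h, mono_apply_self, mono_apply_self]
    · rw [mono_apply_ne h, mono_apply_ne fun h' => h (Finset.map_injective _ h')]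
  · rw [rename_apply_of_ne f _ fun K hK => hJ ⟨K, hK⟩, mono_apply_ne]
    rintro rfl
    exact hJ ⟨I, rfl⟩

theorem rename_mul (f : Fin r ↪o Fin s) (a b : Grassmann r) :
    rename f (a * b) = rename f a * rename f b := by
  simp only [← renameLM_apply]
  induction a using induction_mono with
  | hadd a a' h h' => simp only [add_mul, map_add, h, h']
  | hmono c I =>
  induction b using induction_mono with
  | hadd b b' h h' => simp only [mul_add, map_add, h, h']
  | hmono d J =>
  simp only [smul_mul_assoc, mul_smul_comm, map_smul]
  congr 2
  simp only [renameLM_apply, rename_mono, mono_mul_mono, inversions_map, Finset.disjoint_map]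
  split_ifs
  · rw [← renameLM_apply, map_smul, renameLM_apply, rename_mono, Finset.map_union]
  · exact map_zero (renameLM f)

theorem rename_one (f : Fin r ↪o Fin s) : rename f 1 = 1 := by
  rw [one_eq_mono, rename_mono, Finset.map_empty, one_eq_mono]

theorem rename_gen (f : Fin r ↪o Fin s) (g : Fin r) : rename f (gen g) = gen (f g) := by
  rw [gen_eq_mono, rename_mono, Finset.map_singleton, gen_eq_mono]
  rfl

theorem HasParity.rename {ε : ZMod 2} {a : Grassmann r} (ha : a.HasParity ε)
    (f : Fin r ↪o Fin s) : (Grassmann.rename f a).HasParity ε :=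
  hasParity_iff.2 fun J hJ => by
    by_cases h : ∃ K : Finset (Fin r), K.map f.toEmbedding = J
    · obtain ⟨K, rfl⟩ := h
      rw [Finset.card_map] at hJ
      rw [rename_apply_map, ha.apply_eq_zero hJ]
    · exact rename_apply_of_ne f _ fun K hK => h ⟨K, hK⟩

theorem leftDeriv_rename (f : Fin r ↪o Fin s) (g : Fin r) (a : Grassmann r) :
    leftDeriv (f g) (rename f a) = rename f (leftDeriv g a) := by
  simp only [← renameLM_apply, ← leftDerivLM_apply]
  induction a using induction_mono with
  | hadd a a' h h' => simp only [map_add, h, h']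
  | hmono c I =>
  simp only [map_smul]
  congr 1
  simp only [renameLM_apply, leftDerivLM_apply, rename_mono, leftDeriv_mono]
  have h1 : f g ∈ I.map f.toEmbedding ↔ g ∈ I := by simp
  have h2 := inversions_map f {g} I
  rw [Finset.map_singleton] at h2
  have h3 := Finset.map_erase f.toEmbedding I g
  by_cases hg : g ∈ I
  · rw [if_pos (h1.2 hg), if_pos hg, ← renameLM_apply, map_smul, renameLM_apply, rename_mono, h3,
      ← h2]
    rfl
  · rw [if_neg fun h => hg (h1.1 h), if_neg hg]
    exact (map_zero (renameLM f)).symm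

/-- A generator outside the range of the renaming does not occur. -/
theorem leftDeriv_rename_of_notMem (f : Fin r ↪o Fin s) {g : Fin s} (hg : g ∉ Set.range f)
    (a : Grassmann r) : leftDeriv g (rename f a) = 0 := by
  ext J
  by_cases h : g ∈ J
  · exact leftDeriv_apply_of_mem h _
  · rw [leftDeriv_apply_of_notMem h, rename_apply_of_ne, mul_zero, zero_apply]
    intro K hK
    have : g ∈ K.map f.toEmbedding := hK ▸ Finset.mem_insert_self g J
    obtain ⟨k, _, rfl⟩ := Finset.mem_map.1 this
    exact hg ⟨k, rfl⟩

/-- Setting to zero all generators outside the range of `f`, as an algebra homomorphism. -/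
def restrict (f : Fin r ↪o Fin s) : Grassmann s →ₐ[ℝ] Grassmann r where
  toFun a := fun I => a (I.map f.toEmbedding)
  map_one' := by
    ext I
    simp [one_apply]
  map_mul' a b := by
    ext I
    change (a * b) (I.map f.toEmbedding) = _
    rw [mul_apply]
    symm
    refine Finset.sum_bij (fun A _ => A.map f.toEmbedding) ?_ ?_ ?_ ?_
    · intro A hA
      exact Finset.mem_powerset.2 (Finset.map_subset_map.2 (Finset.mem_powerset.1 hA))
    · intro A _ B _ h
      exact Finset.map_injective _ h
    · intro B hB
      obtain ⟨A, hA, rfl⟩ := Finset.subset_map_iff.1 (Finset.mem_powerset.1 hB)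
      exact ⟨A, Finset.mem_powerset.2 hA, rfl⟩
    · intro A _
      rw [← Finset.map_sdiff, inversions_map]
  map_zero' := rfl
  map_add' _ _ := rfl
  commutes' c := by
    rw [Algebra.algebraMap_eq_smul_one, Algebra.algebraMap_eq_smul_one]
    ext I
    change c * (1 : Grassmann s) (I.map f.toEmbedding) = c * (1 : Grassmann r) I
    simp [one_apply]

theorem restrict_apply (f : Fin r ↪o Fin s) (a : Grassmann s) (I : Finset (Fin r)) :
    restrict f a I = a (I.map f.toEmbedding) := rfl

theorem restrict_rename (f : Fin r ↪o Fin s) (a : Grassmann r) :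
    restrict f (rename f a) = a := by
  ext I
  rw [restrict_apply, rename_apply_map]

theorem HasParity.restrict {ε : ZMod 2} {a : Grassmann s} (ha : a.HasParity ε)
    (f : Fin r ↪o Fin s) : (Grassmann.restrict f a).HasParity ε :=
  hasParity_iff.2 fun I hI => by
    rw [restrict_apply, ha.apply_eq_zero]
    rwa [Finset.card_map]

end Grassmann

/-! ### Calculus of Grassmann-valued functions -/

namespace Grassmann

variable {r : ℕ} {E : Type*} [NormedAddCommGroup E] [NormedSpace ℝ E]

/-- The product as a continuous bilinear map. -/
def mulCLM (r : ℕ) : Grassmann r →L[ℝ] Grassmann r →L[ℝ] Grassmann r :=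
  (LinearMap.mul ℝ (Grassmann r)).toContinuousBilinearMap

theorem mulCLM_apply (a b : Grassmann r) : mulCLM r a b = a * b := rfl

theorem contDiff_mul {k : WithTop ℕ∞} {f g : E → Grassmann r} (hf : ContDiff ℝ k f)
    (hg : ContDiff ℝ k g) : ContDiff ℝ k (fun x => f x * g x) :=
  (mulCLM r).isBoundedBilinearMap.contDiff.comp (hf.prodMk hg)

theorem fderiv_mul_apply {f g : E → Grassmann r} {x : E} (hf : DifferentiableAt ℝ f x)
    (hg : DifferentiableAt ℝ g x) (v : E) :
    fderiv ℝ (fun y => f y * g y) x v = fderiv ℝ f x v * g x + f x * fderiv ℝ g x v := by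
  have h := (mulCLM r).hasFDerivAt_of_bilinear hf.hasFDerivAt hg.hasFDerivAt
  have h2 : HasFDerivAt (fun y => f y * g y) _ x := h
  rw [h2.fderiv]
  simp [mulCLM_apply, add_comm]

theorem contDiff_linear {V : Type*} [NormedAddCommGroup V] [NormedSpace ℝ V]
    {k : WithTop ℕ∞} (L : Grassmann r →ₗ[ℝ] V) {f : E → Grassmann r} (hf : ContDiff ℝ k f) :
    ContDiff ℝ k (fun x => L (f x)) :=
  (LinearMap.toContinuousLinearMap L).contDiff.comp hf

theorem fderiv_linear_apply {V : Type*} [NormedAddCommGroup V] [NormedSpace ℝ V]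
    (L : Grassmann r →ₗ[ℝ] V) {f : E → Grassmann r} {x : E} (hf : DifferentiableAt ℝ f x)
    (v : E) : fderiv ℝ (fun y => L (f y)) x v = L (fderiv ℝ f x v) := by
  have h := (LinearMap.toContinuousLinearMap L).hasFDerivAt.comp x hf.hasFDerivAt
  have h2 : HasFDerivAt (fun y => L (f y)) _ x := h
  rw [h2.fderiv]
  rfl

theorem contDiff_iff_coeff {k : WithTop ℕ∞} {f : E → Grassmann r} :
    ContDiff ℝ k f ↔ ∀ I, ContDiff ℝ k (fun x => f x I) :=
  contDiff_pi (F' := fun _ : Finset (Fin r) => ℝ)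

end Grassmann

namespace SuperFun

open Grassmann

variable {n m P : ℕ}

/-! ### Smooth functions -/

theorem Smooth.differentiableAt {F : SuperFun n m P} (hF : Smooth F)
    (z : ℝ × (Fin n ⊕ Fin n → ℝ)) : DifferentiableAt ℝ F z :=
  (ContDiff.differentiable hF (by simp)) z

theorem smooth_const (a : Grassmann (m + m + P)) :
    Smooth (fun _ => a : SuperFun n m P) := contDiff_const

theorem Smooth.add {F G : SuperFun n m P} (hF : Smooth F) (hG : Smooth G) : Smooth (F + G) :=
  ContDiff.add hF hG

theorem Smooth.mul {F G : SuperFun n m P} (hF : Smooth F) (hG : Smooth G) : Smooth (F * G) :=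
  contDiff_mul hF hG

theorem Smooth.smul (c : ℝ) {F : SuperFun n m P} (hF : Smooth F) : Smooth (c • F) :=
  ContDiff.const_smul c hF

theorem Smooth.sum {ι : Type*} (t : Finset ι) {F : ι → SuperFun n m P}
    (hF : ∀ i ∈ t, Smooth (F i)) : Smooth (∑ i ∈ t, F i) :=
  Finset.sum_induction _ (fun G : SuperFun n m P => Smooth G) (fun _ _ => Smooth.add)
    (smooth_const 0) hF

/-- The algebra of smooth functions on the graded phase space. -/
def smoothAlg (n m P : ℕ) : Subalgebra ℝ (SuperFun n m P) where
  carrier := {F | Smooth F}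
  mul_mem' := Smooth.mul
  add_mem' := Smooth.add
  algebraMap_mem' c := smooth_const (algebraMap ℝ (Grassmann (m + m + P)) c)

theorem mem_smoothAlg {F : SuperFun n m P} : F ∈ smoothAlg n m P ↔ Smooth F := Iff.rfl

theorem Smooth.neg {F : SuperFun n m P} (hF : Smooth F) : Smooth (-F) :=
  (smoothAlg n m P).neg_mem hF

theorem Smooth.sub {F G : SuperFun n m P} (hF : Smooth F) (hG : Smooth G) : Smooth (F - G) :=
  (smoothAlg n m P).sub_mem hF hG

/-! ### Directional derivatives -/

/-- The derivative in a direction of the real space of time and bosonic coordinates. -/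
def dirPD (v : ℝ × (Fin n ⊕ Fin n → ℝ)) (F : SuperFun n m P) : SuperFun n m P :=
  fun z => fderiv ℝ F z v

theorem timePD_eq_dirPD (F : SuperFun n m P) : timePD F = dirPD (1, 0) F := rfl

variable (v u : ℝ × (Fin n ⊕ Fin n → ℝ))

theorem Smooth.dirPD {F : SuperFun n m P} (hF : Smooth F) : Smooth (SuperFun.dirPD v F) :=
  (ContDiff.fderiv_right (m := ∞) hF (by simp)).clm_apply contDiff_const

theorem dirPD_add {F G : SuperFun n m P} (hF : Smooth F) (hG : Smooth G) :
    dirPD v (F + G) = dirPD v F + dirPD v G := by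
  funext z
  change fderiv ℝ (F + G) z v = fderiv ℝ F z v + fderiv ℝ G z v
  rw [fderiv_add (hF.differentiableAt z) (hG.differentiableAt z)]
  rfl

theorem dirPD_smul (c : ℝ) {F : SuperFun n m P} (hF : Smooth F) :
    dirPD v (c • F) = c • dirPD v F := by
  funext z
  change fderiv ℝ (c • F) z v = c • fderiv ℝ F z v
  rw [fderiv_const_smul (hF.differentiableAt z)]
  rfl

theorem dirPD_mul {F G : SuperFun n m P} (hF : Smooth F) (hG : Smooth G) :
    dirPD v (F * G) = dirPD v F * G + F * dirPD v G :=
  funext fun z => fderiv_mul_apply (hF.differentiableAt z) (hG.differentiableAt z) v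

theorem dirPD_linear {r : ℕ} (L : Grassmann (m + m + P) →ₗ[ℝ] Grassmann (m + m + r))
    {F : SuperFun n m P} (hF : Smooth F) :
    dirPD v (fun z => L (F z) : SuperFun n m r) = fun z => L (dirPD v F z) :=
  funext fun z => fderiv_linear_apply L (hF.differentiableAt z) v

theorem dirPD_apply_coeff {F : SuperFun n m P} (hF : Smooth F) (z : ℝ × (Fin n ⊕ Fin n → ℝ))
    (I : Finset (Fin (m + m + P))) :
    dirPD v F z I = fderiv ℝ (fun y => F y I) z v :=
  (fderiv_linear_apply (coeff I) (hF.differentiableAt z) v).symm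

theorem dirPD_dirPD {F : SuperFun n m P} (hF : Smooth F) :
    dirPD u (dirPD v F) = dirPD v (dirPD u F) := by
  have h2 : ContDiff ℝ ∞ (fderiv ℝ F) := ContDiff.fderiv_right (m := ∞) hF (by simp)
  have key : ∀ u v : ℝ × (Fin n ⊕ Fin n → ℝ), ∀ z,
      dirPD u (dirPD v F) z = fderiv ℝ (fderiv ℝ F) z u v := by
    intro u v z
    change fderiv ℝ (fun y => fderiv ℝ F y v) z u = _
    rw [fderiv_clm_apply (h2.differentiable (by simp) z) (differentiableAt_const v)]
    simp
  funext z
  rw [key, key]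
  exact (ContDiffAt.isSymmSndFDerivAt (n := ∞) (ContDiff.contDiffAt hF)
    (by simpa using (WithTop.coe_le_coe.2 (le_top : (2 : ℕ∞) ≤ ⊤) : (2 : WithTop ℕ∞) ≤ ∞))) u v

theorem dirPD_const (a : Grassmann (m + m + P)) :
    dirPD v (fun _ => a : SuperFun n m P) = 0 := by
  funext z
  change fderiv ℝ (fun _ => a) z v = 0
  rw [fderiv_fun_const]
  rfl

/-! ### Parity of functions -/

theorem HasParity.add {ε : ZMod 2} {F G : SuperFun n m P} (hF : HasParity ε F)
    (hG : HasParity ε G) : HasParity ε (F + G) := fun z => (hF z).add (hG z)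

theorem HasParity.sub {ε : ZMod 2} {F G : SuperFun n m P} (hF : HasParity ε F)
    (hG : HasParity ε G) : HasParity ε (F - G) := fun z => (hF z).sub (hG z)

theorem HasParity.neg {ε : ZMod 2} {F : SuperFun n m P} (hF : HasParity ε F) :
    HasParity ε (-F) := fun z => (hF z).neg

theorem HasParity.smul {ε : ZMod 2} (c : ℝ) {F : SuperFun n m P} (hF : HasParity ε F) :
    HasParity ε (c • F) := fun z => (hF z).smul c

theorem HasParity.mul {ε δ : ZMod 2} {F G : SuperFun n m P} (hF : HasParity ε F)
    (hG : HasParity δ G) : HasParity (ε + δ) (F * G) := fun z => (hF z).mul (hG z)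

theorem HasParity.sum {ι : Type*} (t : Finset ι) {ε : ZMod 2} {F : ι → SuperFun n m P}
    (hF : ∀ i ∈ t, HasParity ε (F i)) : HasParity ε (∑ i ∈ t, F i) := fun z => by
  rw [Finset.sum_apply]
  exact Grassmann.HasParity.sum t fun i hi => hF i hi z

theorem HasParity.dirPD {ε : ZMod 2} {F : SuperFun n m P} (hF : HasParity ε F) (hs : Smooth F) :
    HasParity ε (SuperFun.dirPD v F) := fun z =>
  hasParity_iff.2 fun I hI => by
    rw [dirPD_apply_coeff v hs, show (fun y => F y I) = fun _ => 0 from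
      funext fun y => (hF y).apply_eq_zero hI, fderiv_fun_const]
    rfl

theorem HasParity.mul_comm {ε δ : ZMod 2} {F G : SuperFun n m P} (hF : HasParity ε F)
    (hG : HasParity δ G) : F * G = paritySign (ε * δ) • (G * F) :=
  funext fun z => (hF z).mul_comm (hG z)

/-! ### Partial derivatives -/

/-- A partial derivative is a directional derivative for a bosonic coordinate, and the derivative
with respect to a generator for a fermionic one. -/
theorem leftPD_cases (M : CoordIdx n m) :
    (coordParity M = 0 ∧ ∃ u : Fin n ⊕ Fin n → ℝ, ∀ P, (∀ F : SuperFun n m P,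
      leftPD M F = dirPD (0, u) F) ∧ ∀ F : SuperFun n m P, rightPD M F = dirPD (0, u) F) ∨
    (coordParity M = 1 ∧ ∃ g : Fin (m + m), ∀ P,
      (∀ F : SuperFun n m P, leftPD M F = fun z => leftDeriv (Fin.castAdd P g) (F z)) ∧
      ∀ F : SuperFun n m P, rightPD M F = fun z => rightDeriv (Fin.castAdd P g) (F z)) := by
  rcases M with (i | μ) | (i | μ)
  · exact Or.inl ⟨rfl, Pi.single (.inl i) 1, fun _ => ⟨fun _ => rfl, fun _ => rfl⟩⟩
  · exact Or.inr ⟨rfl, Fin.castAdd m μ, fun _ => ⟨fun _ => rfl, fun _ => rfl⟩⟩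
  · exact Or.inl ⟨rfl, Pi.single (.inr i) 1, fun _ => ⟨fun _ => rfl, fun _ => rfl⟩⟩
  · exact Or.inr ⟨rfl, Fin.natAdd m μ, fun _ => ⟨fun _ => rfl, fun _ => rfl⟩⟩

variable (M N : CoordIdx n m)

theorem Smooth.leftPD {F : SuperFun n m P} (hF : Smooth F) : Smooth (SuperFun.leftPD M F) := by
  rcases leftPD_cases M with ⟨_, u, hu⟩ | ⟨_, g, hg⟩
  · rw [(hu P).1]
    exact hF.dirPD _
  · rw [(hg P).1]
    exact contDiff_linear (leftDerivLM (Fin.castAdd P g)) hF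

theorem leftPD_add {F G : SuperFun n m P} (hF : Smooth F) (hG : Smooth G) :
    leftPD M (F + G) = leftPD M F + leftPD M G := by
  rcases leftPD_cases M with ⟨_, u, hu⟩ | ⟨_, g, hg⟩
  · simp only [(hu P).1]
    exact dirPD_add _ hF hG
  · simp only [(hg P).1]
    exact funext fun z => map_add (leftDerivLM (Fin.castAdd P g)) _ _

theorem leftPD_smul (c : ℝ) {F : SuperFun n m P} (hF : Smooth F) :
    leftPD M (c • F) = c • leftPD M F := by
  rcases leftPD_cases M with ⟨_, u, hu⟩ | ⟨_, g, hg⟩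
  · simp only [(hu P).1]
    exact dirPD_smul _ c hF
  · simp only [(hg P).1]
    exact funext fun z => map_smul (leftDerivLM (Fin.castAdd P g)) _ _

theorem rightPD_add {F G : SuperFun n m P} (hF : Smooth F) (hG : Smooth G) :
    rightPD M (F + G) = rightPD M F + rightPD M G := by
  rcases leftPD_cases M with ⟨_, u, hu⟩ | ⟨_, g, hg⟩
  · simp only [(hu P).2]
    exact dirPD_add _ hF hG
  · simp only [(hg P).2]
    exact funext fun z => map_add (rightDerivLM (Fin.castAdd P g)) _ _

theorem rightPD_smul (c : ℝ) {F : SuperFun n m P} (hF : Smooth F) :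
    rightPD M (c • F) = c • rightPD M F := by
  rcases leftPD_cases M with ⟨_, u, hu⟩ | ⟨_, g, hg⟩
  · simp only [(hu P).2]
    exact dirPD_smul _ c hF
  · simp only [(hg P).2]
    exact funext fun z => map_smul (rightDerivLM (Fin.castAdd P g)) _ _

/-- The partial derivative as a linear operator on smooth functions. -/
def pd (M : CoordIdx n m) : smoothAlg n m P →ₗ[ℝ] smoothAlg n m P where
  toFun F := ⟨leftPD M F.1, Smooth.leftPD M F.2⟩
  map_add' F G := Subtype.ext (leftPD_add M F.2 G.2)
  map_smul' c F := Subtype.ext (leftPD_smul M c F.2)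

theorem pd_coe (F : smoothAlg n m P) : (pd M F : SuperFun n m P) = leftPD M F.1 := rfl

/-- The directional derivative as a linear operator on smooth functions. -/
def dir (v : ℝ × (Fin n ⊕ Fin n → ℝ)) : smoothAlg n m P →ₗ[ℝ] smoothAlg n m P where
  toFun F := ⟨dirPD v F.1, Smooth.dirPD v F.2⟩
  map_add' F G := Subtype.ext (dirPD_add v F.2 G.2)
  map_smul' c F := Subtype.ext (dirPD_smul v c F.2)

theorem dir_coe (F : smoothAlg n m P) : (dir v F : SuperFun n m P) = dirPD v F.1 := rfl

theorem leftPD_sub {F G : SuperFun n m P} (hF : Smooth F) (hG : Smooth G) :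
    leftPD M (F - G) = leftPD M F - leftPD M G :=
  congrArg Subtype.val (map_sub (pd M) (⟨F, hF⟩ : smoothAlg n m P) ⟨G, hG⟩)

theorem leftPD_sum {ι : Type*} (t : Finset ι) {F : ι → SuperFun n m P}
    (hF : ∀ i, Smooth (F i)) : leftPD M (∑ i ∈ t, F i) = ∑ i ∈ t, leftPD M (F i) := by
  have h := congrArg Subtype.val (map_sum (pd M) (fun i => (⟨F i, hF i⟩ : smoothAlg n m P)) t)
  rw [pd_coe, AddSubmonoidClass.coe_finsetSum, AddSubmonoidClass.coe_finsetSum] at h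
  exact h

theorem HasParity.leftPD {ε : ZMod 2} {F : SuperFun n m P} (hF : HasParity ε F) (hs : Smooth F) :
    HasParity (ε + coordParity M) (SuperFun.leftPD M F) := by
  rcases leftPD_cases M with ⟨hM, u, hu⟩ | ⟨hM, g, hg⟩
  · rw [(hu P).1, hM, add_zero]
    exact hF.dirPD _ hs
  · rw [(hg P).1, hM]
    exact fun z => (hF z).leftDeriv _

theorem leftPD_mul {ε : ZMod 2} {F G : SuperFun n m P} (hF : Smooth F) (hG : Smooth G)
    (hε : HasParity ε F) :
    leftPD M (F * G) = leftPD M F * G + paritySign (coordParity M * ε) • (F * leftPD M G) := by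
  rcases leftPD_cases M with ⟨hM, u, hu⟩ | ⟨hM, g, hg⟩
  · simp only [(hu P).1, hM, zero_mul, paritySign_zero, one_smul]
    exact dirPD_mul _ hF hG
  · simp only [(hg P).1, hM, one_mul]
    exact funext fun z => leftDeriv_mul (hε z) _ _

theorem leftPD_dirPD {F : SuperFun n m P} (hF : Smooth F) :
    leftPD M (dirPD v F) = dirPD v (leftPD M F) := by
  rcases leftPD_cases M with ⟨hM, u, hu⟩ | ⟨hM, g, hg⟩
  · simp only [(hu P).1]
    exact dirPD_dirPD _ _ hF
  · simp only [(hg P).1]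
    exact (dirPD_linear v (leftDerivLM (Fin.castAdd P g)) hF).symm

/-- Partial derivatives commute in the graded sense. -/
theorem leftPD_leftPD {F : SuperFun n m P} (hF : Smooth F) :
    leftPD M (leftPD N F) = paritySign (coordParity M * coordParity N) • leftPD N (leftPD M F) := by
  rcases leftPD_cases M with ⟨hM, u, hu⟩ | ⟨hM, g, hg⟩
  · simp only [(hu P).1, hM, zero_mul, paritySign_zero, one_smul]
    exact (leftPD_dirPD _ _ hF).symm
  · rcases leftPD_cases N with ⟨hN, u', hu'⟩ | ⟨hN, g', hg'⟩
    · simp only [(hu' P).1, hN, mul_zero, paritySign_zero, one_smul]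
      exact leftPD_dirPD _ _ hF
    · simp only [(hg P).1, (hg' P).1, hM, hN, one_mul, paritySign_one, neg_smul, one_smul]
      exact funext fun z => leftDeriv_leftDeriv _ _ _

theorem rightPD_eq {ε : ZMod 2} {F : SuperFun n m P} (hε : HasParity ε F) :
    rightPD M F = paritySign (coordParity M * (ε + 1)) • leftPD M F := by
  rcases leftPD_cases M with ⟨hM, u, hu⟩ | ⟨hM, g, hg⟩
  · rw [(hu P).1, (hu P).2, hM, zero_mul, paritySign_zero, one_smul]
  · rw [(hg P).1, (hg P).2, hM, one_mul]
    exact funext fun z => (hε z).rightDeriv_eq _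

theorem leftPD_const_rename (a : Grassmann P) :
    leftPD M (fun _ => a.rename (Fin.natAddOrderEmb (m + m)) : SuperFun n m P) = 0 := by
  rcases leftPD_cases M with ⟨hM, u, hu⟩ | ⟨hM, g, hg⟩
  · rw [(hu P).1, dirPD_const]
  · rw [(hg P).1]
    refine funext fun z => leftDeriv_rename_of_notMem _ ?_ a
    rintro ⟨k, hk⟩
    have := congrArg Fin.val hk
    simp at this
    omega

/-! ### Coordinates -/

theorem smooth_coord : Smooth (coord P M) := by
  rcases M with (i | μ) | (i | μ)
  · exact ContDiff.smul (((ContinuousLinearMap.proj (R := ℝ) (φ := fun _ : Fin n ⊕ Fin n => ℝ)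
      (.inl i)).comp (ContinuousLinearMap.snd ℝ ℝ _)).contDiff) contDiff_const
  · exact smooth_const _
  · exact ContDiff.smul (((ContinuousLinearMap.proj (R := ℝ) (φ := fun _ : Fin n ⊕ Fin n => ℝ)
      (.inr i)).comp (ContinuousLinearMap.snd ℝ ℝ _)).contDiff) contDiff_const
  · exact smooth_const _

theorem hasParity_coord : HasParity (coordParity M) (coord P M) := by
  rcases M with (i | μ) | (i | μ)
  · exact fun z => hasParity_one.smul _
  · exact fun z => hasParity_gen _
  · exact fun z => hasParity_one.smul _
  · exact fun z => hasParity_gen _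

theorem dirPD_coord_smul (k : Fin n ⊕ Fin n) (z : ℝ × (Fin n ⊕ Fin n → ℝ)) :
    dirPD v (fun z => z.2 k • (1 : Grassmann (m + m + P)) : SuperFun n m P) z
      = v.2 k • (1 : Grassmann (m + m + P)) := by
  change fderiv ℝ (fun z : ℝ × (Fin n ⊕ Fin n → ℝ) => z.2 k • (1 : Grassmann (m + m + P))) z v = _
  have h : HasFDerivAt (fun z : ℝ × (Fin n ⊕ Fin n → ℝ) => z.2 k • (1 : Grassmann (m + m + P)))
      (((ContinuousLinearMap.proj (R := ℝ) (φ := fun _ : Fin n ⊕ Fin n => ℝ) k).comp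
        (ContinuousLinearMap.snd ℝ ℝ _)).smulRight (1 : Grassmann (m + m + P))) z :=
    (((ContinuousLinearMap.proj (R := ℝ) (φ := fun _ : Fin n ⊕ Fin n => ℝ) k).comp
        (ContinuousLinearMap.snd ℝ ℝ _)).smulRight (1 : Grassmann (m + m + P))).hasFDerivAt
  rw [h.fderiv]
  rfl

theorem leftPD_coord : leftPD M (coord P N) = if M = N then 1 else 0 := by
  have hg1 : ∀ g h : Fin (m + m + P), leftDeriv g (gen h) = if g = h then 1 else 0 :=
    leftDeriv_gen
  funext z
  rcases M with (i | μ) | (i | μ) <;> rcases N with (j | ν) | (j | ν)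
  any_goals
    exact (dirPD_coord_smul _ _ z).trans (by
      by_cases h : i = j
      · subst h; simp
      · simp [h, Ne.symm h])
  any_goals exact (congrFun (dirPD_const _ _) z).trans (by simp)
  any_goals
    refine (map_smul (leftDerivLM _) _ _).trans ?_
    rw [leftDerivLM_apply, leftDeriv_one]
    simp
  all_goals
    refine (leftDeriv_gen _ _).trans ?_
    simp only [qGen, pGen, Fin.ext_iff, Fin.val_castAdd, Fin.val_natAdd, Sum.inl.injEq,
      Sum.inr.injEq, reduceCtorEq, if_false]
    try split_ifs <;> first | rfl | omega

theorem rightPD_coord : rightPD M (coord P N) = if M = N then 1 else 0 := by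
  rw [rightPD_eq M (hasParity_coord N), leftPD_coord]
  by_cases h : M = N
  · subst h
    rw [if_pos rfl]
    rcases eq_zero_or_eq_one (coordParity M) with h | h <;>
      simp [h, paritySign_zero, show (1 + 1 : ZMod 2) = 0 from rfl]
  · rw [if_neg h, smul_zero]

end SuperFun

namespace SuperFun

open Grassmann

variable {n m P : ℕ}

/-! ### The Poisson bracket -/

/-- The coordinate conjugate to `x^M` is `x^(M.swap)`, and `[x^M, x^(M.swap)}` is this sign. -/
def symplSign : CoordIdx n m → ℝ
  | .inl A => pairSign A
  | .inr _ => -1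

variable (M N : CoordIdx n m)

theorem coordParity_swap : coordParity M.swap = coordParity M := by
  rcases M with (i | μ) | (i | μ) <;> rfl

theorem symplSign_swap :
    symplSign M.swap = -(paritySign (coordParity M) * symplSign M) := by
  rcases M with (i | μ) | (i | μ) <;>
    simp [symplSign, pairSign, coordParity, paritySign_zero, paritySign_one]

theorem symplSign_mul_self : symplSign M * symplSign M = 1 := by
  rcases M with (i | μ) | (i | μ) <;> simp [symplSign, pairSign]

theorem bracket_coord_left (G : SuperFun n m P) :
    bracket (coord P M) G = symplSign M • leftPD M.swap G := by
  have h : ∀ A : PairIdx n m,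
      pairSign A • (rightPD (.inl A) (coord P M) * leftPD (.inr A) G)
        - rightPD (.inr A) (coord P M) * leftPD (.inl A) G
      = if M = .inl A ∨ M = .inr A then symplSign M • leftPD M.swap G else 0 := by
    intro A
    rw [rightPD_coord, rightPD_coord]
    rcases M with B | B
    · by_cases hA : A = B
      · subst hA
        simp [symplSign]
      · simp [hA, Ne.symm hA]
    · by_cases hA : A = B
      · subst hA
        simp [symplSign]
      · simp [hA, Ne.symm hA]
  rw [bracket, Finset.sum_congr rfl fun A _ => h A]
  rcases M with B | B
  · rw [Finset.sum_eq_single B]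
    · simp
    · intro A _ hA
      simp [Ne.symm hA]
    · simp
  · rw [Finset.sum_eq_single B]
    · simp
    · intro A _ hA
      simp [Ne.symm hA]
    · simp

theorem bracket_coord_right (F : SuperFun n m P) :
    bracket F (coord P N) = symplSign N.swap • rightPD N.swap F := by
  have h : ∀ A : PairIdx n m,
      pairSign A • (rightPD (.inl A) F * leftPD (.inr A) (coord P N))
        - rightPD (.inr A) F * leftPD (.inl A) (coord P N)
      = if N = .inl A ∨ N = .inr A then symplSign N.swap • rightPD N.swap F else 0 := by
    intro A
    rw [leftPD_coord, leftPD_coord]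
    rcases N with B | B
    · by_cases hA : A = B
      · subst hA
        simp [symplSign]
      · simp [hA, Ne.symm hA]
    · by_cases hA : A = B
      · subst hA
        simp [symplSign]
      · simp [hA, Ne.symm hA]
  rw [bracket, Finset.sum_congr rfl fun A _ => h A]
  rcases N with B | B
  · rw [Finset.sum_eq_single B]
    · simp
    · intro A _ hA
      simp [Ne.symm hA]
    · simp
  · rw [Finset.sum_eq_single B]
    · simp
    · intro A _ hA
      simp [Ne.symm hA]
    · simp

variable {M N}

/-- The Hamiltonian vector field `∑_M [x^M, Q} ∂→/∂x^M` of `Q`. -/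
def hamDer (Q F : SuperFun n m P) : SuperFun n m P :=
  ∑ M : CoordIdx n m, bracket (coord P M) Q * leftPD M F

theorem hamDer_eq (Q F : SuperFun n m P) :
    hamDer Q F = ∑ M : CoordIdx n m, symplSign M • (leftPD M.swap Q * leftPD M F) :=
  Finset.sum_congr rfl fun M _ => by rw [bracket_coord_left, smul_mul_assoc]

/-- For bosonic `Q`, the operator `[Q, ·}` is, up to a sign, a Hamiltonian vector field. -/
theorem bracket_eq_neg_hamDer {Q : SuperFun n m P} (hQ : HasParity 0 Q) (F : SuperFun n m P) :
    bracket Q F = -hamDer Q F := by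
  have h : ∀ M : CoordIdx n m, rightPD M Q = paritySign (coordParity M) • leftPD M Q := fun M => by
    rw [rightPD_eq M hQ, zero_add, mul_one]
  rw [hamDer_eq, Fintype.sum_sum_type, bracket, ← Finset.sum_add_distrib, ← Finset.sum_neg_distrib]
  refine Finset.sum_congr rfl fun A _ => ?_
  rw [h, h]
  rcases A with i | μ
  · simp [symplSign, pairSign, coordParity, paritySign_zero]
    abel
  · simp [symplSign, pairSign, coordParity, paritySign_one]

theorem smooth_bracket_coord {Q : SuperFun n m P} (hQ : Smooth Q) (M : CoordIdx n m) :
    Smooth (bracket (coord P M) Q) := by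
  rw [bracket_coord_left]
  exact (hQ.leftPD _).smul _

theorem hasParity_bracket_coord {Q : SuperFun n m P} (hs : Smooth Q) (hQ : HasParity 0 Q)
    (M : CoordIdx n m) : HasParity (coordParity M) (bracket (coord P M) Q) := by
  rw [bracket_coord_left]
  have h := (hQ.leftPD M.swap hs).smul (symplSign M)
  rwa [coordParity_swap, zero_add] at h

theorem bracket_coord_add {F G : SuperFun n m P} (hF : Smooth F) (hG : Smooth G)
    (M : CoordIdx n m) :
    bracket (coord P M) (F + G) = bracket (coord P M) F + bracket (coord P M) G := by
  simp only [bracket_coord_left, leftPD_add _ hF hG, smul_add]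

theorem bracket_coord_sub {F G : SuperFun n m P} (hF : Smooth F) (hG : Smooth G)
    (M : CoordIdx n m) :
    bracket (coord P M) (F - G) = bracket (coord P M) F - bracket (coord P M) G := by
  simp only [bracket_coord_left, leftPD_sub _ hF hG, smul_sub]

theorem bracket_coord_smul (c : ℝ) {F : SuperFun n m P} (hF : Smooth F) (M : CoordIdx n m) :
    bracket (coord P M) (c • F) = c • bracket (coord P M) F := by
  simp only [bracket_coord_left, leftPD_smul _ c hF]
  rw [smul_comm]

theorem smooth_hamDer {Q F : SuperFun n m P} (hQ : Smooth Q) (hF : Smooth F) :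
    Smooth (hamDer Q F) :=
  Smooth.sum _ fun M _ => (smooth_bracket_coord hQ M).mul (hF.leftPD M)

theorem hamDer_smul (c : ℝ) (Q : SuperFun n m P) {F : SuperFun n m P} (hF : Smooth F) :
    hamDer Q (c • F) = c • hamDer Q F := by
  simp only [hamDer, Finset.smul_sum]
  exact Finset.sum_congr rfl fun M _ => by rw [leftPD_smul M c hF, mul_smul_comm]

theorem hasParity_hamDer {Q F : SuperFun n m P} (hQs : Smooth Q) (hQ : HasParity 0 Q)
    (hFs : Smooth F) {ε : ZMod 2} (hF : HasParity ε F) : HasParity ε (hamDer Q F) :=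
  HasParity.sum _ fun M _ => by
    have h := (hasParity_bracket_coord hQs hQ M).mul (hF.leftPD M hFs)
    have e : coordParity M + (ε + coordParity M) = ε := by
      rw [add_left_comm, CharTwo.add_self_eq_zero, add_zero]
    rwa [e] at h

/-- The partial derivative of a bracket of bosonic functions.  Since `[x^L, ·}` is, up to a sign,
a partial derivative, this is the Jacobi identity for the coordinates and two bosonic functions. -/
theorem leftPD_bracket {Q H : SuperFun n m P} (hQs : Smooth Q) (hQ : HasParity 0 Q)
    (hHs : Smooth H) (hH : HasParity 0 H) (L : CoordIdx n m) :
    leftPD L (bracket Q H) = hamDer H (leftPD L Q) - hamDer Q (leftPD L H) := by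
  have hsm : ∀ M : CoordIdx n m, Smooth (symplSign M • (leftPD M.swap Q * leftPD M H)) :=
    fun M => ((hQs.leftPD _).mul (hHs.leftPD _)).smul _
  have hpar : ∀ M : CoordIdx n m, HasParity (coordParity M) (leftPD M.swap Q) := fun M => by
    have h := hQ.leftPD M.swap hQs
    rwa [coordParity_swap, zero_add] at h
  rw [bracket_eq_neg_hamDer hQ, ← neg_one_smul ℝ, leftPD_smul _ _ (smooth_hamDer hQs hHs),
    neg_one_smul]
  have h1 : leftPD L (hamDer Q H) =
      (∑ M : CoordIdx n m, symplSign M • (leftPD L (leftPD M.swap Q) * leftPD M H))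
      + hamDer Q (leftPD L H) := by
    rw [hamDer_eq, hamDer_eq, leftPD_sum L _ hsm, ← Finset.sum_add_distrib]
    refine Finset.sum_congr rfl fun M _ => ?_
    rw [leftPD_smul _ _ ((hQs.leftPD _).mul (hHs.leftPD _)), leftPD_mul L (hQs.leftPD _)
      (hHs.leftPD _) (hpar M), smul_add]
    congr 2
    rw [← mul_smul_comm, leftPD_leftPD L M hHs, smul_smul, paritySign_mul_self, one_smul]
  have h2 : (∑ M : CoordIdx n m, symplSign M • (leftPD L (leftPD M.swap Q) * leftPD M H))
      = - hamDer H (leftPD L Q) := by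
    rw [hamDer_eq, ← Finset.sum_neg_distrib]
    refine Fintype.sum_equiv (Equiv.sumComm _ _) _ _ fun M => ?_
    have e : Equiv.sumComm (PairIdx n m) (PairIdx n m) M = M.swap := rfl
    have hp : HasParity (coordParity L + coordParity M) (leftPD L (leftPD M.swap Q)) := by
      have h := (hpar M).leftPD L (hQs.leftPD _)
      rwa [add_comm] at h
    have hp2 : HasParity (coordParity M) (leftPD M H) := by
      have h := hH.leftPD M hHs
      rwa [zero_add] at h
    rw [e, Sum.swap_swap, hp.mul_comm hp2, leftPD_leftPD L M.swap hQs, coordParity_swap,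
      mul_smul_comm, smul_smul, smul_smul, symplSign_swap, neg_smul, neg_neg]
    congr 1
    rcases eq_zero_or_eq_one (coordParity L) with h | h <;>
      rcases eq_zero_or_eq_one (coordParity M) with h' | h' <;>
      simp [h, h', paritySign_zero, paritySign_one, show (1 + 1 : ZMod 2) = 0 from rfl]
  rw [h1, h2]
  abel

end SuperFun

/-! ### Parity components, body and soul -/

namespace Grassmann

variable {r : ℕ}

/-- The component of a given parity. -/
def parityPart (ε : ZMod 2) : Grassmann r →ₗ[ℝ] Grassmann r where
  toFun a := fun I => if (I.card : ZMod 2) = ε then a I else 0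
  map_add' a b := by
    ext I
    change (if _ then (a + b) I else 0) = (if _ then a I else 0) + (if _ then b I else 0)
    split_ifs
    · rfl
    · rw [add_zero]
  map_smul' c a := by
    ext I
    change (if _ then (c • a) I else 0) = c * (if _ then a I else 0)
    split_ifs
    · rfl
    · rw [mul_zero]

theorem parityPart_apply (ε : ZMod 2) (a : Grassmann r) (I : Finset (Fin r)) :
    parityPart ε a I = if (I.card : ZMod 2) = ε then a I else 0 := rfl

theorem hasParity_parityPart (ε : ZMod 2) (a : Grassmann r) : (parityPart ε a).HasParity ε :=
  hasParity_iff.2 fun _ hI => if_neg hI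

theorem HasParity.parityPart_eq {ε : ZMod 2} {a : Grassmann r} (ha : a.HasParity ε) :
    parityPart ε a = a := by
  ext I
  rw [parityPart_apply]
  split_ifs with h
  · rfl
  · exact (ha.apply_eq_zero h).symm

theorem parityPart_add_parityPart (a : Grassmann r) :
    parityPart 0 a + parityPart 1 a = a := by
  ext I
  rw [add_apply, parityPart_apply, parityPart_apply]
  rcases eq_zero_or_eq_one (I.card : ZMod 2) with h | h <;> simp [h]

theorem HasParity.soul {ε : ZMod 2} {a : Grassmann r} (ha : a.HasParity ε) :
    (Grassmann.soul a).HasParity ε :=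
  hasParity_iff.2 fun I hI => by
    rw [Grassmann.soul]
    split_ifs
    · rfl
    · exact ha.apply_eq_zero hI

theorem body_smul_one_add_soul (a : Grassmann r) : a.body • (1 : Grassmann r) + a.soul = a := by
  ext I
  rw [add_apply, smul_apply, one_apply, soul, body]
  split_ifs with h
  · rw [h, mul_one, add_zero]
  · rw [mul_zero, zero_add]

theorem HasParity.body_eq_zero {a : Grassmann r} (ha : a.HasParity 1) : a.body = 0 :=
  ha.apply_eq_zero (by simp)

/-- The soul as a linear map. -/
def soulLM : Grassmann r →ₗ[ℝ] Grassmann r where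
  toFun := soul
  map_add' a b := by
    ext I
    rw [add_apply, soul, soul, soul, add_apply]
    split_ifs <;> simp
  map_smul' c a := by
    ext I
    change soul (c • a) I = c * soul a I
    rw [soul, soul, smul_apply]
    split_ifs <;> simp

end Grassmann

/-- The exponential of a nilpotent derivation is multiplicative. -/
theorem sum_pow_derivation_mul {B : Type*} [Ring B] [Algebra ℝ B] (D : B →ₗ[ℝ] B)
    (hD : ∀ x y, D (x * y) = x * D y + D x * y) {N : ℕ} (hN : D ^ N = 0) (x y : B) :
    ∑ k ∈ Finset.range N, ((k.factorial : ℝ)⁻¹) • (D ^ k) (x * y) =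
      (∑ k ∈ Finset.range N, ((k.factorial : ℝ)⁻¹) • (D ^ k) x) *
      ∑ k ∈ Finset.range N, ((k.factorial : ℝ)⁻¹) • (D ^ k) y := by
  -- Mathlib's exponential of a nilpotent element has rational coefficients
  let _ : Module ℚ B := Module.compHom B (algebraMap ℚ ℝ)
  have hq : ∀ (q : ℚ) (b : B), q • b = (q : ℝ) • b := fun _ _ => rfl
  have h : ∀ b : B, IsNilpotent.exp D b =
      ∑ k ∈ Finset.range N, ((k.factorial : ℝ)⁻¹) • (D ^ k) b := fun b => by
    rw [IsNilpotent.exp_eq_sum hN, LinearMap.sum_apply]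
    refine Finset.sum_congr rfl fun k _ => ?_
    rw [LinearMap.smul_apply, hq]
    push_cast
    rfl
  rw [← h, ← h, ← h]
  exact Module.End.exp_mul_of_derivation ℝ B D hD ⟨N, hN⟩ x y

namespace SuperFun

open Grassmann

variable {n m P : ℕ}

/-! ### The displacement operator -/

/-- A constant of the algebra of the parameters as a function. -/
def param (n m : ℕ) {P : ℕ} (a : Grassmann P) : smoothAlg n m P :=
  ⟨fun _ => a.rename (Fin.natAddOrderEmb (m + m)), smooth_const _⟩

theorem param_coe (a : Grassmann P) :
    (param n m a : SuperFun n m P) = fun _ => a.rename (Fin.natAddOrderEmb (m + m)) := rfl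

/-- The operator `∑_M ξ^M ∂→/∂x^M` on smooth functions. -/
def displaceLM (ξ : CoordIdx n m → Grassmann P) : smoothAlg n m P →ₗ[ℝ] smoothAlg n m P :=
  ∑ M : CoordIdx n m, LinearMap.mulLeft ℝ (param n m (ξ M)) ∘ₗ pd M

theorem displaceLM_apply (ξ : CoordIdx n m → Grassmann P) (F : smoothAlg n m P) :
    displaceLM ξ F = ∑ M : CoordIdx n m, param n m (ξ M) * pd M F := by
  rw [displaceLM, LinearMap.sum_apply]
  rfl

theorem displaceLM_coe (ξ : CoordIdx n m → Grassmann P) (F : smoothAlg n m P) :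
    (displaceLM ξ F : SuperFun n m P) = displace ξ F.1 := by
  rw [displaceLM_apply, AddSubmonoidClass.coe_finsetSum]
  funext z
  rw [Finset.sum_apply]
  rfl

theorem displaceLM_pow_coe (ξ : CoordIdx n m → Grassmann P) (k : ℕ) (F : smoothAlg n m P) :
    (((displaceLM ξ) ^ k) F : SuperFun n m P) = (displace ξ)^[k] F.1 := by
  induction k with
  | zero => rfl
  | succ k ih => rw [pow_succ', Module.End.mul_apply, displaceLM_coe, ih,
      Function.iterate_succ_apply']

theorem hasParity_param {a : Grassmann P} {ε : ZMod 2} (ha : a.HasParity ε) :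
    HasParity ε (param n m a : SuperFun n m P) := fun _ => ha.rename _

theorem exists_parity_decomp (F : smoothAlg n m P) :
    ∃ F₀ F₁ : smoothAlg n m P, HasParity 0 F₀.1 ∧ HasParity 1 F₁.1 ∧ F = F₀ + F₁ :=
  ⟨⟨fun z => parityPart 0 (F.1 z), contDiff_linear (parityPart 0) (mem_smoothAlg.1 F.2)⟩,
    ⟨fun z => parityPart 1 (F.1 z), contDiff_linear (parityPart 1) (mem_smoothAlg.1 F.2)⟩,
    fun _ => hasParity_parityPart 0 _, fun _ => hasParity_parityPart 1 _,
    Subtype.ext (funext fun _ => (parityPart_add_parityPart _).symm)⟩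

theorem pd_mul {ε : ZMod 2} (M : CoordIdx n m) {F : smoothAlg n m P} (hF : HasParity ε F.1)
    (G : smoothAlg n m P) :
    pd M (F * G) = pd M F * G + paritySign (coordParity M * ε) • (F * pd M G) :=
  Subtype.ext (leftPD_mul M F.2 G.2 hF)

theorem pd_param (M : CoordIdx n m) (a : Grassmann P) : pd M (param n m a) = 0 :=
  Subtype.ext (leftPD_const_rename M a)

theorem param_mul_comm {ε δ : ZMod 2} {a : Grassmann P} (ha : a.HasParity ε)
    {F : smoothAlg n m P} (hF : HasParity δ F.1) :
    param n m a * F = paritySign (ε * δ) • (F * param n m a) :=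
  Subtype.ext ((hasParity_param ha).mul_comm hF)

/-- The components `ξ^M` have the parities of the coordinates, so that the displacement operator is
an even derivation. -/
theorem displaceLM_mul {ξ : CoordIdx n m → Grassmann P} (hξ : IsPoint ξ)
    (F G : smoothAlg n m P) :
    displaceLM ξ (F * G) = F * displaceLM ξ G + displaceLM ξ F * G := by
  have key : ∀ (ε : ZMod 2) (F : smoothAlg n m P), HasParity ε F.1 →
      displaceLM ξ (F * G) = F * displaceLM ξ G + displaceLM ξ F * G := by
    intro ε F hF
    simp only [displaceLM_apply, Finset.mul_sum, Finset.sum_mul, ← Finset.sum_add_distrib]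
    refine Finset.sum_congr rfl fun M _ => ?_
    rw [pd_mul M hF, mul_add, add_comm (_ * (pd M F * G)), mul_smul_comm, ← mul_assoc,
      ← mul_assoc, ← mul_assoc,
      param_mul_comm (hξ M) hF, smul_mul_assoc, smul_smul, paritySign_mul_self, one_smul]
  obtain ⟨F₀, F₁, h₀, h₁, rfl⟩ := exists_parity_decomp F
  rw [add_mul, map_add, key 0 F₀ h₀, key 1 F₁ h₁, map_add, add_mul, add_mul]
  abel

theorem displaceLM_param (ξ : CoordIdx n m → Grassmann P) (a : Grassmann P) :
    displaceLM ξ (param n m a) = 0 := by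
  rw [displaceLM_apply]
  exact Finset.sum_eq_zero fun M _ => by rw [pd_param, mul_zero]

/-- Displacement operators commute, being even with constant coefficients. -/
theorem displaceLM_displaceLM {ξ η : CoordIdx n m → Grassmann P} (hξ : IsPoint ξ)
    (hη : IsPoint η) (F : smoothAlg n m P) :
    displaceLM ξ (displaceLM η F) = displaceLM η (displaceLM ξ F) := by
  have key : ∀ {ξ η : CoordIdx n m → Grassmann P}, IsPoint ξ →
      displaceLM ξ (displaceLM η F) = ∑ N : CoordIdx n m, ∑ M : CoordIdx n m,
        param n m (η N) * (param n m (ξ M) * pd M (pd N F)) := by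
    intro ξ η hξ
    rw [displaceLM_apply η, map_sum]
    refine Finset.sum_congr rfl fun N _ => ?_
    rw [displaceLM_mul hξ, displaceLM_param, zero_mul, add_zero, displaceLM_apply, Finset.mul_sum]
  rw [key hξ, key hη, Finset.sum_comm]
  refine Finset.sum_congr rfl fun M _ => Finset.sum_congr rfl fun N _ => ?_
  have h : pd M (pd N F) = paritySign (coordParity M * coordParity N) • pd N (pd M F) :=
    Subtype.ext (leftPD_leftPD M N F.2)
  rw [h, ← mul_assoc, ← mul_assoc, param_mul_comm (hη N) (hasParity_param (hξ M)),
    mul_comm (coordParity N), mul_smul_comm, smul_mul_assoc, smul_smul, paritySign_mul_self,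
    one_smul]

theorem dir_displaceLM (v : ℝ × (Fin n ⊕ Fin n → ℝ)) (ξ : CoordIdx n m → Grassmann P)
    (F : smoothAlg n m P) : dir v (displaceLM ξ F) = displaceLM ξ (dir v F) := by
  rw [displaceLM_apply, displaceLM_apply, map_sum]
  refine Finset.sum_congr rfl fun M _ => Subtype.ext ?_
  change dirPD v ((param n m (ξ M)).1 * leftPD M F.1) = (param n m (ξ M)).1 * leftPD M (dirPD v F.1)
  rw [dirPD_mul v (param n m (ξ M)).2 (F.2.leftPD M), param_coe, dirPD_const, zero_mul, zero_add,
    leftPD_dirPD v M F.2]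

/-! ### Nilpotency -/

/-- The degree of a monomial in the parameters. -/
def paramDegree (I : Finset (Fin (m + m + P))) : ℕ := (I.filter (fun i => m + m ≤ i.val)).card

/-- All terms of `F` have at least degree `k` in the parameters. -/
def ParamOrder (k : ℕ) (F : SuperFun n m P) : Prop := ∀ z I, F z I ≠ 0 → k ≤ paramDegree I

theorem ParamOrder.sum {ι : Type*} (t : Finset ι) {k : ℕ} {F : ι → SuperFun n m P}
    (hF : ∀ i ∈ t, ParamOrder k (F i)) : ParamOrder k (∑ i ∈ t, F i) := by
  refine Finset.sum_induction _ (fun G : SuperFun n m P => ParamOrder k G) ?_ ?_ hF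
  · intro F G hF hG z I h
    by_contra hk
    have h1 : F z I = 0 := by_contra fun h1 => hk (hF z I h1)
    have h2 : G z I = 0 := by_contra fun h2 => hk (hG z I h2)
    exact h (by rw [Pi.add_apply, add_apply, h1, h2, add_zero])
  · exact fun z I h => absurd rfl h

theorem paramDegree_le (I : Finset (Fin (m + m + P))) : paramDegree I ≤ P := by
  have h : I.filter (fun i => m + m ≤ i.val) ⊆
      Finset.univ.map (Fin.natAddOrderEmb (m + m) : Fin P ↪o Fin (m + m + P)).toEmbedding := by
    intro i hi
    have hi' := (Finset.mem_filter.1 hi).2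
    refine Finset.mem_map.2 ⟨⟨i.val - (m + m), by omega⟩, Finset.mem_univ _, ?_⟩
    apply Fin.ext
    change m + m + (i.val - (m + m)) = i.val
    omega
  refine (Finset.card_le_card h).trans ?_
  rw [Finset.card_map, Finset.card_univ, Fintype.card_fin]

theorem ParamOrder.eq_zero {k : ℕ} (hk : P < k) {F : SuperFun n m P} (hF : ParamOrder k F) :
    F = 0 := by
  funext z
  ext I
  by_contra h
  have := (hF z I h).trans (paramDegree_le I)
  omega

theorem ParamOrder.leftPD (M : CoordIdx n m) {k : ℕ} {F : SuperFun n m P} (hF : ParamOrder k F)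
    (hs : Smooth F) : ParamOrder k (SuperFun.leftPD M F) := by
  rcases leftPD_cases M with ⟨_, u, hu⟩ | ⟨_, g, hg⟩
  · rw [(hu P).1]
    intro z I hI
    by_contra hk
    refine hI ?_
    rw [dirPD_apply_coeff _ hs, show (fun y => F y I) = fun _ => 0 from
      funext fun y => by_contra fun h => hk (hF y I h), fderiv_fun_const]
    rfl
  · rw [(hg P).1]
    intro z I hI
    change leftDeriv (Fin.castAdd P g) (F z) I ≠ 0 at hI
    have hgI : Fin.castAdd P g ∉ I := fun h => hI (leftDeriv_apply_of_mem h _)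
    rw [leftDeriv_apply_of_notMem hgI] at hI
    have h := hF z _ (right_ne_zero_of_mul hI)
    rw [paramDegree, Finset.filter_insert, if_neg (by simp)] at h
    exact h

/-- Multiplication by a parameter without body raises the order. -/
theorem ParamOrder.param_mul {k : ℕ} {F : SuperFun n m P} (hF : ParamOrder k F)
    {a : Grassmann P} (ha : a.body = 0) : ParamOrder (k + 1) ((param n m a).1 * F) := by
  intro z I hI
  rw [Pi.mul_apply, mul_apply] at hI
  obtain ⟨A, hA, hne⟩ := Finset.exists_ne_zero_of_sum_ne_zero hI
  have h1 := right_ne_zero_of_mul (right_ne_zero_of_mul hne)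
  have h2 : a.rename (Fin.natAddOrderEmb (m + m)) A ≠ 0 :=
    left_ne_zero_of_mul (right_ne_zero_of_mul hne)
  have hAI := Finset.mem_powerset.1 hA
  have h3 : 1 ≤ paramDegree A := by
    by_cases h : ∃ B : Finset (Fin P), B.map (Fin.natAddOrderEmb (m + m)).toEmbedding = A
    · obtain ⟨B, rfl⟩ := h
      have hB : B ≠ ∅ := by
        rintro rfl
        rw [rename_apply_map] at h2
        exact h2 ha
      rw [Nat.one_le_iff_ne_zero, paramDegree, Finset.card_ne_zero]
      obtain ⟨b, hb⟩ := Finset.nonempty_iff_ne_empty.2 hB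
      refine ⟨Fin.natAddOrderEmb (m + m) b, ?_⟩
      exact Finset.mem_filter.2 ⟨Finset.mem_map_of_mem _ hb, Nat.le_add_right _ _⟩
    · rw [rename_apply_of_ne _ _ fun K hK => h ⟨K, hK⟩] at h2
      exact absurd rfl h2
  have h4 := hF z _ h1
  have h5 : paramDegree (I \ A) + paramDegree A = paramDegree I := by
    unfold paramDegree
    rw [← Finset.card_union_of_disjoint
      (Finset.disjoint_filter_filter Finset.sdiff_disjoint), ← Finset.filter_union,
      Finset.sdiff_union_of_subset hAI]
  omega

theorem ParamOrder.displaceLM {k : ℕ} {F : smoothAlg n m P} (hF : ParamOrder k F.1)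
    {ξ : CoordIdx n m → Grassmann P} (hξ : ∀ M, (ξ M).body = 0) :
    ParamOrder (k + 1) (SuperFun.displaceLM ξ F).1 := by
  rw [displaceLM_apply, AddSubmonoidClass.coe_finsetSum]
  exact ParamOrder.sum _ fun M _ => ParamOrder.param_mul (hF.leftPD M F.2) (hξ M)

theorem ParamOrder.displaceLM_pow {j : ℕ} {F : smoothAlg n m P} (hF : ParamOrder j F.1)
    {ξ : CoordIdx n m → Grassmann P} (hξ : ∀ M, (ξ M).body = 0) (k : ℕ) :
    ParamOrder (j + k) (((SuperFun.displaceLM ξ) ^ k) F).1 := by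
  induction k with
  | zero => exact hF
  | succ k ih =>
    rw [pow_succ', Module.End.mul_apply]
    exact ih.displaceLM hξ

/-- Each application of the operator raises the degree in the `P` parameters. -/
theorem displaceLM_pow_eq_zero {ξ : CoordIdx n m → Grassmann P} (hξ : ∀ M, (ξ M).body = 0) :
    (displaceLM (n := n) ξ) ^ (P + 1) = 0 := by
  refine LinearMap.ext fun F => Subtype.ext ?_
  have h : ParamOrder 0 F.1 := fun _ _ _ => Nat.zero_le _
  exact (h.displaceLM_pow hξ (P + 1)).eq_zero (by omega)

end SuperFun

namespace SuperFun

open Grassmann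

variable {n m P P' : ℕ}

/-! ### Taylor expansion around the body -/

/-- The value at a real point with vanishing fermionic coordinates. -/
def evalAt (z : ℝ × (Fin n ⊕ Fin n → ℝ)) : smoothAlg n m P →ₐ[ℝ] Grassmann P :=
  ((restrict (Fin.natAddOrderEmb (m + m))).comp (Pi.evalAlgHom ℝ _ z)).comp (smoothAlg n m P).val

theorem evalAt_apply (z : ℝ × (Fin n ⊕ Fin n → ℝ)) (F : smoothAlg n m P) :
    evalAt z F = restrict (Fin.natAddOrderEmb (m + m)) (F.1 z) := rfl

/-- The truncated exponential of the displacement operator. -/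
def expDisplace (ξ : CoordIdx n m → Grassmann P) : smoothAlg n m P →ₗ[ℝ] smoothAlg n m P :=
  ∑ k ∈ Finset.range (P + 1), ((k.factorial : ℝ)⁻¹) • (displaceLM ξ) ^ k

theorem expDisplace_apply (ξ : CoordIdx n m → Grassmann P) (F : smoothAlg n m P) :
    expDisplace ξ F =
      ∑ k ∈ Finset.range (P + 1), ((k.factorial : ℝ)⁻¹) • ((displaceLM ξ) ^ k) F := by
  rw [expDisplace, LinearMap.sum_apply]
  rfl

/-- The value of a function at a Grassmann-valued point, by Taylor expansion around its body. -/
def taylor (t : ℝ) (X : CoordIdx n m → Grassmann P) : smoothAlg n m P →ₗ[ℝ] Grassmann P :=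
  (evalAt (t, bodyPoint X)).toLinearMap ∘ₗ expDisplace fun M => (X M).soul

theorem taylor_apply (t : ℝ) (X : CoordIdx n m → Grassmann P) (F : smoothAlg n m P) :
    taylor t X F = evalAt (t, bodyPoint X) (expDisplace (fun M => (X M).soul) F) := rfl

theorem Smooth.extend (hP : P ≤ P') {F : SuperFun n m P} (hF : Smooth F) :
    Smooth (F.extend hP) :=
  contDiff_linear (renameLM (Fin.castLEOrderEmb (Nat.add_le_add_left hP (m + m)))) hF

theorem value_eq_taylor (hP : P ≤ P') {F : SuperFun n m P} (hF : Smooth F) (t : ℝ)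
    (X : CoordIdx n m → Grassmann P') :
    value hP F t X = taylor t X ⟨F.extend hP, hF.extend hP⟩ := by
  rw [taylor_apply, expDisplace_apply, evalAt_apply, AddSubmonoidClass.coe_finsetSum,
    Finset.sum_apply]
  have h : ∀ k : ℕ, (((k.factorial : ℝ)⁻¹ • ((displaceLM fun M => (X M).soul) ^ k)
      (⟨F.extend hP, hF.extend hP⟩ : smoothAlg n m P') : smoothAlg n m P') : SuperFun n m P')
      (t, bodyPoint X) = (k.factorial : ℝ)⁻¹ •
        ((displace (fun M => (X M).soul))^[k] (F.extend hP)) (t, bodyPoint X) := fun k => by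
    rw [← displaceLM_pow_coe _ k ⟨F.extend hP, hF.extend hP⟩]
    rfl
  simp only [h]
  rfl

theorem isPoint_soul {X : CoordIdx n m → Grassmann P} (hX : IsPoint X) :
    IsPoint fun M => (X M).soul := fun M => (hX M).soul

theorem body_soul (a : Grassmann P) : a.soul.body = 0 :=
  show (if (∅ : Finset (Fin P)) = ∅ then 0 else a ∅) = 0 from if_pos rfl

theorem expDisplace_mul {ξ : CoordIdx n m → Grassmann P} (hξ : IsPoint ξ)
    (hb : ∀ M, (ξ M).body = 0) (F G : smoothAlg n m P) :
    expDisplace ξ (F * G) = expDisplace ξ F * expDisplace ξ G := by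
  simp only [expDisplace_apply]
  exact sum_pow_derivation_mul _ (displaceLM_mul hξ) (displaceLM_pow_eq_zero hb) F G

/-- The value at a point is multiplicative, as the composite of the exponential of a derivation with
an evaluation. -/
theorem taylor_mul (t : ℝ) {X : CoordIdx n m → Grassmann P} (hX : IsPoint X)
    (F G : smoothAlg n m P) : taylor t X (F * G) = taylor t X F * taylor t X G := by
  rw [taylor_apply, expDisplace_mul (isPoint_soul hX) (fun M => body_soul _), map_mul]
  rfl

theorem taylor_param (t : ℝ) (X : CoordIdx n m → Grassmann P) (a : Grassmann P) :
    taylor t X (param n m a) = a := by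
  rw [taylor_apply, expDisplace_apply, Finset.sum_eq_single 0]
  · rw [pow_zero, Nat.factorial_zero, Nat.cast_one, inv_one, one_smul]
    exact restrict_rename _ a
  · intro k _ hk
    obtain ⟨j, rfl⟩ := Nat.exists_eq_succ_of_ne_zero hk
    rw [Nat.succ_eq_add_one, pow_succ, Module.End.mul_apply, displaceLM_param, map_zero, smul_zero]
  · simp

theorem displaceLM_add (ξ η : CoordIdx n m → Grassmann P) :
    displaceLM (n := n) (fun M => ξ M + η M) = displaceLM ξ + displaceLM η := by
  refine LinearMap.ext fun F => ?_
  rw [LinearMap.add_apply, displaceLM_apply, displaceLM_apply, displaceLM_apply,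
    ← Finset.sum_add_distrib]
  refine Finset.sum_congr rfl fun M _ => ?_
  rw [← add_mul]
  congr 1
  exact Subtype.ext (funext fun _ => map_add (renameLM (Fin.natAddOrderEmb (m + m))) (ξ M) (η M))

theorem displaceLM_smul (c : ℝ) (ξ : CoordIdx n m → Grassmann P) :
    displaceLM (n := n) (fun M => c • ξ M) = c • displaceLM ξ := by
  refine LinearMap.ext fun F => ?_
  rw [LinearMap.smul_apply, displaceLM_apply, displaceLM_apply, Finset.smul_sum]
  refine Finset.sum_congr rfl fun M _ => ?_
  rw [← smul_mul_assoc]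
  congr 1
  exact Subtype.ext (funext fun _ => map_smul (renameLM (Fin.natAddOrderEmb (m + m))) c (ξ M))

theorem bodyPoint_add_smul (X Y : CoordIdx n m → Grassmann P) (s : ℝ) :
    bodyPoint (X + s • Y) = bodyPoint X + s • bodyPoint Y := by
  funext i
  rcases i with i | i <;> rfl

theorem soul_add_smul (a b : Grassmann P) (s : ℝ) : (a + s • b).soul = a.soul + s • b.soul := by
  have h := (soulLM (r := P)).map_add a (s • b)
  rw [map_smul] at h
  exact h

theorem hasDerivAt_eval_line (F : smoothAlg n m P) (z v : ℝ × (Fin n ⊕ Fin n → ℝ)) :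
    HasDerivAt (fun s : ℝ => F.1 (z + s • v)) ((dir v F).1 z) 0 := by
  have hF : DifferentiableAt ℝ F.1 (z + (0 : ℝ) • v) := Smooth.differentiableAt F.2 _
  have h : HasDerivAt (fun s : ℝ => z + s • v) v 0 := by
    simpa using ((hasDerivAt_id (0 : ℝ)).smul_const v).const_add z
  have h2 := hF.hasFDerivAt.comp_hasDerivAt (0 : ℝ) h
  rw [zero_smul, add_zero] at h2
  exact h2

/-- The derivative at `s = 0` of `(A + s B)^k F` at the point `z + s v`, for commuting `A`, `B`. -/
theorem hasDerivAt_pow_line {A B : smoothAlg n m P →ₗ[ℝ] smoothAlg n m P}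
    (hAB : ∀ F, A (B F) = B (A F)) (z v : ℝ × (Fin n ⊕ Fin n → ℝ)) (k : ℕ)
    (F : smoothAlg n m P) :
    HasDerivAt (fun s : ℝ => (((A + s • B) ^ k) F).1 (z + s • v))
      ((dir v ((A ^ k) F) + (k : ℝ) • (A ^ (k - 1)) (B F)).1 z) 0 := by
  induction k generalizing F with
  | zero =>
    simp only [pow_zero, Module.End.one_apply, Nat.cast_zero, zero_smul, add_zero]
    exact hasDerivAt_eval_line F z v
  | succ k ih =>
    have e : ∀ s : ℝ, (((A + s • B) ^ (k + 1)) F).1 (z + s • v)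
        = (((A + s • B) ^ k) (A F)).1 (z + s • v)
          + s • (((A + s • B) ^ k) (B F)).1 (z + s • v) := fun s => by
      rw [pow_succ, Module.End.mul_apply, LinearMap.add_apply, LinearMap.smul_apply, map_add,
        map_smul]
      rfl
    have h := (ih (A F)).add ((hasDerivAt_id (0 : ℝ)).smul (ih (B F)))
    simp only [id, zero_smul, add_zero, one_smul, zero_add] at h
    have e2 : (dir v ((A ^ (k + 1)) F) + ((k + 1 : ℕ) : ℝ) • (A ^ (k + 1 - 1)) (B F))
        = (dir v ((A ^ k) (A F)) + (k : ℝ) • (A ^ (k - 1)) (B (A F))) + (A ^ k) (B F) := by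
      have e3 : (k : ℝ) • (A ^ (k - 1)) (B (A F)) = (k : ℝ) • (A ^ k) (B F) := by
        rcases Nat.eq_zero_or_pos k with rfl | hk
        · simp
        · obtain ⟨j, rfl⟩ := Nat.exists_eq_succ_of_ne_zero hk.ne'
          rw [← hAB, Nat.succ_sub_one, Nat.succ_eq_add_one, pow_succ, Module.End.mul_apply]
      rw [e3, pow_succ, Module.End.mul_apply, Nat.add_sub_cancel, Nat.cast_succ, add_smul, one_smul]
      exact (add_assoc _ _ _).symm
    rw [e2]
    exact h.congr_of_eventuallyEq (Filter.Eventually.of_forall e)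

theorem zero_prodMk_eq_sum {κ : Type*} [Fintype κ] [DecidableEq κ] (x : κ → ℝ) :
    ((0 : ℝ), x) = ∑ i, x i • ((0 : ℝ), (Pi.single i 1 : κ → ℝ)) := by
  refine Prod.ext ?_ ?_
  · simp [Prod.fst_sum]
  · funext j
    simp [Prod.snd_sum, Pi.single_apply]

/-- The direction `(τ, Y)` splits into a real direction and a nilpotent displacement. -/
theorem dir_add_displaceLM_soul (τ : ℝ) {Y : CoordIdx n m → Grassmann P} (hY : IsPoint Y)
    (F : smoothAlg n m P) :
    dir (τ, bodyPoint Y) F + displaceLM (fun M => (Y M).soul) F =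
      τ • dir (1, 0) F + displaceLM Y F := by
  have h1 : displaceLM Y F = displaceLM (fun M => (Y M).body • (1 : Grassmann P)) F
      + displaceLM (fun M => (Y M).soul) F := by
    rw [← LinearMap.add_apply, ← displaceLM_add]
    simp only [body_smul_one_add_soul]
  have h2 : displaceLM (fun M => (Y M).body • (1 : Grassmann P)) F = dir (0, bodyPoint Y) F := by
    refine Subtype.ext (funext fun z => ?_)
    have h4 : ∀ M : CoordIdx n m, (param n m ((Y M).body • (1 : Grassmann P)) * pd M F).1 z
        = (Y M).body • leftPD M F.1 z := fun M => by
      change ((Y M).body • (1 : Grassmann P)).rename _ * leftPD M F.1 z = _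
      rw [← renameLM_apply, map_smul, renameLM_apply, rename_one, smul_mul_assoc, one_mul]
    have hf : ∀ μ : Fin m, (Y (.inl (.inr μ))).body = 0 ∧ (Y (.inr (.inr μ))).body = 0 :=
      fun μ => ⟨(hY (.inl (.inr μ))).body_eq_zero, (hY (.inr (.inr μ))).body_eq_zero⟩
    rw [displaceLM_apply, AddSubmonoidClass.coe_finsetSum, Finset.sum_apply,
      Finset.sum_congr rfl fun M _ => h4 M, dir_coe, zero_prodMk_eq_sum (bodyPoint Y)]
    change _ = fderiv ℝ F.1 z _
    rw [map_sum, Fintype.sum_sum_type, Fintype.sum_sum_type, Fintype.sum_sum_type,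
      Fintype.sum_sum_type]
    simp only [hf, zero_smul, Finset.sum_const_zero, add_zero, map_smul]
    rfl
  have h5 : dir (τ, bodyPoint Y) F = τ • dir (1, 0) F + dir (0, bodyPoint Y) F := by
    refine Subtype.ext (funext fun z => ?_)
    change fderiv ℝ F.1 z (τ, bodyPoint Y) = τ • fderiv ℝ F.1 z (1, 0) + fderiv ℝ F.1 z (0, _)
    rw [← map_smul, ← map_add]
    simp
  rw [h1, h2, h5]
  exact add_assoc _ _ _

theorem displaceLM_pow_comm {T : smoothAlg n m P →ₗ[ℝ] smoothAlg n m P}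
    {ξ : CoordIdx n m → Grassmann P} (h : ∀ F, T (displaceLM ξ F) = displaceLM ξ (T F)) (k : ℕ)
    (F : smoothAlg n m P) : T (((displaceLM ξ) ^ k) F) = ((displaceLM ξ) ^ k) (T F) := by
  induction k with
  | zero => rfl
  | succ k ih => rw [pow_succ', Module.End.mul_apply, h, ih, Module.End.mul_apply]

theorem taylor_displaceLM (t : ℝ) {X : CoordIdx n m → Grassmann P} (hX : IsPoint X)
    (Y : CoordIdx n m → Grassmann P) (F : smoothAlg n m P) :
    taylor t X (displaceLM Y F) = ∑ M, Y M * taylor t X (pd M F) := by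
  rw [displaceLM_apply, map_sum]
  exact Finset.sum_congr rfl fun M _ => by rw [taylor_mul t hX, taylor_param]

/-- The chain rule along lines. -/
theorem hasDerivAt_taylor_line (t τ : ℝ) {X Y : CoordIdx n m → Grassmann P} (hX : IsPoint X)
    (hY : IsPoint Y) (F : smoothAlg n m P) :
    HasDerivAt (fun s : ℝ => taylor (t + s * τ) (X + s • Y) F)
      (τ • taylor t X (dir (1, 0) F) + ∑ M, Y M * taylor t X (pd M F)) 0 := by
  set A := displaceLM (n := n) fun M => (X M).soul with hA
  set B := displaceLM (n := n) fun M => (Y M).soul with hB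
  set v : ℝ × (Fin n ⊕ Fin n → ℝ) := (τ, bodyPoint Y)
  set z : ℝ × (Fin n ⊕ Fin n → ℝ) := (t, bodyPoint X)
  have hAB : ∀ F, A (B F) = B (A F) :=
    displaceLM_displaceLM (isPoint_soul hX) (isPoint_soul hY)
  have e : ∀ s : ℝ, taylor (t + s * τ) (X + s • Y) F =
      restrict (Fin.natAddOrderEmb (m + m)) (∑ k ∈ Finset.range (P + 1),
        ((k.factorial : ℝ)⁻¹) • (((A + s • B) ^ k) F).1 (z + s • v)) := fun s => by
    have e1 : (displaceLM (n := n) fun M => ((X + s • Y) M).soul) = A + s • B := by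
      rw [hA, hB, ← displaceLM_smul, ← displaceLM_add]
      congr 1
      exact funext fun M => soul_add_smul _ _ _
    rw [taylor_apply, expDisplace_apply, e1, bodyPoint_add_smul, evalAt_apply,
      AddSubmonoidClass.coe_finsetSum, Finset.sum_apply]
    rfl
  have h1 : HasDerivAt (fun s : ℝ => ∑ k ∈ Finset.range (P + 1),
        ((k.factorial : ℝ)⁻¹) • (((A + s • B) ^ k) F).1 (z + s • v))
      (∑ k ∈ Finset.range (P + 1), ((k.factorial : ℝ)⁻¹) •
        (dir v ((A ^ k) F) + (k : ℝ) • (A ^ (k - 1)) (B F)).1 z) 0 :=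
    HasDerivAt.fun_sum fun k _ => (hasDerivAt_pow_line hAB z v k F).fun_const_smul _
  have h2 := (LinearMap.toContinuousLinearMap (restrict (Fin.natAddOrderEmb (m + m) :
    Fin P ↪o Fin (m + m + P))).toLinearMap).hasFDerivAt.comp_hasDerivAt (0 : ℝ) h1
  have h3 : ∑ k ∈ Finset.range (P + 1), ((k.factorial : ℝ)⁻¹) •
        (dir v ((A ^ k) F) + (k : ℝ) • (A ^ (k - 1)) (B F))
      = expDisplace (fun M => (X M).soul) (dir v F + B F) := by
    have h4 : ∑ k ∈ Finset.range (P + 1), ((k.factorial : ℝ)⁻¹) • (k : ℝ) • (A ^ (k - 1)) (B F)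
        = ∑ k ∈ Finset.range (P + 1), ((k.factorial : ℝ)⁻¹) • (A ^ k) (B F) := by
      rw [Finset.sum_range_succ', Finset.sum_range_succ]
      -- the displacement `B` raises the order, so that the last term vanishes
      have h5 : (A ^ P) (B F) = 0 := by
        have h6 : ParamOrder 0 F.1 := fun _ _ _ => Nat.zero_le _
        have h7 : ParamOrder (0 + 1) (B F).1 := h6.displaceLM fun M => body_soul _
        exact Subtype.ext ((h7.displaceLM_pow (fun M => body_soul _) P).eq_zero (by omega))
      rw [h5, smul_zero, Nat.cast_zero, zero_smul, smul_zero]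
      congr 1
      refine Finset.sum_congr rfl fun k _ => ?_
      rw [Nat.add_sub_cancel, smul_smul, Nat.factorial_succ]
      congr 1
      push_cast
      field_simp
    rw [expDisplace_apply]
    simp only [map_add, smul_add, Finset.sum_add_distrib]
    rw [h4]
    congr 1
    exact Finset.sum_congr rfl fun k _ => by
      rw [displaceLM_pow_comm fun F => dir_displaceLM v _ F]
  have h8 : taylor t X (dir v F + B F) =
      restrict (Fin.natAddOrderEmb (m + m)) (∑ k ∈ Finset.range (P + 1), ((k.factorial : ℝ)⁻¹) •
        (dir v ((A ^ k) F) + (k : ℝ) • (A ^ (k - 1)) (B F)).1 z) := by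
    rw [taylor_apply, ← h3, evalAt_apply, AddSubmonoidClass.coe_finsetSum, Finset.sum_apply]
    rfl
  rw [← taylor_displaceLM t hX, ← map_smul, ← map_add, ← dir_add_displaceLM_soul τ hY, h8]
  exact h2.congr_of_eventuallyEq (Filter.Eventually.of_forall e)

end SuperFun

namespace SuperFun

open Grassmann

variable {n m P P' : ℕ}

/-! ### Algebra of values -/

theorem HasParity.extend (hP : P ≤ P') {ε : ZMod 2} {F : SuperFun n m P} (hF : HasParity ε F) :
    HasParity ε (F.extend hP) := fun z => (hF z).rename _

theorem dirPD_extend (hP : P ≤ P') (v : ℝ × (Fin n ⊕ Fin n → ℝ)) {F : SuperFun n m P}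
    (hF : Smooth F) : dirPD v (F.extend hP) = (dirPD v F).extend hP :=
  dirPD_linear v (renameLM (Fin.castLEOrderEmb (Nat.add_le_add_left hP (m + m)))) hF

theorem leftPD_extend (hP : P ≤ P') (M : CoordIdx n m) {F : SuperFun n m P} (hF : Smooth F) :
    leftPD M (F.extend hP) = (leftPD M F).extend hP := by
  rcases leftPD_cases M with ⟨_, u, hu⟩ | ⟨_, g, hg⟩
  · rw [(hu P).1, (hu P').1]
    exact dirPD_extend hP _ hF
  · rw [(hg P).1, (hg P').1]
    exact funext fun z => leftDeriv_rename
      (Fin.castLEOrderEmb (Nat.add_le_add_left hP (m + m))) (Fin.castAdd P g) (F z)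

section Value

variable (hP : P ≤ P') (t : ℝ) (X : CoordIdx n m → Grassmann P')

theorem value_add {F G : SuperFun n m P} (hF : Smooth F) (hG : Smooth G) :
    value hP (F + G) t X = value hP F t X + value hP G t X := by
  rw [value_eq_taylor hP hF, value_eq_taylor hP hG, value_eq_taylor hP (hF.add hG), ← map_add]
  congr 1
  exact Subtype.ext (funext fun z =>
    map_add (renameLM (Fin.castLEOrderEmb (Nat.add_le_add_left hP (m + m)))) (F z) (G z))

theorem value_smul (c : ℝ) {F : SuperFun n m P} (hF : Smooth F) :
    value hP (c • F) t X = c • value hP F t X := by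
  rw [value_eq_taylor hP hF, value_eq_taylor hP (hF.smul c), ← map_smul]
  congr 1
  exact Subtype.ext (funext fun z =>
    map_smul (renameLM (Fin.castLEOrderEmb (Nat.add_le_add_left hP (m + m)))) c (F z))

theorem value_neg {F : SuperFun n m P} (hF : Smooth F) :
    value hP (-F) t X = -value hP F t X := by
  rw [← neg_one_smul ℝ F, value_smul hP t X _ hF, neg_one_smul]

theorem value_sub {F G : SuperFun n m P} (hF : Smooth F) (hG : Smooth G) :
    value hP (F - G) t X = value hP F t X - value hP G t X := by
  rw [sub_eq_add_neg, value_add hP t X hF hG.neg, value_neg hP t X hG, sub_eq_add_neg]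

theorem value_zero : value hP (0 : SuperFun n m P) t X = 0 := by
  have h := value_smul hP t X 0 (smooth_const (n := n) (m := m) (P := P) 0)
  rw [zero_smul, zero_smul] at h
  exact h

theorem value_sum {ι : Type*} (s : Finset ι) {F : ι → SuperFun n m P} (hF : ∀ i, Smooth (F i)) :
    value hP (∑ i ∈ s, F i) t X = ∑ i ∈ s, value hP (F i) t X := by
  classical
  induction s using Finset.induction_on with
  | empty => exact value_zero hP t X
  | insert i s hi ih =>
    rw [Finset.sum_insert hi, Finset.sum_insert hi, value_add hP t X (hF i)
      (Smooth.sum s fun i _ => hF i), ih]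

variable {X}

theorem value_mul (hX : IsPoint X) {F G : SuperFun n m P} (hF : Smooth F) (hG : Smooth G) :
    value hP (F * G) t X = value hP F t X * value hP G t X := by
  rw [value_eq_taylor hP hF, value_eq_taylor hP hG, value_eq_taylor hP (hF.mul hG),
    ← taylor_mul t hX]
  congr 1
  exact Subtype.ext (funext fun z => rename_mul _ (F z) (G z))

theorem hasParity_displace {ξ : CoordIdx n m → Grassmann P} (hξ : IsPoint ξ) {ε : ZMod 2}
    {F : smoothAlg n m P} (hF : HasParity ε F.1) : HasParity ε (displaceLM ξ F).1 := by
  rw [displaceLM_apply, AddSubmonoidClass.coe_finsetSum]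
  refine HasParity.sum _ fun M _ => ?_
  have h := (hasParity_param (n := n) (m := m) (hξ M)).mul (hF.leftPD M F.2)
  have e : coordParity M + (ε + coordParity M) = ε := by
    rw [add_left_comm, CharTwo.add_self_eq_zero, add_zero]
  rwa [e] at h

theorem hasParity_value (hX : IsPoint X) {ε : ZMod 2} {F : SuperFun n m P} (hF : Smooth F)
    (hε : HasParity ε F) : (value hP F t X).HasParity ε := by
  have h : ∀ k : ℕ, HasParity ε (((displaceLM fun M => (X M).soul) ^ k)
      (⟨F.extend hP, hF.extend hP⟩ : smoothAlg n m P')).1 := fun k => by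
    induction k with
    | zero => exact hε.extend hP
    | succ k ih =>
      rw [pow_succ', Module.End.mul_apply]
      exact hasParity_displace (isPoint_soul hX) ih
  rw [value_eq_taylor hP hF, taylor_apply, evalAt_apply, expDisplace_apply,
    AddSubmonoidClass.coe_finsetSum, Finset.sum_apply]
  exact (Grassmann.HasParity.sum _ fun k _ => (h k _).smul _).restrict _

theorem hasDerivAt_value_line (τ : ℝ) (hX : IsPoint X) {Y : CoordIdx n m → Grassmann P'}
    (hY : IsPoint Y) {F : SuperFun n m P} (hF : Smooth F) :
    HasDerivAt (fun s : ℝ => value hP F (t + s * τ) (X + s • Y))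
      (τ • value hP (timePD F) t X + ∑ M, Y M * value hP (leftPD M F) t X) 0 := by
  have h := hasDerivAt_taylor_line t τ hX hY ⟨F.extend hP, hF.extend hP⟩
  have e1 : dir (1, 0) ⟨F.extend hP, hF.extend hP⟩
      = (⟨(timePD F).extend hP, (hF.dirPD _).extend hP⟩ : smoothAlg n m P') :=
    Subtype.ext (dirPD_extend hP (1, 0) hF)
  have e2 : ∀ M, pd M ⟨F.extend hP, hF.extend hP⟩
      = (⟨(leftPD M F).extend hP, (hF.leftPD M).extend hP⟩ : smoothAlg n m P') := fun M =>
    Subtype.ext (leftPD_extend hP M hF)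
  simp only [e1, e2, ← value_eq_taylor hP hF, ← value_eq_taylor hP (hF.leftPD _)] at h
  rw [← value_eq_taylor hP (F := timePD F) (hF.dirPD _)] at h
  exact h

end Value

/-! ### Smoothness of values -/

/-- Partial derivatives preserve smoothness in parameters. -/
theorem contDiff_leftPD {E : Type*} [NormedAddCommGroup E] [NormedSpace ℝ E]
    {G : E → SuperFun n m P}
    (hG : ContDiff ℝ ∞ fun p : E × (ℝ × (Fin n ⊕ Fin n → ℝ)) => G p.1 p.2) (M : CoordIdx n m) :
    ContDiff ℝ ∞ fun p : E × (ℝ × (Fin n ⊕ Fin n → ℝ)) => leftPD M (G p.1) p.2 := by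
  rcases leftPD_cases M with ⟨_, u, hu⟩ | ⟨_, g, hg⟩
  · simp only [(hu P).1]
    have h : ContDiff ℝ ∞ (Function.uncurry
        fun (p : E × (ℝ × (Fin n ⊕ Fin n → ℝ))) (z : ℝ × (Fin n ⊕ Fin n → ℝ)) => G p.1 z) :=
      hG.comp ((contDiff_fst.comp contDiff_fst).prodMk contDiff_snd)
    exact (ContDiff.fderiv (n := ∞) h contDiff_snd (by simp)).clm_apply contDiff_const
  · simp only [(hg P).1]
    exact contDiff_linear (leftDerivLM (Fin.castAdd P g)) hG

theorem contDiff_displace {E : Type*} [NormedAddCommGroup E] [NormedSpace ℝ E]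
    {ξ : E → CoordIdx n m → Grassmann P} (hξ : ∀ M, ContDiff ℝ ∞ fun e => ξ e M)
    {G : E → SuperFun n m P}
    (hG : ContDiff ℝ ∞ fun p : E × (ℝ × (Fin n ⊕ Fin n → ℝ)) => G p.1 p.2) :
    ContDiff ℝ ∞ fun p : E × (ℝ × (Fin n ⊕ Fin n → ℝ)) => displace (ξ p.1) (G p.1) p.2 :=
  ContDiff.sum fun M _ => contDiff_mul
    (contDiff_linear (renameLM (Fin.natAddOrderEmb (m + m))) ((hξ M).comp contDiff_fst))
    (contDiff_leftPD hG M)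

/-- The value of a smooth function depends smoothly on the time and on the point. -/
theorem contDiff_value (hP : P ≤ P') {F : SuperFun n m P} (hF : Smooth F) :
    ContDiff ℝ ∞ fun p : ℝ × (CoordIdx n m → Grassmann P') => value hP F p.1 p.2 := by
  have hproj : ∀ M, ContDiff ℝ ∞ fun X : CoordIdx n m → Grassmann P' => X M :=
    fun M => contDiff_apply ℝ (Grassmann P') M
  have hsoul : ∀ M, ContDiff ℝ ∞ fun X : CoordIdx n m → Grassmann P' => (X M).soul :=
    fun M => contDiff_linear soulLM (hproj M)
  have h : ∀ k : ℕ, ContDiff ℝ ∞ fun p : (CoordIdx n m → Grassmann P') ×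
      (ℝ × (Fin n ⊕ Fin n → ℝ)) => ((displace (fun M => (p.1 M).soul))^[k] (F.extend hP)) p.2 := by
    intro k
    induction k with
    | zero => exact (show ContDiff ℝ ∞ (F.extend hP) from hF.extend hP).comp contDiff_snd
    | succ k ih =>
      simp only [Function.iterate_succ_apply']
      exact contDiff_displace hsoul
        (G := fun X => (displace (fun M => (X M).soul))^[k] (F.extend hP)) ih
  have hbody : ContDiff ℝ ∞ fun X : CoordIdx n m → Grassmann P' => bodyPoint X := by
    refine contDiff_pi.2 fun i => ?_
    rcases i with i | i
    · exact contDiff_linear (coeff ∅) (hproj (.inl (.inl i)))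
    · exact contDiff_linear (coeff ∅) (hproj (.inr (.inl i)))
  have h2 : ContDiff ℝ ∞ fun p : ℝ × (CoordIdx n m → Grassmann P') =>
      ∑ k ∈ Finset.range (P' + 1), ((k.factorial : ℝ)⁻¹) •
        ((displace (fun M => (p.2 M).soul))^[k] (F.extend hP)) (p.1, bodyPoint p.2) :=
    ContDiff.sum fun k _ => ((h k).comp
      (contDiff_snd.prodMk (contDiff_fst.prodMk (hbody.comp contDiff_snd)))).const_smul _
  exact contDiff_linear (restrict (Fin.natAddOrderEmb (m + m))).toLinearMap h2

theorem contDiff_value_comp {E : Type*} [NormedAddCommGroup E] [NormedSpace ℝ E] (hP : P ≤ P')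
    {F : SuperFun n m P} (hF : Smooth F) {f : E → ℝ × (CoordIdx n m → Grassmann P')}
    (hf : ContDiff ℝ ∞ f) : ContDiff ℝ ∞ fun e => value hP F (f e).1 (f e).2 :=
  ContDiff.comp (g := fun p : ℝ × (CoordIdx n m → Grassmann P') => value hP F p.1 p.2)
    (contDiff_value hP hF) hf

/-- The chain rule along a curve of points. -/
theorem hasDerivAt_value_curve (hP : P ≤ P') {F : SuperFun n m P} (hF : Smooth F) {t : ℝ}
    {X : ℝ → CoordIdx n m → Grassmann P'} {Y : CoordIdx n m → Grassmann P'}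
    (hX : IsPoint (X t)) (hY : IsPoint Y) (hd : ∀ M, HasDerivAt (fun s => X s M) (Y M) t) :
    HasDerivAt (fun s => value hP F s (X s))
      (value hP (timePD F) t (X t) + ∑ M, Y M * value hP (leftPD M F) t (X t)) t := by
  have hf : DifferentiableAt ℝ (fun p : ℝ × (CoordIdx n m → Grassmann P') => value hP F p.1 p.2)
      (t, X t) := (contDiff_value hP hF).differentiable (by simp) _
  have h1 : HasDerivAt (fun s => (s, X s)) ((1 : ℝ), Y) t :=
    (hasDerivAt_id t).prodMk (hasDerivAt_pi.2 hd)
  have h2 : HasDerivAt (fun s => value hP F s (X s))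
      (fderiv ℝ (fun p : ℝ × (CoordIdx n m → Grassmann P') => value hP F p.1 p.2) (t, X t)
        (1, Y)) t := HasFDerivAt.comp_hasDerivAt (f := fun s => (s, X s)) t hf.hasFDerivAt h1
  have h3 : HasDerivAt (fun s : ℝ => (t + s * 1, X t + s • Y)) ((1 : ℝ), Y) 0 := by
    have h4 : HasDerivAt (fun s : ℝ => t + s * 1) 1 0 := by
      simpa using (hasDerivAt_id (0 : ℝ)).const_add t
    have h5 : HasDerivAt (fun s : ℝ => X t + s • Y) Y 0 := by
      simpa using ((hasDerivAt_id (0 : ℝ)).smul_const Y).const_add (X t)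
    exact h4.prodMk h5
  have h4 : HasDerivAt (fun s : ℝ => value hP F (t + s * 1) (X t + s • Y))
      (fderiv ℝ (fun p : ℝ × (CoordIdx n m → Grassmann P') => value hP F p.1 p.2) (t, X t)
        (1, Y)) 0 := by
    have h5 : DifferentiableAt ℝ
        (fun p : ℝ × (CoordIdx n m → Grassmann P') => value hP F p.1 p.2)
        (t + (0 : ℝ) * 1, X t + (0 : ℝ) • Y) := (contDiff_value hP hF).differentiable (by simp) _
    have h6 := h5.hasFDerivAt.comp_hasDerivAt (0 : ℝ) h3
    rw [zero_mul, add_zero, zero_smul, add_zero] at h6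
    exact h6
  rw [h4.unique (hasDerivAt_value_line hP t 1 hX hY hF), one_smul] at h2
  exact h2

/-- The chain rule at a fixed time. -/
theorem hasDerivAt_value_shift (hP : P ≤ P') {F : SuperFun n m P} (hF : Smooth F) (t : ℝ)
    {X Y : CoordIdx n m → Grassmann P'} (hX : IsPoint X) (hY : IsPoint Y) :
    HasDerivAt (fun s : ℝ => value hP F t (X + s • Y))
      (∑ M, Y M * value hP (leftPD M F) t X) 0 := by
  have h := hasDerivAt_value_line hP t 0 hX hY hF
  simpa only [mul_zero, add_zero, zero_smul, zero_add] using h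

/-! ### Existence of solutions -/

/-- The projection onto the points: each coordinate is replaced by its part of the right parity. -/
def pointPart (X : CoordIdx n m → Grassmann P) : CoordIdx n m → Grassmann P :=
  fun M => parityPart (coordParity M) (X M)

theorem isPoint_pointPart (X : CoordIdx n m → Grassmann P) : IsPoint (pointPart X) :=
  fun _ => hasParity_parityPart _ _

theorem IsPoint.pointPart_eq {X : CoordIdx n m → Grassmann P} (hX : IsPoint X) :
    pointPart X = X := funext fun M => (hX M).parityPart_eq

theorem contDiff_pointPart :
    ContDiff ℝ ∞ (pointPart : (CoordIdx n m → Grassmann P) → CoordIdx n m → Grassmann P) :=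
  contDiff_pi.2 fun M => contDiff_linear (parityPart (coordParity M))
    (contDiff_apply ℝ (Grassmann P) M)

/-- Hamilton's equations as an autonomous vector field: the time is adjoined as a coordinate, and
the arguments are projected onto the points. -/
def hamField (hP : P ≤ P') (H : SuperFun n m P) (p : ℝ × (CoordIdx n m → Grassmann P')) :
    ℝ × (CoordIdx n m → Grassmann P') :=
  (1, fun M => value hP (bracket (coord P M) H) p.1 (pointPart p.2))

theorem contDiff_value_pointPart (hP : P ≤ P') {F : SuperFun n m P} (hF : Smooth F) :
    ContDiff ℝ ∞ fun p : ℝ × (CoordIdx n m → Grassmann P') => value hP F p.1 (pointPart p.2) := by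
  have h : ContDiff ℝ ∞ fun p : ℝ × (CoordIdx n m → Grassmann P') => (p.1, pointPart p.2) :=
    contDiff_fst.prodMk (contDiff_pointPart.comp contDiff_snd)
  have h2 := contDiff_value_comp hP hF h
  exact h2

theorem contDiff_hamField (hP : P ≤ P') {H : SuperFun n m P} (hH : Smooth H) :
    ContDiff ℝ ∞ (hamField hP H) :=
  ContDiff.prodMk (f := fun _ => (1 : ℝ)) contDiff_const
    (contDiff_pi.2 fun M => contDiff_value_pointPart hP (smooth_bracket_coord hH M))

/-- Through each point passes a solution of Hamilton's equations. -/
theorem exists_isSolution (hP : P ≤ P') {H : SuperFun n m P} (hH : Smooth H) (hH0 : HasParity 0 H)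
    (t : ℝ) {X₀ : CoordIdx n m → Grassmann P'} (hX₀ : IsPoint X₀) :
    ∃ (a b : ℝ) (X : ℝ → CoordIdx n m → Grassmann P'),
      IsSolution H hP a b X ∧ t ∈ Set.Ioo a b ∧ X t = X₀ := by
  -- The integral curves of `hamField` need not stay among the points, but their projections do, and
  -- the velocity `[x^M, H}` at a point already has the parity of `x^M`.
  have hf1 : ContDiffAt ℝ 1 (hamField hP H) (t, X₀) :=
    ((contDiff_hamField hP hH).of_le (WithTop.coe_le_coe.2 (le_top : (1 : ℕ∞) ≤ ⊤))).contDiffAt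
  obtain ⟨α, hα0, ε, hε, hα⟩ :=
    hf1.exists_forall_mem_closedBall_exists_eq_forall_mem_Ioo_hasDerivAt₀ t
  have ht : t ∈ Set.Ioo (t - ε) (t + ε) := ⟨by linarith, by linarith⟩
  have h1 : ∀ s ∈ Set.Ioo (t - ε) (t + ε), HasDerivAt (fun s => (α s).1) 1 s :=
    fun s hs => (hα s hs).fst
  have h2 : ∀ s ∈ Set.Ioo (t - ε) (t + ε), ∀ M, HasDerivAt (fun s => (α s).2 M)
      (value hP (bracket (coord P M) H) (α s).1 (pointPart (α s).2)) s :=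
    fun s hs => hasDerivAt_pi.1 (hα s hs).snd
  have htime : ∀ s ∈ Set.Ioo (t - ε) (t + ε), (α s).1 = s := by
    have h3 : ∀ s ∈ Set.Ioo (t - ε) (t + ε), HasDerivAt (fun s => (α s).1 - s) 0 s := by
      intro s hs
      have h4 := (h1 s hs).sub (hasDerivAt_id s)
      rw [sub_self] at h4
      exact h4
    intro s hs
    have h4 := isOpen_Ioo.is_const_of_deriv_eq_zero isPreconnected_Ioo
      (fun s hs => (h3 s hs).differentiableAt.differentiableWithinAt)
      (fun s hs => (h3 s hs).deriv) hs ht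
    simp only [hα0, sub_self] at h4
    exact sub_eq_zero.1 h4
  refine ⟨t - ε, t + ε, fun s => pointPart (α s).2,
    ⟨fun s _ => isPoint_pointPart _, fun s hs M => ?_⟩, ht, ?_⟩
  · have h5 := HasFDerivAt.comp_hasDerivAt (f := fun s => (α s).2 M) s
      (LinearMap.toContinuousLinearMap
        (parityPart (r := P') (coordParity M))).hasFDerivAt (h2 s hs M)
    rw [htime s hs] at h5
    have h6 := (hasParity_value hP s (isPoint_pointPart (α s).2) (smooth_bracket_coord hH M)
      (hasParity_bracket_coord hH hH0 M)).parityPart_eq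
    change HasDerivAt (fun s => parityPart (coordParity M) ((α s).2 M))
      (parityPart (coordParity M) _) s at h5
    rwa [h6] at h5
  · change pointPart (α t).2 = X₀
    rw [hα0]
    exact hX₀.pointPart_eq

end SuperFun

namespace SuperFun

open Grassmann

variable {n m P P' : ℕ}

/-! ### Functions are determined by their values -/

theorem displaceLM_coord (ξ : CoordIdx n m → Grassmann P) (M : CoordIdx n m) :
    displaceLM ξ ⟨coord P M, smooth_coord M⟩ = param n m (ξ M) := by
  rw [displaceLM_apply, Finset.sum_eq_single M]
  · have h : pd M ⟨coord P M, smooth_coord M⟩ = (1 : smoothAlg n m P) :=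
      Subtype.ext ((leftPD_coord M M).trans (if_pos rfl))
    rw [h, mul_one]
  · intro N _ hN
    have h : pd N ⟨coord P M, smooth_coord M⟩ = (0 : smoothAlg n m P) :=
      Subtype.ext ((leftPD_coord N M).trans (if_neg hN))
    rw [h, mul_zero]
  · simp

theorem value_eq_taylor_of_extend_eq (hP : P ≤ P') {F : SuperFun n m P} (hF : Smooth F) (t : ℝ)
    (X : CoordIdx n m → Grassmann P') {G : smoothAlg n m P'} (h : F.extend hP = G.1) :
    value hP F t X = taylor t X G := by
  rw [value_eq_taylor hP hF]
  congr 1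
  exact Subtype.ext h

/-- The expansion of a coordinate stops after the linear term. -/
theorem taylor_coord (t : ℝ) (X : CoordIdx n m → Grassmann P) (M : CoordIdx n m) :
    taylor t X ⟨coord P M, smooth_coord M⟩ =
      evalAt (t, bodyPoint X) ⟨coord P M, smooth_coord M⟩ + (X M).soul := by
  rw [taylor_apply, expDisplace_apply]
  have h0 := displaceLM_pow_eq_zero (n := n) (m := m) fun M => body_soul (X M)
  -- adding a vanishing term makes room for the linear one when `P = 0`
  have h1 : ∑ k ∈ Finset.range (P + 1), ((k.factorial : ℝ)⁻¹) •
      ((displaceLM fun M => (X M).soul) ^ k) (⟨coord P M, smooth_coord M⟩ : smoothAlg n m P)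
      = ∑ k ∈ Finset.range (P + 1 + 1), ((k.factorial : ℝ)⁻¹) •
      ((displaceLM fun M => (X M).soul) ^ k) ⟨coord P M, smooth_coord M⟩ := by
    rw [Finset.sum_range_succ _ (P + 1), h0, LinearMap.zero_apply, smul_zero, add_zero]
  have h2 : ∀ k : ℕ, ((displaceLM fun M => (X M).soul) ^ (k + 1 + 1))
      (⟨coord P M, smooth_coord M⟩ : smoothAlg n m P) = 0 := fun k => by
    rw [pow_succ, Module.End.mul_apply, displaceLM_coord, pow_succ, Module.End.mul_apply,
      displaceLM_param, map_zero]
  rw [h1, Finset.sum_range_succ', Finset.sum_range_succ']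
  simp only [h2, smul_zero, Finset.sum_const_zero, zero_add, pow_one, displaceLM_coord,
    Nat.factorial_one, Nat.factorial_zero, Nat.cast_one, inv_one, one_smul, pow_zero,
    Module.End.one_apply, map_add]
  rw [add_comm (evalAt _ _)]
  congr 1
  exact restrict_rename _ _

/-- The point with bosonic coordinates `x` whose fermionic coordinates are new generators. -/
def genericPoint (P : ℕ) (x : Fin n ⊕ Fin n → ℝ) : CoordIdx n m → Grassmann (P + (m + m))
  | .inl (.inl i) => x (.inl i) • 1
  | .inl (.inr μ) => gen (Fin.natAdd P (Fin.castAdd m μ))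
  | .inr (.inl i) => x (.inr i) • 1
  | .inr (.inr μ) => gen (Fin.natAdd P (Fin.natAdd m μ))

variable (x : Fin n ⊕ Fin n → ℝ)

theorem isPoint_genericPoint : IsPoint (genericPoint (m := m) P x) := by
  rintro ((i | μ) | (i | μ))
  · exact hasParity_one.smul _
  · exact hasParity_gen _
  · exact hasParity_one.smul _
  · exact hasParity_gen _

theorem bodyPoint_genericPoint : bodyPoint (genericPoint (m := m) P x) = x := by
  have h : ∀ c : ℝ, (c • (1 : Grassmann (P + (m + m)))).body = c := fun c => by
    rw [body, smul_apply, one_apply, if_pos rfl, mul_one]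
  funext i
  rcases i with i | i
  · exact h _
  · exact h _

theorem soul_gen {r : ℕ} (g : Fin r) : (gen g).soul = gen g := by
  ext I
  rw [soul]
  split_ifs with h
  · rw [h, gen, if_neg]
    exact (Finset.singleton_ne_empty g).symm
  · rfl

theorem soul_smul_one {r : ℕ} (c : ℝ) : (c • (1 : Grassmann r)).soul = 0 := by
  ext I
  rw [soul]
  split_ifs with h
  · rfl
  · rw [smul_apply, one_apply, if_neg h, mul_zero, zero_apply]

theorem restrict_gen_castAdd (g : Fin (m + m)) :
    restrict (Fin.natAddOrderEmb (m + m) : Fin P ↪o Fin (m + m + P)) (gen (Fin.castAdd P g))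
      = 0 := by
  ext I
  rw [restrict_apply, gen_eq_mono, mono_apply_ne]
  · rfl
  · intro h
    have h2 : Fin.castAdd P g ∈ I.map (Fin.natAddOrderEmb (m + m)).toEmbedding := by
      rw [h]
      exact Finset.mem_singleton_self _
    obtain ⟨j, _, hj⟩ := Finset.mem_map.1 h2
    have h3 : m + m + j.val = g.val := congrArg Fin.val hj
    omega

/-- Evaluation at the generic point moves the fermionic coordinates behind the parameters. -/
theorem value_gen (t : ℝ) (a : Fin (m + m + P)) :
    value (Nat.le_add_right P (m + m)) (fun _ => gen a : SuperFun n m P) t (genericPoint P x)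
      = gen (finAddFlip a) := by
  have hc : ∀ M : CoordIdx n m, ∀ g : Fin (m + m),
      (∀ P, coord P M = fun _ => gen (Fin.castAdd P g)) →
      genericPoint P x M = gen (Fin.natAdd P g) →
      value (Nat.le_add_right P (m + m)) (fun _ => gen (Fin.castAdd P g) : SuperFun n m P) t
        (genericPoint P x) = gen (Fin.natAdd P g) := by
    intro M g hM hX
    have h : extend (Nat.le_add_right P (m + m))
        (fun _ => gen (Fin.castAdd P g) : SuperFun n m P) = (⟨coord _ M, smooth_coord M⟩ :
          smoothAlg n m (P + (m + m))).1 := by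
      funext z
      simp only [hM]
      exact rename_gen _ _
    have h2 : evalAt (t, bodyPoint (genericPoint (m := m) P x))
        (⟨coord (P + (m + m)) M, smooth_coord M⟩ : smoothAlg n m (P + (m + m))) = 0 := by
      simp only [hM]
      exact restrict_gen_castAdd g
    rw [value_eq_taylor_of_extend_eq _ (smooth_const _) t _ h, taylor_coord, h2, hX, soul_gen,
      zero_add]
  refine Fin.addCases (fun g => ?_) (fun j => ?_) a
  · rw [finAddFlip_apply_castAdd]
    refine Fin.addCases (fun μ => ?_) (fun μ => ?_) g
    · exact hc (.inl (.inr μ)) _ (fun _ => rfl) rfl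
    · exact hc (.inr (.inr μ)) _ (fun _ => rfl) rfl
  · have h : extend (Nat.le_add_right P (m + m))
        (fun _ => gen (Fin.natAdd (m + m) j) : SuperFun n m P)
        = (param n m (gen (Fin.castAdd (m + m) j))).1 := by
      funext z
      rw [param_coe, rename_gen]
      exact rename_gen _ _
    rw [finAddFlip_apply_natAdd, value_eq_taylor_of_extend_eq _ (smooth_const _) t _ h,
      taylor_param]

theorem value_const_one (hP : P ≤ P') (t : ℝ) (X : CoordIdx n m → Grassmann P') :
    value hP (fun _ => 1 : SuperFun n m P) t X = 1 := by
  have h : extend hP (fun _ => 1 : SuperFun n m P) = (param n m (1 : Grassmann P')).1 := by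
    funext z
    rw [param_coe, rename_one]
    exact rename_one _
  rw [value_eq_taylor_of_extend_eq _ (smooth_const _) t _ h, taylor_param]

/-- Evaluation at the generic point takes each monomial to a nonzero multiple of a monomial, the
factor being the sign of the reordering. -/
theorem value_mono (t : ℝ) (I : Finset (Fin (m + m + P))) :
    ∃ c : ℝ, c ≠ 0 ∧ value (Nat.le_add_right P (m + m)) (fun _ => mono I : SuperFun n m P) t
      (genericPoint P x) = c • mono (I.map finAddFlip.toEmbedding) := by
  induction I using Finset.induction_on_min with
  | empty => exact ⟨1, one_ne_zero, by
      rw [Finset.map_empty, ← one_eq_mono, ← one_eq_mono, one_smul]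
      exact value_const_one _ _ _⟩
  | insert a s hs ih =>
    obtain ⟨c, hc, h⟩ := ih
    have has : a ∉ s := fun h => lt_irrefl _ (hs a h)
    have hd : Disjoint {a} s := Finset.disjoint_singleton_left.2 has
    have h1 : (fun _ => mono (insert a s) : SuperFun n m P)
        = (fun _ => gen a : SuperFun n m P) * (fun _ => mono s : SuperFun n m P) := by
      funext z
      change _ = mono {a} * mono s
      rw [mono_mul_mono, if_pos hd, inversions_singleton_left, Finset.filter_false_of_mem
        (fun j hj => (hs j hj).not_gt), Finset.card_empty, pow_zero, one_smul, Finset.insert_eq]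
    have hd2 : Disjoint {finAddFlip a} (s.map (finAddFlip (m := m + m) (n := P)).toEmbedding) := by
      simpa using has
    refine ⟨c * (-1) ^ inversions {finAddFlip a}
      (s.map (finAddFlip (m := m + m) (n := P)).toEmbedding), mul_ne_zero hc (by simp), ?_⟩
    rw [h1, value_mul _ t (isPoint_genericPoint x) (smooth_const _) (smooth_const _), h,
      value_gen, gen_eq_mono, mul_smul_comm, mono_mul_mono, if_pos hd2, smul_smul,
      Finset.map_insert, Finset.insert_eq]
    rfl

/-- As the bosonic coordinates of the generic point are real, values there involve no derivatives
with respect to bosonic coordinates. -/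
theorem value_genericPoint (t : ℝ) (F : SuperFun n m P) :
    value (Nat.le_add_right P (m + m)) F t (genericPoint P x) =
      value (Nat.le_add_right P (m + m)) (fun _ => F (t, x) : SuperFun n m P) t
        (genericPoint P x) := by
  have key : ∀ z, ∀ F G : SuperFun n m (P + (m + m)), F z = G z →
      displace (fun M => (genericPoint P x M).soul) F z =
        displace (fun M => (genericPoint P x M).soul) G z := by
    intro z F G h
    refine Finset.sum_congr rfl fun M _ => ?_
    rcases leftPD_cases M with ⟨hM, _⟩ | ⟨_, g, hg⟩
    · have h0 : (genericPoint P x M).soul = 0 := by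
        rcases M with (i | μ) | (i | μ)
        · exact soul_smul_one _
        · exact absurd hM one_ne_zero
        · exact soul_smul_one _
        · exact absurd hM one_ne_zero
      change (genericPoint P x M).soul.rename _ * _ = (genericPoint P x M).soul.rename _ * _
      rw [h0, ← renameLM_apply, map_zero, zero_mul, zero_mul]
    · rw [(hg _).1, (hg _).1]
      change _ * leftDeriv _ (F z) = _ * leftDeriv _ (G z)
      rw [h]
  have key2 : ∀ k z, ∀ F G : SuperFun n m (P + (m + m)), F z = G z →
      (displace (fun M => (genericPoint P x M).soul))^[k] F z =
        (displace (fun M => (genericPoint P x M).soul))^[k] G z := by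
    intro k z F G h
    induction k with
    | zero => exact h
    | succ k ih =>
      rw [Function.iterate_succ_apply', Function.iterate_succ_apply']
      exact key z _ _ ih
  unfold value
  funext J
  refine congrFun ?_ (J.map _)
  refine Finset.sum_congr rfl fun k _ => ?_
  congr 1
  refine key2 k _ _ _ ?_
  rw [bodyPoint_genericPoint]
  rfl

theorem coeff_mono_self {r : ℕ} (I : Finset (Fin r)) : coeff I (mono I) = 1 := mono_apply_self I

theorem coeff_mono_ne {r : ℕ} {I J : Finset (Fin r)} (h : J ≠ I) : coeff J (mono I) = 0 :=
  mono_apply_ne h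

/-- A function is determined by its values: at the generic points, its expansion in the fermionic
coordinates and the parameters can be recovered. -/
theorem eq_zero_of_value_eq_zero {F : SuperFun n m P}
    (h : ∀ (P' : ℕ) (hP : P ≤ P') (t : ℝ) (X : CoordIdx n m → Grassmann P'), IsPoint X →
      value hP F t X = 0) : F = 0 := by
  funext z
  obtain ⟨t, x⟩ := z
  ext I
  have h1 := h _ (Nat.le_add_right P (m + m)) t (genericPoint P x) (isPoint_genericPoint x)
  choose c hc hv using value_mono (n := n) (m := m) (P := P) x t
  have h2 : (fun _ => F (t, x) : SuperFun n m P) =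
      ∑ J, coeff J (F (t, x)) • (fun _ => mono J : SuperFun n m P) := by
    funext z
    rw [Finset.sum_apply]
    exact eq_sum_mono _
  rw [value_genericPoint, h2, value_sum _ _ _ _ fun J => (smooth_const _).smul _] at h1
  simp only [value_smul _ _ _ _ (smooth_const _), hv] at h1
  have h3 := congrArg (coeff (I.map finAddFlip.toEmbedding)) h1
  rw [map_sum, Finset.sum_eq_single I, map_zero] at h3
  · rw [map_smul, map_smul, coeff_mono_self] at h3
    exact ((smul_eq_zero.1 h3).resolve_right (by simpa using hc I))
  · intro J _ hJ
    rw [map_smul, map_smul, coeff_mono_ne, smul_zero, smul_zero]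
    exact fun e => hJ (Finset.map_injective _ e).symm
  · simp

end SuperFun

/-! ### Integrals depending on parameters -/

section ParametricIntegral

variable {H : Type} [NormedAddCommGroup H] [NormedSpace ℝ H]

theorem contDiff_uncurry_fderiv {E : Type} [NormedAddCommGroup E] [NormedSpace ℝ E] {k : ℕ}
    {f : H → ℝ → E} (hf : ContDiff ℝ (k + 1) (Function.uncurry f)) :
    ContDiff ℝ k (Function.uncurry fun y s => fderiv ℝ (fun y => f y s) y) := by
  have h : ContDiff ℝ (k + 1) (Function.uncurry fun (p : H × ℝ) (y : H) => f y p.2) :=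
    hf.comp (contDiff_snd.prodMk (contDiff_snd.comp contDiff_fst))
  exact ContDiff.fderiv (n := (k : WithTop ℕ∞)) h contDiff_fst le_rfl

variable [ProperSpace H]

theorem hasFDerivAt_integral_of_contDiff {E : Type} [NormedAddCommGroup E] [NormedSpace ℝ E]
    {f : H → ℝ → E} (hf : ContDiff ℝ 1 (Function.uncurry f)) (y : H) :
    HasFDerivAt (fun y => ∫ s in (0 : ℝ)..1, f y s)
      (∫ s in (0 : ℝ)..1, fderiv ℝ (fun y => f y s) y) y := by
  have hc : Continuous (Function.uncurry f) := hf.continuous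
  have hf1 : ContDiff ℝ ((0 : ℕ) + 1) (Function.uncurry f) := by simpa using hf
  have hc' : Continuous (Function.uncurry fun y s => fderiv ℝ (fun y => f y s) y) :=
    (contDiff_uncurry_fderiv hf1).continuous
  obtain ⟨C, hC⟩ := ((isCompact_closedBall y 1).prod
    (isCompact_Icc (a := (0 : ℝ)) (b := 1))).exists_bound_of_continuousOn hc'.continuousOn
  refine intervalIntegral.hasFDerivAt_integral_of_dominated_of_fderiv_le (bound := fun _ => C)
    (F' := fun y s => fderiv ℝ (fun y => f y s) y)
    (Metric.closedBall_mem_nhds y one_pos) ?_ ?_ ?_ ?_ ?_ ?_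
  · exact Filter.Eventually.of_forall fun x =>
      (hc.comp (Continuous.prodMk_right x)).aestronglyMeasurable
  · exact (hc.comp (Continuous.prodMk_right y)).intervalIntegrable _ _
  · exact (hc'.comp (Continuous.prodMk_right y)).aestronglyMeasurable
  · refine Filter.Eventually.of_forall fun s hs x hx => hC (x, s) ⟨hx, ?_⟩
    rw [Set.uIoc_of_le zero_le_one] at hs
    exact Set.Ioc_subset_Icc_self hs
  · exact intervalIntegrable_const
  · refine Filter.Eventually.of_forall fun s _ x _ => ?_
    have h1 : ContDiff ℝ 1 fun y => f y s := hf.comp (contDiff_prodMk_left s)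
    exact (h1.differentiable (by simp) x).hasFDerivAt

theorem contDiff_integral_nat (k : ℕ) {E : Type} [NormedAddCommGroup E] [NormedSpace ℝ E]
    {f : H → ℝ → E} (hf : ContDiff ℝ k (Function.uncurry f)) :
    ContDiff ℝ k fun y => ∫ s in (0 : ℝ)..1, f y s := by
  induction k generalizing E with
  | zero =>
    rw [Nat.cast_zero, contDiff_zero] at hf ⊢
    exact intervalIntegral.continuous_parametric_intervalIntegral_of_continuous' hf 0 1
  | succ k ih =>
    rw [Nat.cast_succ] at hf ⊢
    refine contDiff_succ_iff_hasFDerivAt.2 ⟨_, ih (contDiff_uncurry_fderiv hf), fun y => ?_⟩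
    exact hasFDerivAt_integral_of_contDiff (hf.of_le (by simp)) y

theorem contDiff_integral {E : Type} [NormedAddCommGroup E] [NormedSpace ℝ E]
    {f : H → ℝ → E} (hf : ContDiff ℝ ∞ (Function.uncurry f)) :
    ContDiff ℝ ∞ fun y => ∫ s in (0 : ℝ)..1, f y s :=
  contDiff_infty.2 fun k => contDiff_integral_nat k (contDiff_infty.1 hf k)

end ParametricIntegral

/-! ### The Poincaré lemma -/

section Poincare

variable {κ : Type} [Fintype κ]

/-- The potential of a closed form `∑_i η_i dx^i` that depends on a further real parameter. -/
def potential (η : κ → ℝ × (κ → ℝ) → ℝ) (z : ℝ × (κ → ℝ)) : ℝ :=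
  ∫ s in (0 : ℝ)..1, ∑ i, z.2 i * η i (z.1, s • z.2)

theorem contDiff_potential_integrand {η : κ → ℝ × (κ → ℝ) → ℝ} (hη : ∀ i, ContDiff ℝ ∞ (η i)) :
    ContDiff ℝ ∞ (Function.uncurry fun (z : ℝ × (κ → ℝ)) (s : ℝ) =>
      ∑ i, z.2 i * η i (z.1, s • z.2)) := by
  have h1 : ContDiff ℝ ∞ fun p : (ℝ × (κ → ℝ)) × ℝ => (p.1.1, p.2 • p.1.2) :=
    (contDiff_fst.comp contDiff_fst).prodMk
      (contDiff_snd.smul (contDiff_snd.comp contDiff_fst))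
  have h2 : ∀ i, ContDiff ℝ ∞ fun p : (ℝ × (κ → ℝ)) × ℝ => p.1.2 i := fun i =>
    (contDiff_apply ℝ ℝ i).comp (contDiff_snd.comp contDiff_fst)
  exact ContDiff.sum fun i _ => (h2 i).mul ((hη i).comp h1)

theorem contDiff_potential {η : κ → ℝ × (κ → ℝ) → ℝ} (hη : ∀ i, ContDiff ℝ ∞ (η i)) :
    ContDiff ℝ ∞ (potential η) :=
  contDiff_integral (contDiff_potential_integrand hη)

/-- By closedness, the derivative of the integrand is `d/ds (s η_i(t, s x))`. -/
theorem fderiv_potential [DecidableEq κ] {η : κ → ℝ × (κ → ℝ) → ℝ} (hη : ∀ i, ContDiff ℝ ∞ (η i))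
    (hclosed : ∀ i j z, fderiv ℝ (η j) z (0, Pi.single i 1) = fderiv ℝ (η i) z (0, Pi.single j 1))
    (z : ℝ × (κ → ℝ)) (i : κ) : fderiv ℝ (potential η) z (0, Pi.single i 1) = η i z := by
  have hint := contDiff_potential_integrand hη
  have hdiff : ∀ i z, HasFDerivAt (η i) (fderiv ℝ (η i) z) z := fun i z =>
    ((hη i).differentiable (by simp) z).hasFDerivAt
  have h1 := hasFDerivAt_integral_of_contDiff
    (hint.of_le (WithTop.coe_le_coe.2 (le_top : (1 : ℕ∞) ≤ ⊤))) z
  have hcont : Continuous fun s : ℝ => fderiv ℝ (fun z : ℝ × (κ → ℝ) =>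
      ∑ i, z.2 i * η i (z.1, s • z.2)) z := by
    have h2 : ContDiff ℝ ((0 : ℕ) + 1) (Function.uncurry fun (z : ℝ × (κ → ℝ)) (s : ℝ) =>
      ∑ i, z.2 i * η i (z.1, s • z.2)) :=
        hint.of_le (by simp)
    exact (contDiff_uncurry_fderiv h2).continuous.comp (Continuous.prodMk_right z)
  have h3 : ∀ s : ℝ, fderiv ℝ (fun z : ℝ × (κ → ℝ) => ∑ i, z.2 i * η i (z.1, s • z.2)) z
      (0, Pi.single i 1) = η i (z.1, s • z.2) + s * fderiv ℝ (η i) (z.1, s • z.2) (0, z.2) := by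
    intro s
    have h4 : HasFDerivAt (fun z : ℝ × (κ → ℝ) => (z.1, s • z.2))
        ((ContinuousLinearMap.fst ℝ ℝ (κ → ℝ)).prod (s • ContinuousLinearMap.snd ℝ ℝ (κ → ℝ))) z :=
      ((ContinuousLinearMap.fst ℝ ℝ (κ → ℝ)).prod
        (s • ContinuousLinearMap.snd ℝ ℝ (κ → ℝ))).hasFDerivAt
    have h5 : ∀ j, HasFDerivAt (fun z : ℝ × (κ → ℝ) => z.2 j)
        ((ContinuousLinearMap.proj (R := ℝ) (φ := fun _ : κ => ℝ) j).comp
          (ContinuousLinearMap.snd ℝ ℝ (κ → ℝ))) z := fun j =>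
      ((ContinuousLinearMap.proj (R := ℝ) (φ := fun _ : κ => ℝ) j).comp
          (ContinuousLinearMap.snd ℝ ℝ (κ → ℝ))).hasFDerivAt
    have h6 := HasFDerivAt.fun_sum (u := Finset.univ) fun j (_ : j ∈ Finset.univ) =>
      (h5 j).mul ((hdiff j (z.1, s • z.2)).comp z h4)
    have h7 : HasFDerivAt (fun z : ℝ × (κ → ℝ) => ∑ i, z.2 i * η i (z.1, s • z.2)) _ z := h6
    rw [h7.fderiv]
    have h8 : ∀ j, fderiv ℝ (η j) (z.1, s • z.2) (0, s • (Pi.single i 1 : κ → ℝ))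
        = s * fderiv ℝ (η i) (z.1, s • z.2) (0, Pi.single j 1) := fun j => by
      rw [← hclosed i j, ← smul_eq_mul, ← map_smul, Prod.smul_mk, smul_zero]
    have h11 : fderiv ℝ (η i) (z.1, s • z.2) (0, z.2) =
        ∑ j, z.2 j * fderiv ℝ (η i) (z.1, s • z.2) (0, Pi.single j 1) := by
      rw [SuperFun.zero_prodMk_eq_sum z.2, map_sum]
      exact Finset.sum_congr rfl fun j _ => map_smul _ _ _
    rw [h11, Finset.mul_sum]
    simp [Finset.sum_add_distrib, h8, Pi.single_apply, add_comm]
    exact Finset.sum_congr rfl fun j _ => by ring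
  have h9 : ∀ s : ℝ, HasDerivAt (fun s : ℝ => s * η i (z.1, s • z.2))
      (η i (z.1, s • z.2) + s * fderiv ℝ (η i) (z.1, s • z.2) (0, z.2)) s := by
    intro s
    have h4 : HasDerivAt (fun s : ℝ => (z.1, s • z.2)) ((0 : ℝ), z.2) s := by
      have h5 := (hasDerivAt_const s z.1).prodMk ((hasDerivAt_id s).smul_const z.2)
      rwa [one_smul] at h5
    have h5 := (hasDerivAt_id s).mul ((hdiff i (z.1, s • z.2)).comp_hasDerivAt s h4)
    rw [one_mul] at h5
    exact h5
  have h10 : HasFDerivAt (potential η) _ z := h1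
  rw [h10.fderiv, ContinuousLinearMap.intervalIntegral_apply (hcont.intervalIntegrable 0 1)]
  simp only [h3]
  have hcont2 : Continuous fun s : ℝ =>
      η i (z.1, s • z.2) + s * fderiv ℝ (η i) (z.1, s • z.2) (0, z.2) := by
    simp only [← h3]
    exact hcont.clm_apply continuous_const
  rw [intervalIntegral.integral_eq_sub_of_hasDerivAt (fun s _ => h9 s)
    (hcont2.intervalIntegrable 0 1)]
  simp

theorem potential_zero {η : κ → ℝ × (κ → ℝ) → ℝ} (hη : ∀ i z, η i z = 0) (z : ℝ × (κ → ℝ)) :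
    potential η z = 0 := by
  simp [potential, hη]

end Poincare

/-! ### The Poincaré lemma on the graded phase space -/

namespace SuperFun

open Grassmann

variable {n m P : ℕ}

/-- The index of a bosonic coordinate. -/
def bosIdx : Fin n ⊕ Fin n → CoordIdx n m
  | .inl i => .inl (.inl i)
  | .inr i => .inr (.inl i)

/-- The index of a fermionic coordinate. -/
def fermIdx (g : Fin (m + m)) : CoordIdx n m :=
  Fin.addCases (fun μ => .inl (.inr μ)) (fun μ => .inr (.inr μ)) g

theorem eq_bosIdx_or_eq_fermIdx (M : CoordIdx n m) :
    (∃ k, M = bosIdx k) ∨ ∃ g, M = fermIdx g := by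
  rcases M with (i | μ) | (i | μ)
  · exact Or.inl ⟨.inl i, rfl⟩
  · exact Or.inr ⟨Fin.castAdd m μ, by simp [fermIdx]⟩
  · exact Or.inl ⟨.inr i, rfl⟩
  · exact Or.inr ⟨Fin.natAdd m μ, by rw [fermIdx, Fin.addCases_right]⟩

theorem leftPD_bosIdx (k : Fin n ⊕ Fin n) (F : SuperFun n m P) :
    leftPD (bosIdx k) F = dirPD (0, Pi.single k 1) F := by
  rcases k with i | i <;> rfl

theorem coordParity_bosIdx (k : Fin n ⊕ Fin n) : coordParity (bosIdx k : CoordIdx n m) = 0 := by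
  rcases k with i | i <;> rfl

theorem leftPD_fermIdx (g : Fin (m + m)) (F : SuperFun n m P) :
    leftPD (fermIdx g) F = fun z => leftDeriv (Fin.castAdd P g) (F z) := by
  refine Fin.addCases (fun μ => ?_) (fun μ => ?_) g
  · rw [fermIdx, Fin.addCases_left]
    rfl
  · rw [fermIdx, Fin.addCases_right]
    rfl

theorem coordParity_fermIdx (g : Fin (m + m)) : coordParity (fermIdx g : CoordIdx n m) = 1 := by
  refine Fin.addCases (fun μ => ?_) (fun μ => ?_) g
  · rw [fermIdx, Fin.addCases_left]
    rfl
  · rw [fermIdx, Fin.addCases_right]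
    rfl

/-- The fermionic coordinates in a monomial. -/
def fermPart (I : Finset (Fin (m + m + P))) : Finset (Fin (m + m)) :=
  Finset.univ.filter fun g => Fin.castAdd P g ∈ I

theorem mem_fermPart {I : Finset (Fin (m + m + P))} {g : Fin (m + m)} :
    g ∈ fermPart I ↔ Fin.castAdd P g ∈ I := by
  simp [fermPart]

/-- The potential of a closed form `∑_M dx^M η_M` on the graded phase space.  If `g` is the first
fermionic coordinate in a monomial `I`, then the coefficient of `I` is determined by the derivative
with respect to `g`, without a sign because the fermionic coordinates precede the parameters.  The
monomials in the parameters alone are treated with the homotopy formula. -/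
def superPotential (η : CoordIdx n m → SuperFun n m P) : SuperFun n m P := fun z I =>
  if h : (fermPart I).Nonempty then
    η (fermIdx ((fermPart I).min' h)) z (I.erase (Fin.castAdd P ((fermPart I).min' h)))
  else potential (fun k z => η (bosIdx k) z I) z

section Potential

variable {η : CoordIdx n m → SuperFun n m P}

theorem superPotential_of_isLeast {I : Finset (Fin (m + m + P))} {g : Fin (m + m)}
    (hg : Fin.castAdd P g ∈ I) (hmin : ∀ h, Fin.castAdd P h ∈ I → g ≤ h)
    (z : ℝ × (Fin n ⊕ Fin n → ℝ)) :
    superPotential η z I = η (fermIdx g) z (I.erase (Fin.castAdd P g)) := by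
  have hne : (fermPart I).Nonempty := ⟨g, mem_fermPart.2 hg⟩
  have he : (fermPart I).min' hne = g :=
    le_antisymm (Finset.min'_le _ _ (mem_fermPart.2 hg))
      (hmin _ (mem_fermPart.1 (Finset.min'_mem _ hne)))
  have h1 : superPotential η z I = η (fermIdx ((fermPart I).min' hne)) z
      (I.erase (Fin.castAdd P ((fermPart I).min' hne))) := dif_pos hne
  rw [h1, he]

theorem exists_isLeast_fermPart {I : Finset (Fin (m + m + P))} (h : (fermPart I).Nonempty) :
    ∃ g, Fin.castAdd P g ∈ I ∧ ∀ h, Fin.castAdd P h ∈ I → g ≤ h :=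
  ⟨(fermPart I).min' h, mem_fermPart.1 (Finset.min'_mem _ h),
    fun _ hh => Finset.min'_le _ _ (mem_fermPart.2 hh)⟩

theorem superPotential_of_fermPart_empty {I : Finset (Fin (m + m + P))}
    (h : ¬ (fermPart I).Nonempty) (z : ℝ × (Fin n ⊕ Fin n → ℝ)) :
    superPotential η z I = potential (fun k z => η (bosIdx k) z I) z := dif_neg h

/-- No generator in `I` precedes its first fermionic coordinate. -/
theorem filter_lt_eq_empty {I J : Finset (Fin (m + m + P))} (hJ : J ⊆ I) {g : Fin (m + m)}
    (hmin : ∀ h, Fin.castAdd P h ∈ I → g ≤ h) :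
    J.filter (fun j => j < Fin.castAdd P g) = ∅ := by
  refine Finset.filter_eq_empty_iff.2 fun j hj hlt => ?_
  have h1 : j.val < g.val := hlt
  have h2 := hmin ⟨j.val, h1.trans g.isLt⟩ (hJ hj)
  exact absurd h1 (not_lt.2 h2)

theorem smooth_superPotential (hs : ∀ M, Smooth (η M)) : Smooth (superPotential η) := by
  have hs' : ∀ M I, ContDiff ℝ ∞ fun z => η M z I := fun M => contDiff_iff_coeff.1 (hs M)
  refine contDiff_iff_coeff.2 fun I => ?_
  by_cases h : (fermPart I).Nonempty
  · obtain ⟨g, hg, hmin⟩ := exists_isLeast_fermPart h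
    simp only [superPotential_of_isLeast hg hmin]
    exact hs' _ _
  · simp only [superPotential_of_fermPart_empty h]
    exact contDiff_potential fun k => hs' _ _

theorem hasParity_superPotential (hp : ∀ M, HasParity (coordParity M) (η M)) :
    HasParity 0 (superPotential η) := fun z => hasParity_iff.2 fun I hI => by
  by_cases h : (fermPart I).Nonempty
  · obtain ⟨g, hg, hmin⟩ := exists_isLeast_fermPart h
    rw [superPotential_of_isLeast hg hmin]
    refine (hp (fermIdx g) z).apply_eq_zero fun h1 => hI ?_
    rw [coordParity_fermIdx] at h1
    rw [← Finset.card_erase_add_one hg, Nat.cast_succ, h1]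
    rfl
  · rw [superPotential_of_fermPart_empty h]
    refine potential_zero (fun k z => (hp (bosIdx k) z).apply_eq_zero ?_) z
    rwa [coordParity_bosIdx]

theorem leftDeriv_fermIdx_closed
    (hclosed : ∀ M N, leftPD M (η N) =
      paritySign (coordParity M * coordParity N) • leftPD N (η M))
    (g h : Fin (m + m)) (z : ℝ × (Fin n ⊕ Fin n → ℝ)) (K : Finset (Fin (m + m + P))) :
    leftDeriv (Fin.castAdd P g) (η (fermIdx h) z) K
      = -leftDeriv (Fin.castAdd P h) (η (fermIdx g) z) K := by
  have h1 := congrFun (congrFun (hclosed (fermIdx g) (fermIdx h)) z) K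
  rw [leftPD_fermIdx, leftPD_fermIdx, coordParity_fermIdx, coordParity_fermIdx, mul_one,
    paritySign_one, neg_one_smul] at h1
  exact h1

/-- A closed form has no component `η_g` containing the generator `g`, since
`∂_g η_g = -∂_g η_g`. -/
theorem fermIdx_apply_eq_zero
    (hclosed : ∀ M N, leftPD M (η N) =
      paritySign (coordParity M * coordParity N) • leftPD N (η M))
    {g : Fin (m + m)} {I : Finset (Fin (m + m + P))} (hg : Fin.castAdd P g ∈ I)
    (z : ℝ × (Fin n ⊕ Fin n → ℝ)) : η (fermIdx g) z I = 0 := by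
  have h1 := leftDeriv_fermIdx_closed hclosed g g z (I.erase (Fin.castAdd P g))
  have h2 := self_eq_neg.1 h1
  rw [leftDeriv_apply_of_notMem (Finset.notMem_erase _ _), Finset.insert_erase hg] at h2
  exact (mul_eq_zero.1 h2).resolve_left (pow_ne_zero _ (by norm_num))

/-- The coefficient of `I` in the potential can be read off from the derivative with respect to any
fermionic coordinate in `I`. -/
theorem superPotential_of_mem
    (hclosed : ∀ M N, leftPD M (η N) =
      paritySign (coordParity M * coordParity N) • leftPD N (η M))
    {g : Fin (m + m)} {I : Finset (Fin (m + m + P))} (hg : Fin.castAdd P g ∈ I)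
    (z : ℝ × (Fin n ⊕ Fin n → ℝ)) :
    superPotential η z I
      = (-1 : ℝ) ^ ((I.erase (Fin.castAdd P g)).filter (fun j => j < Fin.castAdd P g)).card
        * η (fermIdx g) z (I.erase (Fin.castAdd P g)) := by
  obtain ⟨h, hh, hmin⟩ := exists_isLeast_fermPart ⟨g, mem_fermPart.2 hg⟩
  rw [superPotential_of_isLeast hh hmin]
  -- otherwise `h` precedes `g`, and `∂_g η_h = -∂_h η_g` is compared at the monomial without both
  by_cases hgh : g = h
  · subst hgh
    rw [filter_lt_eq_empty (Finset.erase_subset _ _) hmin, Finset.card_empty, pow_zero, one_mul]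
  have hne : Fin.castAdd P h ≠ Fin.castAdd P g := fun e =>
    hgh (Fin.castAdd_injective _ _ e).symm
  have hlt : Fin.castAdd P h < Fin.castAdd P g := lt_of_le_of_ne (hmin g hg) hne
  have hhK : Fin.castAdd P h ∈ I.erase (Fin.castAdd P g) := Finset.mem_erase.2 ⟨hne, hh⟩
  have hgK : Fin.castAdd P g ∈ I.erase (Fin.castAdd P h) := Finset.mem_erase.2 ⟨hne.symm, hg⟩
  have h1 := leftDeriv_fermIdx_closed hclosed g h z
    ((I.erase (Fin.castAdd P g)).erase (Fin.castAdd P h))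
  rw [leftDeriv_apply_of_notMem (g := Fin.castAdd P h) (Finset.notMem_erase _ _),
    Finset.insert_erase hhK, filter_lt_eq_empty
      ((Finset.erase_subset _ _).trans (Finset.erase_subset _ _)) hmin,
    Finset.card_empty, pow_zero, one_mul, Finset.erase_right_comm,
    leftDeriv_apply_of_notMem (Finset.notMem_erase _ _), Finset.insert_erase hgK,
    Finset.erase_right_comm] at h1
  have h2 : ((I.erase (Fin.castAdd P g)).filter (fun j => j < Fin.castAdd P g)).card
      = (((I.erase (Fin.castAdd P g)).erase (Fin.castAdd P h)).filter
          (fun j => j < Fin.castAdd P g)).card + 1 := by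
    have h4 := Finset.filter_insert (fun j => j < Fin.castAdd P g) (Fin.castAdd P h)
      ((I.erase (Fin.castAdd P g)).erase (Fin.castAdd P h))
    rw [Finset.insert_erase hhK, if_pos hlt] at h4
    rw [h4, Finset.card_insert_of_notMem (by simp)]
  have h3 : η (fermIdx g) z (I.erase (Fin.castAdd P g)) = -((-1 : ℝ) ^
      (((I.erase (Fin.castAdd P g)).erase (Fin.castAdd P h)).filter
        (fun j => j < Fin.castAdd P g)).card * η (fermIdx h) z (I.erase (Fin.castAdd P h))) := by
    rw [h1, neg_neg]
  rw [h2, h3, pow_succ, mul_neg_one, neg_mul_neg, ← mul_assoc, ← mul_pow, neg_one_mul, neg_neg,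
    one_pow, one_mul]

/-- The Poincaré lemma on the graded phase space. -/
theorem leftPD_superPotential (hs : ∀ M, Smooth (η M))
    (hclosed : ∀ M N, leftPD M (η N) =
      paritySign (coordParity M * coordParity N) • leftPD N (η M)) (M : CoordIdx n m) :
    leftPD M (superPotential η) = η M := by
  rcases eq_bosIdx_or_eq_fermIdx M with ⟨k, rfl⟩ | ⟨g, rfl⟩
  · have hb : ∀ N z I, fderiv ℝ (fun y => η N y I) z (0, Pi.single k 1)
        = leftPD N (η (bosIdx k)) z I := fun N z I => by
      rw [← dirPD_apply_coeff _ (hs N), ← leftPD_bosIdx, hclosed, coordParity_bosIdx, zero_mul,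
        paritySign_zero, one_smul]
    funext z
    refine Grassmann.ext fun I => ?_
    rw [leftPD_bosIdx, dirPD_apply_coeff _ (smooth_superPotential hs)]
    by_cases h : (fermPart I).Nonempty
    · obtain ⟨g, hg, hmin⟩ := exists_isLeast_fermPart h
      simp only [superPotential_of_isLeast hg hmin]
      rw [hb, leftPD_fermIdx]
      change leftDeriv _ _ _ = _
      rw [leftDeriv_apply_of_notMem (Finset.notMem_erase _ _), Finset.insert_erase hg,
        filter_lt_eq_empty (Finset.erase_subset _ _) hmin, Finset.card_empty, pow_zero, one_mul]
    · simp only [superPotential_of_fermPart_empty h]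
      refine fderiv_potential (η := fun k z => η (bosIdx k) z I)
        (fun k => contDiff_iff_coeff.1 (hs _) I) (fun i j y => ?_) z k
      rw [← dirPD_apply_coeff _ (hs _), ← dirPD_apply_coeff _ (hs _), ← leftPD_bosIdx,
        ← leftPD_bosIdx, hclosed, coordParity_bosIdx, zero_mul, paritySign_zero, one_smul]
  · rw [leftPD_fermIdx]
    funext z
    refine Grassmann.ext fun I => ?_
    by_cases hI : Fin.castAdd P g ∈ I
    · rw [leftDeriv_apply_of_mem hI, fermIdx_apply_eq_zero hclosed hI]
    · rw [leftDeriv_apply_of_notMem hI, superPotential_of_mem hclosed (Finset.mem_insert_self _ _),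
        Finset.erase_insert hI, ← mul_assoc, ← mul_pow, neg_one_mul, neg_neg, one_pow, one_mul]

end Potential

end SuperFun

namespace SuperFun

open Grassmann

variable {n m P : ℕ}

/-! ### Symplectic transformations -/

theorem bracket_add_left {F F' G : SuperFun n m P} (hF : Smooth F) (hF' : Smooth F') :
    bracket (F + F') G = bracket F G + bracket F' G := by
  simp only [bracket, ← Finset.sum_add_distrib]
  refine Finset.sum_congr rfl fun A _ => ?_
  rw [rightPD_add _ hF hF', rightPD_add _ hF hF', add_mul, add_mul, smul_add]
  abel

theorem bracket_smul_left (c : ℝ) {F G : SuperFun n m P} (hF : Smooth F) :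
    bracket (c • F) G = c • bracket F G := by
  simp only [bracket, Finset.smul_sum]
  refine Finset.sum_congr rfl fun A _ => ?_
  rw [rightPD_smul _ c hF, rightPD_smul _ c hF, smul_mul_assoc, smul_mul_assoc, smul_sub,
    smul_comm]

theorem bracket_add_right {F G G' : SuperFun n m P} (hG : Smooth G) (hG' : Smooth G') :
    bracket F (G + G') = bracket F G + bracket F G' := by
  simp only [bracket, ← Finset.sum_add_distrib]
  refine Finset.sum_congr rfl fun A _ => ?_
  rw [leftPD_add _ hG hG', leftPD_add _ hG hG', mul_add, mul_add, smul_add]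
  abel

theorem bracket_smul_right (c : ℝ) {F G : SuperFun n m P} (hG : Smooth G) :
    bracket F (c • G) = c • bracket F G := by
  simp only [bracket, Finset.smul_sum]
  refine Finset.sum_congr rfl fun A _ => ?_
  rw [leftPD_smul _ c hG, leftPD_smul _ c hG, mul_smul_comm, mul_smul_comm, smul_sub, smul_comm]

/-- The condition of first order in `ε`; the bracket of the transformed coordinates is a quadratic
polynomial in `ε`. -/
theorem preservesSymplectic_iff {δx : CoordIdx n m → SuperFun n m P} (hδ : ∀ M, Smooth (δx M)) :
    PreservesSymplectic δx ↔
      ∀ M N, bracket (δx M) (coord P N) + bracket (coord P M) (δx N) = 0 := by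
  have h : ∀ M N z, HasDerivAt
      (fun ε : ℝ => bracket (coord P M + ε • δx M) (coord P N + ε • δx N) z)
      ((bracket (δx M) (coord P N) + bracket (coord P M) (δx N)) z) 0 := by
    intro M N z
    have e : (fun ε : ℝ => bracket (coord P M + ε • δx M) (coord P N + ε • δx N) z) =
        fun ε : ℝ => bracket (coord P M) (coord P N) z
          + (ε • (bracket (δx M) (coord P N) + bracket (coord P M) (δx N)) z
            + (ε * ε) • bracket (δx M) (δx N) z) := by
      funext ε
      rw [bracket_add_left (smooth_coord M) ((hδ M).smul ε), bracket_smul_left ε (hδ M),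
        bracket_add_right (smooth_coord N) ((hδ N).smul ε),
        bracket_add_right (smooth_coord N) ((hδ N).smul ε), bracket_smul_right ε (hδ N),
        bracket_smul_right ε (hδ N)]
      simp only [Pi.add_apply, Pi.smul_apply, smul_add, mul_smul]
      abel
    rw [e]
    have h1 := (hasDerivAt_id (0 : ℝ)).smul_const
      ((bracket (δx M) (coord P N) + bracket (coord P M) (δx N)) z)
    have h2 := ((hasDerivAt_id (0 : ℝ)).mul (hasDerivAt_id (0 : ℝ))).smul_const
      (bracket (δx M) (δx N) z)
    have h3 := (h1.add h2).const_add (bracket (coord P M) (coord P N) z)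
    simp only [id, mul_zero, zero_mul, one_smul, add_zero, zero_smul] at h3
    exact h3
  constructor
  · exact fun hp M N => funext fun z => (h M N z).unique (hp M N z)
  · intro h0 M N z
    have h1 := h M N z
    rw [h0 M N] at h1
    exact h1

/-- An infinitesimal transformation preserves the symplectic structure if and only if the form
obtained by lowering its index is closed, and hence if and only if it is Hamiltonian. -/
theorem preservesSymplectic_iff_exists {δx : CoordIdx n m → SuperFun n m P}
    (hδ : IsTransformation δx) :
    PreservesSymplectic δx ↔ ∃ Q : SuperFun n m P, Smooth Q ∧ HasParity 0 Q ∧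
      ∀ M, δx M = bracket (coord P M) Q := by
  obtain ⟨η, hη⟩ : ∃ η : CoordIdx n m → SuperFun n m P,
      η = fun L => symplSign L.swap • δx L.swap := ⟨_, rfl⟩
  have hηs : ∀ L, Smooth (η L) := fun L => by
    rw [hη]
    exact (hδ.smooth _).smul _
  have hηp : ∀ L, HasParity (coordParity L) (η L) := fun L => by
    have h := (hδ.parity L.swap).smul (symplSign L.swap)
    rw [coordParity_swap] at h
    rw [hη]
    exact h
  have hδη : ∀ M, δx M = symplSign M • η M.swap := fun M => by
    rw [hη]
    simp only [Sum.swap_swap]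
    rw [smul_smul, symplSign_mul_self, one_smul]
  have hclosed : PreservesSymplectic δx ↔ ∀ M N, leftPD M (η N) =
      paritySign (coordParity M * coordParity N) • leftPD N (η M) := by
    have h1 : ∀ M N, bracket (δx M) (coord P N) + bracket (coord P M) (δx N)
        = (symplSign M * symplSign N) • (leftPD M.swap (η N.swap)
          - paritySign (coordParity M * coordParity N) • leftPD N.swap (η M.swap)) := by
      intro M N
      rw [bracket_coord_left, bracket_coord_right, rightPD_eq _ (hδ.parity M), coordParity_swap,
        symplSign_swap, hδη M, hδη N, leftPD_smul _ _ (hηs _), leftPD_smul _ _ (hηs _), smul_sub,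
        smul_smul, smul_smul, smul_smul, smul_smul, sub_eq_add_neg, add_comm, ← neg_smul]
      congr 2
      have h2 : paritySign (coordParity N * (coordParity M + 1))
          = paritySign (coordParity M * coordParity N) * paritySign (coordParity N) := by
        rw [mul_add, mul_one, paritySign_add, mul_comm (coordParity N)]
      rw [h2]
      linear_combination (-(symplSign N * symplSign M *
        paritySign (coordParity M * coordParity N))) * paritySign_mul_self (coordParity N)
    have h3 : ∀ M : CoordIdx n m, symplSign M ≠ 0 := fun M h => by
      simpa [h] using symplSign_mul_self M
    rw [preservesSymplectic_iff hδ.smooth]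
    constructor
    · intro h M N
      have h4 := h M.swap N.swap
      rw [h1, Sum.swap_swap, Sum.swap_swap, coordParity_swap, coordParity_swap] at h4
      exact sub_eq_zero.1 ((smul_eq_zero.1 h4).resolve_left (mul_ne_zero (h3 _) (h3 _)))
    · intro h M N
      rw [h1, h, coordParity_swap, coordParity_swap, sub_self, smul_zero]
  rw [hclosed]
  constructor
  · intro h
    refine ⟨superPotential η, smooth_superPotential hηs, hasParity_superPotential hηp,
      fun M => ?_⟩
    rw [bracket_coord_left, leftPD_superPotential hηs h, hδη]
  · rintro ⟨Q, hQ, -, hδQ⟩ M N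
    have h1 : ∀ L, η L = leftPD L Q := fun L => by
      have h2 : η L = symplSign L.swap • δx L.swap := by rw [hη]
      rw [h2, hδQ, bracket_coord_left, Sum.swap_swap, smul_smul, symplSign_mul_self, one_smul]
    rw [h1, h1]
    exact leftPD_leftPD M N hQ

/-! ### Functions of time -/

theorem smooth_ofTime {c : ℝ → Grassmann P} (hc : ContDiff ℝ ∞ c) : Smooth (ofTime n m c) :=
  contDiff_linear (renameLM (Fin.natAddOrderEmb (m + m))) (hc.comp contDiff_fst)

theorem hasParity_ofTime {c : ℝ → Grassmann P} {ε : ZMod 2} (hc : ∀ t, (c t).HasParity ε) :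
    HasParity ε (ofTime n m c) := fun z => (hc z.1).rename _

theorem ofTime_add (c d : ℝ → Grassmann P) : ofTime n m (c + d) = ofTime n m c + ofTime n m d :=
  funext fun z => map_add (renameLM (Fin.natAddOrderEmb (m + m))) (c z.1) (d z.1)

theorem ofTime_smul (a : ℝ) (c : ℝ → Grassmann P) : ofTime n m (a • c) = a • ofTime n m c :=
  funext fun z => map_smul (renameLM (Fin.natAddOrderEmb (m + m))) a (c z.1)

theorem dirPD_ofTime {c : ℝ → Grassmann P} (hc : ContDiff ℝ ∞ c)
    (v : ℝ × (Fin n ⊕ Fin n → ℝ)) : dirPD v (ofTime n m c) = v.1 • ofTime n m (deriv c) := by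
  funext z
  have h1 : HasDerivAt c (deriv c z.1) z.1 :=
    ((hc.differentiable (by simp)) z.1).hasDerivAt
  have h2 : HasFDerivAt (fun z : ℝ × (Fin n ⊕ Fin n → ℝ) => c z.1) _ z :=
    h1.hasFDerivAt.comp z hasFDerivAt_fst
  have h3 := fderiv_linear_apply
    (renameLM (Fin.natAddOrderEmb (m + m)) : Grassmann P →ₗ[ℝ] Grassmann (m + m + P))
    h2.differentiableAt v
  refine h3.trans ?_
  rw [h2.fderiv]
  exact map_smul (renameLM (Fin.natAddOrderEmb (m + m))) v.1 (deriv c z.1)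

theorem leftPD_ofTime {c : ℝ → Grassmann P} (hc : ContDiff ℝ ∞ c) (M : CoordIdx n m) :
    leftPD M (ofTime n m c) = 0 := by
  rcases leftPD_cases M with ⟨_, u, hu⟩ | ⟨_, g, hg⟩
  · rw [(hu P).1, dirPD_ofTime hc, zero_smul]
  · funext z
    have h := congrFun (leftPD_const_rename M (c z.1)) z
    rw [(hg P).1] at h ⊢
    exact h

theorem timePD_ofTime {c : ℝ → Grassmann P} (hc : ContDiff ℝ ∞ c) :
    timePD (ofTime n m c) = ofTime n m (deriv c) := by
  rw [timePD_eq_dirPD, dirPD_ofTime hc, one_smul]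

/-- A monomial without fermionic coordinates is one in the parameters. -/
theorem exists_map_eq_of_fermPart_empty {J : Finset (Fin (m + m + P))}
    (h : ¬ (fermPart J).Nonempty) :
    ∃ I : Finset (Fin P), I.map (Fin.natAddOrderEmb (m + m)).toEmbedding = J := by
  refine ⟨Finset.univ.filter fun i => Fin.natAdd (m + m) i ∈ J, Finset.ext fun j => ?_⟩
  refine Fin.addCases (fun g => ?_) (fun i => ?_) j
  · refine iff_of_false (fun hj => ?_) fun hj => h ⟨g, mem_fermPart.2 hj⟩
    obtain ⟨i, -, hi⟩ := Finset.mem_map.1 hj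
    have h1 : (m + m) + i.val = g.val := congrArg Fin.val hi
    omega
  · constructor
    · intro hj
      obtain ⟨k, hk, hi⟩ := Finset.mem_map.1 hj
      rw [← hi]
      exact (Finset.mem_filter.1 hk).2
    · exact fun hj => Finset.mem_map.2 ⟨i, Finset.mem_filter.2 ⟨Finset.mem_univ _, hj⟩, rfl⟩

/-- A function whose partial derivatives vanish depends on the time alone. -/
theorem exists_eq_ofTime {K : SuperFun n m P} (hs : Smooth K) (hp : HasParity 0 K)
    (h : ∀ M, leftPD M K = 0) :
    ∃ k : ℝ → Grassmann P, ContDiff ℝ ∞ k ∧ (∀ t, (k t).HasParity 0) ∧ K = ofTime n m k := by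
  have h1 : ∀ z u, fderiv ℝ K z (0, u) = 0 := by
    intro z u
    rw [zero_prodMk_eq_sum, map_sum]
    refine Finset.sum_eq_zero fun k _ => ?_
    rw [map_smul]
    have h2 := congrFun (h (bosIdx k)) z
    rw [leftPD_bosIdx] at h2
    have h3 : fderiv ℝ K z (0, Pi.single k 1) = 0 := h2
    rw [h3, smul_zero]
  have h2 : ∀ t x, K (t, x) = K (t, 0) := by
    intro t x
    have hd : ∀ x, HasFDerivAt (fun x : Fin n ⊕ Fin n → ℝ => K (t, x))
        ((fderiv ℝ K (t, x)).comp (ContinuousLinearMap.inr ℝ ℝ _)) x := fun x =>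
      (hs.differentiableAt (t, x)).hasFDerivAt.comp x (hasFDerivAt_prodMk_right t x)
    refine is_const_of_fderiv_eq_zero (𝕜 := ℝ) (fun x => (hd x).differentiableAt) (fun x => ?_) x 0
    rw [(hd x).fderiv]
    exact ContinuousLinearMap.ext fun u => h1 (t, x) u
  have h3 : ∀ z J, (fermPart J).Nonempty → K z J = 0 := by
    rintro z J ⟨g, hg⟩
    have hg' := mem_fermPart.1 hg
    have h4 := congrFun (congrFun (h (fermIdx g)) z) (J.erase (Fin.castAdd P g))
    rw [leftPD_fermIdx] at h4
    change leftDeriv _ _ _ = 0 at h4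
    rw [leftDeriv_apply_of_notMem (Finset.notMem_erase _ _), Finset.insert_erase hg'] at h4
    exact (mul_eq_zero.1 h4).resolve_left (pow_ne_zero _ (by norm_num))
  refine ⟨fun t => restrict (Fin.natAddOrderEmb (m + m)) (K (t, 0)), ?_, ?_, ?_⟩
  · exact contDiff_linear (restrict (Fin.natAddOrderEmb (m + m))).toLinearMap
      (ContDiff.comp hs (contDiff_id.prodMk contDiff_const))
  · exact fun t => (hp (t, 0)).restrict _
  · funext z
    obtain ⟨t, x⟩ := z
    rw [h2]
    refine Grassmann.ext fun J => ?_
    change _ = rename _ (restrict _ (K (t, 0))) J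
    by_cases hJ : (fermPart J).Nonempty
    · rw [h3 _ _ hJ, rename_apply_of_ne]
      rintro I rfl
      obtain ⟨g, hg⟩ := hJ
      obtain ⟨i, -, hi⟩ := Finset.mem_map.1 (mem_fermPart.1 hg)
      have h1 : (m + m) + i.val = g.val := congrArg Fin.val hi
      omega
    · obtain ⟨I, rfl⟩ := exists_map_eq_of_fermPart_empty hJ
      rw [rename_apply_map, restrict_apply]

theorem exists_antideriv {k : ℝ → Grassmann P} (hk : ContDiff ℝ ∞ k)
    (hp : ∀ t, (k t).HasParity 0) :
    ∃ c : ℝ → Grassmann P, ContDiff ℝ ∞ c ∧ (∀ t, (c t).HasParity 0) ∧ deriv c = k := by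
  have hk' := contDiff_iff_coeff.1 hk
  obtain ⟨c, hc⟩ : ∃ c : ℝ → Grassmann P, ∀ t I, c t I = ∫ s in (0 : ℝ)..t, k s I :=
    ⟨fun t I => ∫ s in (0 : ℝ)..t, k s I, fun _ _ => rfl⟩
  have hd : ∀ t, HasDerivAt c (k t) t := fun t =>
    hasDerivAt_pi (E' := fun _ : Finset (Fin P) => ℝ) |>.2 fun I => by
      simp only [hc]
      exact ((hk' I).continuous.integral_hasStrictDerivAt 0 t).hasDerivAt
  have he : deriv c = k := funext fun t => (hd t).deriv
  refine ⟨c, ?_, fun t => hasParity_iff.2 fun I hI => ?_, he⟩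
  · refine contDiff_infty_iff_deriv.2 ⟨fun t => (hd t).differentiableAt, ?_⟩
    rwa [he]
  · have h0 : ∀ s, k s I = 0 := fun s => (hp s).apply_eq_zero hI
    rw [hc]
    simp only [h0, intervalIntegral.integral_zero]

end SuperFun

namespace SuperFun

open Grassmann

variable {n m P P' : ℕ}

theorem bracket_ofTime_left {c : ℝ → Grassmann P} (hc : ContDiff ℝ ∞ c)
    (hp : ∀ t, (c t).HasParity 0) (F : SuperFun n m P) : bracket (ofTime n m c) F = 0 := by
  rw [bracket_eq_neg_hamDer (hasParity_ofTime hp), neg_eq_zero]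
  refine Finset.sum_eq_zero fun M _ => ?_
  rw [bracket_coord_left, leftPD_ofTime hc, smul_zero, zero_mul]

theorem leftPD_eq_zero_iff_bracket_coord_eq_zero {K : SuperFun n m P} :
    (∀ M, leftPD M K = 0) ↔ ∀ M, bracket (coord P M) K = 0 := by
  simp only [bracket_coord_left]
  constructor
  · intro h M
    rw [h, smul_zero]
  · intro h M
    have h1 := h M.swap
    rw [Sum.swap_swap] at h1
    refine (smul_eq_zero.1 h1).resolve_left fun h2 => ?_
    simpa [h2] using symplSign_mul_self M.swap

/-! ### The action of a Hamiltonian transformation on functions and on solutions -/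

theorem shift_eq (δx : CoordIdx n m → SuperFun n m P) (hP : P ≤ P') (ε t : ℝ)
    (X : CoordIdx n m → Grassmann P') :
    shift δx hP ε t X = X + ε • fun M => value hP (δx M) t X := rfl

theorem isPoint_value_bracket_coord {Q : SuperFun n m P} (hs : Smooth Q) (hp : HasParity 0 Q)
    (hP : P ≤ P') (t : ℝ) {X : CoordIdx n m → Grassmann P'} (hX : IsPoint X) :
    IsPoint fun M => value hP (bracket (coord P M) Q) t X := fun M =>
  hasParity_value hP t hX (smooth_bracket_coord hs M) (hasParity_bracket_coord hs hp M)

theorem sum_value_bracket_coord_mul {Q F : SuperFun n m P} (hQ : Smooth Q) (hF : Smooth F)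
    (hP : P ≤ P') (t : ℝ) {X : CoordIdx n m → Grassmann P'} (hX : IsPoint X) :
    ∑ M : CoordIdx n m, value hP (bracket (coord P M) Q) t X * value hP (leftPD M F) t X
      = value hP (hamDer Q F) t X := by
  rw [hamDer, value_sum hP t X _ fun M => (smooth_bracket_coord hQ M).mul (hF.leftPD M)]
  exact Finset.sum_congr rfl fun M _ =>
    (value_mul hP t hX (smooth_bracket_coord hQ M) (hF.leftPD M)).symm

/-- The infinitesimal change of `F` under the transformation generated by `Q`. -/
theorem hasDerivAt_value_shift_bracket {Q F : SuperFun n m P} (hs : Smooth Q)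
    (hp : HasParity 0 Q) (hF : Smooth F) (hP : P ≤ P') (t : ℝ)
    {X : CoordIdx n m → Grassmann P'} (hX : IsPoint X) :
    HasDerivAt (fun ε => value hP F t (shift (fun M => bracket (coord P M) Q) hP ε t X))
      (value hP (hamDer Q F) t X) 0 := by
  rw [← sum_value_bracket_coord_mul hs hF hP t hX]
  exact hasDerivAt_value_shift hP hF t hX (isPoint_value_bracket_coord hs hp hP t hX)

/-- The rate of change of `F` along a solution. -/
theorem IsSolution.hasDerivAt_value {H F : SuperFun n m P} (hs : Smooth H) (hp : HasParity 0 H)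
    (hF : Smooth F) {hP : P ≤ P'} {a b : ℝ} {X : ℝ → CoordIdx n m → Grassmann P'}
    (hX : IsSolution H hP a b X) {t : ℝ} (ht : t ∈ Set.Ioo a b) :
    HasDerivAt (fun s => value hP F s (X s)) (value hP (timePD F + hamDer H F) t (X t)) t := by
  have h : Smooth (timePD F) := hF.dirPD _
  rw [value_add hP t _ h (smooth_hamDer hs hF),
    ← sum_value_bracket_coord_mul hs hF hP t (hX.isPoint t ht)]
  exact hasDerivAt_value_curve hP hF (hX.isPoint t ht)
    (isPoint_value_bracket_coord hs hp hP t (hX.isPoint t ht)) (hX.motion t ht)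

/-- The Jacobi identity for a coordinate, `Q` and `H`. -/
theorem bracket_coord_defect {Q H : SuperFun n m P} (hQs : Smooth Q) (hQ : HasParity 0 Q)
    (hHs : Smooth H) (hH : HasParity 0 H) (M : CoordIdx n m) :
    bracket (coord P M) (bracket Q H + timePD Q) =
      timePD (bracket (coord P M) Q) + hamDer H (bracket (coord P M) Q)
        - hamDer Q (bracket (coord P M) H) := by
  have h1 : Smooth (bracket Q H) := by
    rw [bracket_eq_neg_hamDer hQ]
    exact (smooth_hamDer hQs hHs).neg
  simp only [timePD_eq_dirPD]
  rw [bracket_coord_add h1 (hQs.dirPD _), bracket_coord_left, leftPD_bracket hQs hQ hHs hH,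
    bracket_coord_left, bracket_coord_left, bracket_coord_left, leftPD_dirPD _ _ hQs,
    dirPD_smul _ _ (hQs.leftPD _), hamDer_smul _ _ (hQs.leftPD _), hamDer_smul _ _ (hHs.leftPD _),
    smul_sub]
  abel

/-- The velocity of a solution of `H` shifted by the transformation generated by `Q`. -/
theorem hasDerivAt_shift_bracket {Q H : SuperFun n m P} (hQs : Smooth Q)
    (hHs : Smooth H) (hH : HasParity 0 H) {hP : P ≤ P'} {a b : ℝ}
    {X : ℝ → CoordIdx n m → Grassmann P'} (hX : IsSolution H hP a b X) {t : ℝ}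
    (ht : t ∈ Set.Ioo a b) (M : CoordIdx n m) (ε : ℝ) :
    HasDerivAt (fun s => shift (fun M => bracket (coord P M) Q) hP ε s (X s) M)
      (value hP (bracket (coord P M) H) t (X t) + ε •
        value hP (timePD (bracket (coord P M) Q) + hamDer H (bracket (coord P M) Q)) t (X t))
      t := by
  have h1 := hX.hasDerivAt_value hHs hH (smooth_bracket_coord hQs M) ht
  have h2 := (hX.motion t ht M).add (h1.fun_const_smul ε)
  exact h2

/-- To first order, a shifted solution of `H` fails to solve the equations of motion of
`H + ε G` by `[x^M, [Q, H} + ∂_t Q - G}`. -/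
theorem hasDerivAt_defect {Q H G : SuperFun n m P} (hQs : Smooth Q) (hQ : HasParity 0 Q)
    (hHs : Smooth H) (hH : HasParity 0 H) (hG : Smooth G) {hP : P ≤ P'} {a b : ℝ}
    {X : ℝ → CoordIdx n m → Grassmann P'} (hX : IsSolution H hP a b X) {t : ℝ}
    (ht : t ∈ Set.Ioo a b) (M : CoordIdx n m) :
    HasDerivAt (fun ε : ℝ => (value hP (bracket (coord P M) H) t (X t) + ε •
        value hP (timePD (bracket (coord P M) Q) + hamDer H (bracket (coord P M) Q)) t (X t))
        - value hP (bracket (coord P M) (H + ε • G)) t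
          (shift (fun M => bracket (coord P M) Q) hP ε t (X t)))
      (value hP (bracket (coord P M) (bracket Q H + timePD Q - G)) t (X t)) 0 := by
  have hB : ∀ {F : SuperFun n m P}, Smooth F → Smooth (bracket (coord P M) F) :=
    fun hF => smooth_bracket_coord hF M
  have hK : Smooth (bracket Q H + timePD Q) := by
    rw [bracket_eq_neg_hamDer hQ]
    exact (smooth_hamDer hQs hHs).neg.add (hQs.dirPD _)
  have e1 : (fun ε : ℝ => value hP (bracket (coord P M) (H + ε • G)) t
      (shift (fun M => bracket (coord P M) Q) hP ε t (X t))) = fun ε : ℝ =>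
      value hP (bracket (coord P M) H) t (shift (fun M => bracket (coord P M) Q) hP ε t (X t))
      + ε • value hP (bracket (coord P M) G) t
          (shift (fun M => bracket (coord P M) Q) hP ε t (X t)) := by
    funext ε
    rw [bracket_coord_add hHs (hG.smul ε), bracket_coord_smul ε hG,
      value_add hP t _ (hB hHs) ((hB hG).smul ε), value_smul hP t _ ε (hB hG)]
  have h1 := hasDerivAt_value_shift_bracket hQs hQ (hB hHs) hP t (hX.isPoint t ht)
  have h2 := (hasDerivAt_id (0 : ℝ)).fun_smul
    (hasDerivAt_value_shift_bracket hQs hQ (hB hG) hP t (hX.isPoint t ht))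
  have h3 := (h1.fun_add h2).congr_of_eventuallyEq (Filter.EventuallyEq.of_eq e1)
  have h4 := ((hasDerivAt_id (0 : ℝ)).smul_const (value hP (timePD (bracket (coord P M) Q)
    + hamDer H (bracket (coord P M) Q)) t (X t))).const_add
      (value hP (bracket (coord P M) H) t (X t))
  have h5 := h4.fun_sub h3
  have e2 : shift (fun M => bracket (coord P M) Q) hP 0 t (X t) = X t := by
    rw [shift_eq, zero_smul, add_zero]
  rw [e2] at h5
  simp only [id, zero_smul, zero_add, one_smul] at h5
  rw [bracket_coord_sub hK hG, bracket_coord_defect hQs hQ hHs hH,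
    value_sub hP t _ ?_ (hB hG), value_sub hP t _ ?_ (smooth_hamDer hQs (hB hHs)), sub_sub]
  · exact h5
  · exact ((hB hQs).dirPD _).add (smooth_hamDer hHs (hB hQs))
  · exact (((hB hQs).dirPD _).add (smooth_hamDer hHs (hB hQs))).sub (smooth_hamDer hQs (hB hHs))

end SuperFun

/-! ### Total Hamiltonian systems -/

namespace TotalHamiltonianSystem

open SuperFun

open scoped Grassmann

variable {n m P : ℕ} (S : TotalHamiltonianSystem n m P)

theorem smooth_firstClass (i : Fin S.numFirstClass) : Smooth (S.firstClass i) :=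
  Smooth.sum _ fun k _ => (S.phi_smooth _).mul (S.V_smooth k i)

theorem hasParity_firstClass (i : Fin S.numFirstClass) :
    HasParity (S.fcParity i) (S.firstClass i) :=
  HasParity.sum _ fun k _ => by
    have h := (S.phi_parity (.inl k)).mul (S.V_parity k i)
    rwa [← add_assoc, CharTwo.add_self_eq_zero, zero_add] at h

variable {v δv : Fin S.numFirstClass → ℝ → Grassmann P}
  {w δw : S.ConstraintIdx → S.ConstraintIdx → ℝ → Grassmann P}

theorem smooth_gaugeTerms (h : S.IsLocalParam v w) : Smooth (S.gaugeTerms v w) :=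
  (Smooth.sum _ fun i _ => (S.smooth_firstClass i).mul (smooth_ofTime (h.v_smooth i))).add
    ((Smooth.sum _ fun k _ => Smooth.sum _ fun k' _ =>
      ((S.phi_smooth k).mul (S.phi_smooth k')).mul (smooth_ofTime (h.w_smooth k k'))).smul _)

theorem hasParity_gaugeTerms (h : S.IsLocalParam v w) : HasParity 0 (S.gaugeTerms v w) := by
  refine (HasParity.sum _ fun i _ => ?_).add
    ((HasParity.sum _ fun k _ => HasParity.sum _ fun k' _ => ?_).smul _)
  · have h1 := (S.hasParity_firstClass i).mul (hasParity_ofTime (n := n) (m := m) (h.v_parity i))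
    rwa [CharTwo.add_self_eq_zero] at h1
  · have h1 := ((S.phi_parity k).mul (S.phi_parity k')).mul
      (hasParity_ofTime (n := n) (m := m) (h.w_parity k k'))
    rwa [CharTwo.add_self_eq_zero] at h1

theorem smooth_totalHam (h : S.IsLocalParam v w) : Smooth (S.totalHam v w) :=
  (S.ham_smooth.add (Smooth.sum _ fun k _ => (S.phi_smooth _).mul (S.U_smooth k))).add
    (S.smooth_gaugeTerms h)

theorem hasParity_totalHam (h : S.IsLocalParam v w) : HasParity 0 (S.totalHam v w) := by
  refine (S.ham_even.add (HasParity.sum _ fun k _ => ?_)).add (S.hasParity_gaugeTerms h)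
  have h1 := (S.phi_parity (.inl k)).mul (S.U_parity k)
  rwa [CharTwo.add_self_eq_zero] at h1

theorem totalHam_add_smul (v δv : Fin S.numFirstClass → ℝ → Grassmann P)
    (w δw : S.ConstraintIdx → S.ConstraintIdx → ℝ → Grassmann P) (ε : ℝ) :
    S.totalHam (v + ε • δv) (w + ε • δw) = S.totalHam v w + ε • S.gaugeTerms δv δw := by
  have h : S.gaugeTerms (v + ε • δv) (w + ε • δw)
      = S.gaugeTerms v w + ε • S.gaugeTerms δv δw := by
    simp only [gaugeTerms, Pi.add_apply, Pi.smul_apply, ofTime_add, ofTime_smul, mul_add,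
      mul_smul_comm, Finset.sum_add_distrib, smul_add, ← Finset.smul_sum]
    rw [smul_comm (1 / 2 : ℝ) ε]
    exact add_add_add_comm _ _ _ _
  rw [totalHam, totalHam, h]
  exact (add_assoc _ _ _).symm

/-- The transformation generated by `Q` takes solutions to solutions if and only if the function
`[Q, H_T} + ∂_t Q` differs from gauge terms by a function with vanishing partial derivatives: a
solution of `H_T` passes through each point, and a smooth function that vanishes at all
Grassmann-valued points is zero. -/
theorem preservesSolutions_bracket_iff (hvw : S.IsLocalParam v w) {Q : SuperFun n m P}
    (hs : Smooth Q) (hp : HasParity 0 Q) :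
    S.PreservesSolutions v w (fun M => bracket (coord P M) Q) ↔
      ∃ (δv : Fin S.numFirstClass → ℝ → Grassmann P)
        (δw : S.ConstraintIdx → S.ConstraintIdx → ℝ → Grassmann P), S.IsLocalParam δv δw ∧
        ∀ M, leftPD M (bracket Q (S.totalHam v w) + timePD Q - S.gaugeTerms δv δw) = 0 := by
  have hHs := S.smooth_totalHam hvw
  have hHp := S.hasParity_totalHam hvw
  refine exists_congr fun δv => exists_congr fun δw => and_congr_right fun hδ => ?_
  rw [leftPD_eq_zero_iff_bracket_coord_eq_zero]
  simp only [totalHam_add_smul]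
  constructor
  · intro h M
    refine eq_zero_of_value_eq_zero fun P' hP t X₀ hX₀ => ?_
    obtain ⟨a, b, X, hX, ht, rfl⟩ := exists_isSolution hP hHs hHp t hX₀
    obtain ⟨Y', hY, hd⟩ := h P' hP a b X hX t ht M
    have hY' := funext fun ε => (hY ε).unique (hasDerivAt_shift_bracket hs hHs hHp hX ht M ε)
    subst hY'
    exact (hasDerivAt_defect hs hp hHs hHp (S.smooth_gaugeTerms hδ) hX ht M).unique hd
  · intro h P' hP a b X hX t ht M
    refine ⟨_, hasDerivAt_shift_bracket hs hHs hHp hX ht M, ?_⟩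
    have h1 := hasDerivAt_defect hs hp hHs hHp (S.smooth_gaugeTerms hδ) hX ht M
    rw [h M, value_zero] at h1
    exact h1

/-- Both conditions say that the derivative of `φ_h` along the transformation vanishes. -/
theorem preservesSurface_bracket_iff {Q : SuperFun n m P} (hs : Smooth Q) (hp : HasParity 0 Q) :
    S.PreservesSurface v w (fun M => bracket (coord P M) Q) ↔ S.IsFirstClassOnShell v w Q := by
  refine forall_congr' fun P' => forall_congr' fun hP => forall_congr' fun a =>
    forall_congr' fun b => forall_congr' fun X => forall_congr' fun hX => forall_congr' fun t =>
    forall_congr' fun ht => forall_congr' fun _ => forall_congr' fun h => ?_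
  have h1 := hasDerivAt_value_shift_bracket hs hp (S.phi_smooth h) hP t (hX.isPoint t ht)
  rw [bracket_eq_neg_hamDer hp, value_neg hP t _ (smooth_hamDer hs (S.phi_smooth h)),
    neg_eq_zero]
  constructor
  · exact fun h2 => h1.unique h2
  · intro h2
    rw [h2] at h1
    exact h1

/-- The functions with vanishing partial derivatives are those of time, and they have smooth
antiderivatives: they can be absorbed in the generator. -/
theorem exists_ofTime_iff (hvw : S.IsLocalParam v w) {Q : SuperFun n m P}
    (hs : Smooth Q) (hp : HasParity 0 Q) (hδ : S.IsLocalParam δv δw) :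
    (∀ M, leftPD M (bracket Q (S.totalHam v w) + timePD Q - S.gaugeTerms δv δw) = 0) ↔
      ∃ c : ℝ → Grassmann P, ContDiff ℝ ∞ c ∧ (∀ t, (c t).HasParity 0) ∧
        bracket (Q + ofTime n m c) (S.totalHam v w) + timePD (Q + ofTime n m c)
          = S.gaugeTerms δv δw := by
  have hHs := S.smooth_totalHam hvw
  have hHp := S.hasParity_totalHam hvw
  have hsum : ∀ c : ℝ → Grassmann P, ContDiff ℝ ∞ c → (∀ t, (c t).HasParity 0) →
      bracket (Q + ofTime n m c) (S.totalHam v w) + timePD (Q + ofTime n m c)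
        = bracket Q (S.totalHam v w) + timePD Q + ofTime n m (deriv c) := by
    intro c hc hcp
    have h1 : timePD (Q + ofTime n m c) = timePD Q + timePD (ofTime n m c) :=
      dirPD_add _ hs (smooth_ofTime hc)
    rw [bracket_add_left hs (smooth_ofTime hc), bracket_ofTime_left hc hcp, h1, timePD_ofTime hc,
      add_zero]
    exact (add_assoc _ _ _).symm
  constructor
  · intro h
    have hKs : Smooth (bracket Q (S.totalHam v w) + timePD Q - S.gaugeTerms δv δw) := by
      rw [bracket_eq_neg_hamDer hp]
      exact ((smooth_hamDer hs hHs).neg.add (hs.dirPD _)).sub (S.smooth_gaugeTerms hδ)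
    have hKp : HasParity 0 (bracket Q (S.totalHam v w) + timePD Q - S.gaugeTerms δv δw) := by
      rw [bracket_eq_neg_hamDer hp]
      exact ((hasParity_hamDer hs hp hHs hHp).neg.add (hp.dirPD _ hs)).sub
        (S.hasParity_gaugeTerms hδ)
    obtain ⟨k, hk, hkp, hK⟩ := exists_eq_ofTime hKs hKp h
    have hk' : ContDiff ℝ ∞ ((-1 : ℝ) • k) := hk.const_smul (-1 : ℝ)
    obtain ⟨c, hc, hcp, hd⟩ := exists_antideriv hk' fun t => (hkp t).smul _
    refine ⟨c, hc, hcp, ?_⟩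
    rw [hsum c hc hcp, hd, ofTime_smul, ← hK, neg_one_smul]
    abel
  · rintro ⟨c, hc, hcp, h⟩ M
    rw [hsum c hc hcp] at h
    have h1 : bracket Q (S.totalHam v w) + timePD Q - S.gaugeTerms δv δw
        = (-1 : ℝ) • ofTime n m (deriv c) := by
      rw [← h, neg_one_smul]
      abel
    have hc' : ContDiff ℝ ∞ (deriv c) := (contDiff_infty_iff_deriv.1 hc).2
    rw [h1, leftPD_smul _ _ (smooth_ofTime hc'), leftPD_ofTime hc', smul_zero]

end TotalHamiltonianSystem

end

open SuperFun in
theorem mainTheorem2 (n m P : ℕ) (S : TotalHamiltonianSystem n m P)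
    (v : Fin S.numFirstClass → ℝ → Grassmann P)
    (w : S.ConstraintIdx → S.ConstraintIdx → ℝ → Grassmann P)
    (hvw : S.IsLocalParam v w) :
    -- the symplectic transformations are the ones generated by a function
    (∀ δx : CoordIdx n m → SuperFun n m P, IsTransformation δx →
      (PreservesSymplectic δx ↔
        ∃ Q : SuperFun n m P, Smooth Q ∧ HasParity 0 Q ∧
          ∀ M, δx M = bracket (coord P M) Q)) ∧
    -- a symmetry generator is first-class on-shell
    (∀ Q : SuperFun n m P, Smooth Q → HasParity 0 Q →
      S.IsSymmetryGenerator v w Q → S.IsFirstClassOnShell v w Q) ∧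
    -- the criterion, up to the addition of a function of time to the generator
    (∀ Q : SuperFun n m P, Smooth Q → HasParity 0 Q → S.IsFirstClassOnShell v w Q →
      (S.IsSymmetryGenerator v w Q ↔
        ∃ c : ℝ → Grassmann P, ContDiff ℝ ∞ c ∧ (∀ t, (c t).HasParity 0) ∧
          ∃ (δv : Fin S.numFirstClass → ℝ → Grassmann P)
            (δw : S.ConstraintIdx → S.ConstraintIdx → ℝ → Grassmann P),
            S.IsLocalParam δv δw ∧
            bracket (Q + ofTime n m c) (S.totalHam v w) + timePD (Q + ofTime n m c)
              = S.gaugeTerms δv δw)) := by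
  refine ⟨fun δx hδ => preservesSymplectic_iff_exists hδ,
    fun Q hs hp h => (S.preservesSurface_bracket_iff hs hp).1 h.surface,
    fun Q hs hp hQ => ⟨fun h => ?_, ?_⟩⟩
  · obtain ⟨δv, δw, hδ, hK⟩ := (S.preservesSolutions_bracket_iff hvw hs hp).1 h.solutions
    obtain ⟨c, hc, hcp, hcK⟩ := (S.exists_ofTime_iff hvw hs hp hδ).1 hK
    exact ⟨c, hc, hcp, δv, δw, hδ, hcK⟩
  · rintro ⟨c, hc, hcp, δv, δw, hδ, hcK⟩
    have ht : IsTransformation (fun M => bracket (coord P M) Q) :=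
      ⟨smooth_bracket_coord hs, hasParity_bracket_coord hs hp⟩
    exact ⟨ht, (preservesSymplectic_iff_exists ht).2 ⟨Q, hs, hp, fun _ => rfl⟩,
      (S.preservesSolutions_bracket_iff hvw hs hp).2
        ⟨δv, δw, hδ, (S.exists_ofTime_iff hvw hs hp hδ).2 ⟨c, hc, hcp, hcK⟩⟩,
      (S.preservesSurface_bracket_iff hs hp).2 hQ⟩
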